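/- **Setting.** Let $d\in\{2,3\}$, let $\Omega\subset\mathbb R^d$ be a bounded domain with smooth boundary $\Gamma$, let $\Omega_0\subset\Omega$ be open, and let $P=L^2(\Omega_0)$ or $P=H^1(\Omega_0)$. Let $g_1,g_2\in L^\infty(\Gamma)$ be exact data for which there is an *exact source* in $P$, i.e. a $p\in P$ such that for some $u\in H^1(\Omega)$, in the weak sense, $$-\Delta u+u=p\,\chi_{\Omega_0}\ \text{in }\Omega,\qquad u=g_1,\quad \partial u/\partial\mathbf n=g_2\ \text{on }\Gamma .$$ For boundary data $g=(g_1^\delta,g_2^\delta)\in L^\infty(\Gamma)^2$ and $p\in P$ let $u(p)=u_{re}(p)+iu_{im}(p)\in H^1(\Omega;\mathbb C)$ be the weak solution of $$-\Delta u+u=p\,\chi_{\Omega_0}\ \text{in }\Omega,\qquad \partial u/\partial\mathbf n+iu=g_2^\delta+ig_1^\delta\ \text{on }\Gamma,$$ and let $w(p)=w_{re}(p)+iw_{im}(p)$ be the weak solution of $-\Delta w+w=u_{im}(p)$ in $\Omega$, $\partial w/\partial\mathbf n+iw=0$ on $\Gamma$. **Flow.** Let either $t_0=0$ and $\eta(t)\equiv\eta\ge1$,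 or $t_0=1$ and $\eta(t)=r/t$ with $r>3$. Let $p_0,\dot p_0\in P$. The SOAR flow for the data $(g_1^\delta,g_2^\delta)$ is the solution $p^\delta:[t_0,\infty)\to P$ of $$(\ddot p^\delta(t)+\eta(t)\dot p^\delta(t),h)_P+\int_{\Omega_0}w_{im}(p^\delta(t))\,h\,dx=0\quad\text{for all } h\in P,\ t>t_0,\qquad p^\delta(t_0)=p_0,\quad \dot p^\delta(t_0)=\dot p_0,$$ that is, $\ddot p^\delta+\eta\dot p^\delta+\nabla V(p^\delta)=0$ with $\nabla V$ the gradient in $P$ of $V(p)=\frac12\|u_{im}(p)\|_{0,\Omega}^2$; for $P=L^2(\Omega_0)$ it reads $\ddot p^\delta+\eta\dot p^\delta+w_{im}=0$ in $\Omega_0$. **Discrepancy functions.** Let $C_0>0$ be a constant (depending on $\Omega$) such that for all $\delta>0$ and all $h_1,h_2\in L^\infty(\Gamma)$ with $\|h_j\|_{\infty,\Gamma}\le\delta$, the weak solution $v$ of $-\Delta v+v=0$ in $\Omega$, $\partial v/\partial\mathbf n+iv=h_2+ih_1$ on $\Gamma$ satisfies $\|v_{im}\|_{0,\Omega}\le C_0\delta$.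 Let $\tau>1$. For $T\ge t_0$ put $$\chi(T)=\|u_{im}(p^\delta(T))\|_{0,\Omega}-C_0\tau\delta,\qquad \chi_{TE}(T)=\|u_{im}(p^\delta(T))\|_{0,\Omega}^2+\|\dot p^\delta(T)\|_P^2-C_0^2\tau^2\delta^2 .$$ **Theorem (convergence for noisy data).** Consider sequences $\delta_n>0$ with $\delta_n\to0$ and noisy data $g_1^{\delta_n},g_2^{\delta_n}\in L^\infty(\Gamma)$ with $\|g_j^{\delta_n}-g_j\|_{\infty,\Gamma}\le\delta_n$ $(j=1,2)$, and let $p^{\delta_n}$ be the corresponding flows. 1. There is an exact source $p^\dagger\in P$, not depending on the noisy data, such that for all such sequences: (a) if $T_n^*$ is a root of $\chi_{TE}$ for each $n$, then $p^{\delta_n}(T^*_n)\rightharpoonup p^\dagger$ weakly in $P$; (b) if $\dot p_0$ is orthogonal in $P$ to all differences of exact sources (e.g. $\dot p_0=0$) and $T_n^*$ is any root of $\chi$ for each $n$, then $p^{\delta_n}(T^*_n)\rightharpoonup p^\dagger$ weakly in $P$. 2. There is an exact source $p^\dagger\in P$, not depending on the noisy data, such that for all such sequences: if $T_n^*$ is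 the smallest root of $\chi$ for each $n$, then $p^{\delta_n}(T^*_n)\rightharpoonup p^\dagger$ weakly in $P$. 3. If $T_n^*$ is an arbitrary root of $\chi$ for each $n$, then some subsequence of $(p^{\delta_n}(T^*_n))$ converges weakly in $P$ to an exact source (hence every subsequence has such a further subsequence). -/

import Mathlib

open MeasureTheory Filter Topology Set
open scoped ENNReal ContDiff

noncomputable section

/-- The space `ℝᵈ` with its Euclidean norm. -/
abbrev Eucl (d : ℕ) : Type := EuclideanSpace ℝ (Fin d)

/-- A bounded domain (nonempty, open, connected) with `C^∞` boundary: near each of its boundary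
points it is the sublevel set `{ρ < 0}` of a smooth function `ρ` with nonvanishing differential. -/
structure IsSmoothBoundedDomain {d : ℕ} (Ω : Set (Eucl d)) : Prop where
  isOpen : IsOpen Ω
  isConnected : IsConnected Ω
  isBounded : Bornology.IsBounded Ω
  smooth_boundary : ∀ x ∈ frontier Ω, ∃ U : Set (Eucl d), IsOpen U ∧ x ∈ U ∧
    ∃ ρ : Eucl d → ℝ, ContDiff ℝ ∞ ρ ∧ fderiv ℝ ρ x ≠ 0 ∧ Ω ∩ U = {y ∈ U | ρ y < 0}

/-- The surface measure on `Γ = ∂Ω`: the `(d-1)`-dimensional Hausdorff measure (normalised so that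
it agrees with Lebesgue measure on hyperplanes), restricted to `∂Ω`. -/
def surfaceMeasure {d : ℕ} (Ω : Set (Eucl d)) : Measure (Eucl d) :=
  Measure.restrict (Measure.euclideanHausdorffMeasure (d - 1)) (frontier Ω)

/-- `G` is the weak gradient of `u` on `Ω`: `∫_Ω u ∂ᵢφ = - ∫_Ω Gᵢ φ` for all `φ ∈ C_c^∞(Ω)`. -/
def IsWeakGradient {𝕜 : Type} [RCLike 𝕜] {d : ℕ} (Ω : Set (Eucl d))
    (u : Eucl d → 𝕜) (G : Eucl d → EuclideanSpace 𝕜 (Fin d)) : Prop :=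
  ∀ φ : Eucl d → ℝ, ContDiff ℝ ∞ φ → HasCompactSupport φ → tsupport φ ⊆ Ω → ∀ i : Fin d,
    ∫ x in Ω, (fderiv ℝ φ x (EuclideanSpace.single i 1)) • u x = - ∫ x in Ω, φ x • G x i

lemma integrable_testFun_smul {𝕜 : Type} [RCLike 𝕜] {d : ℕ} {Ω : Set (Eucl d)}
    {φ : Eucl d → ℝ} (hc : Continuous φ) (hs : HasCompactSupport φ)
    {u : Eucl d → 𝕜} (hu : MemLp u 2 (volume.restrict Ω)) :
    Integrable (fun x => φ x • u x) (volume.restrict Ω) :=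
  memLp_one_iff_integrable.1
    (hu.smul (p := 2) (q := 2) (r := 1) (hc.memLp_of_hasCompactSupport hs))

lemma memLp_coord {𝕜 : Type} [RCLike 𝕜] {d : ℕ} {μ : Measure (Eucl d)}
    {G : Eucl d → EuclideanSpace 𝕜 (Fin d)} (hG : MemLp G 2 μ) (i : Fin d) :
    MemLp (fun x => G x i) 2 μ :=
  (EuclideanSpace.proj (𝕜 := 𝕜) i).comp_memLp' hG

lemma integrable_testFun_fderiv_smul {𝕜 : Type} [RCLike 𝕜] {d : ℕ} {Ω : Set (Eucl d)}
    {φ : Eucl d → ℝ} (hφ : ContDiff ℝ ∞ φ) (hs : HasCompactSupport φ) (i : Fin d)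
    {u : Eucl d → 𝕜} (hu : MemLp u 2 (volume.restrict Ω)) :
    Integrable (fun x => (fderiv ℝ φ x (EuclideanSpace.single i 1)) • u x)
      (volume.restrict Ω) :=
  integrable_testFun_smul
    ((hφ.continuous_fderiv (by simp)).clm_apply continuous_const)
    (hs.fderiv_apply (𝕜 := ℝ) (EuclideanSpace.single i 1)) hu

/-- The Sobolev space `H¹(Ω; 𝕜)`, realised as the space of pairs `(u, ∇u)` in
`L²(Ω; 𝕜) × L²(Ω; 𝕜ᵈ)` with `∇u` the weak gradient of `u`; the inner product inherited from the
product is `(u, v)_{0,Ω} + (∇u, ∇v)_{0,Ω}`. -/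
def SobolevH1 (𝕜 : Type) [RCLike 𝕜] {d : ℕ} (Ω : Set (Eucl d)) :
    Submodule 𝕜 (WithLp 2 (Lp 𝕜 2 (volume.restrict Ω) ×
      Lp (EuclideanSpace 𝕜 (Fin d)) 2 (volume.restrict Ω))) where
  carrier := {z | IsWeakGradient Ω z.fst z.snd}
  zero_mem' := by
    intro φ hφ hs _ i
    have h1 : ∫ x in Ω, (fderiv ℝ φ x (EuclideanSpace.single i 1)) •
        ((0 : Lp 𝕜 2 (volume.restrict Ω)) x) = 0 := by
      apply integral_eq_zero_of_ae
      filter_upwards [Lp.coeFn_zero 𝕜 2 (volume.restrict Ω)] with x hx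
      rw [hx, Pi.zero_apply, smul_zero]
    have h2 : ∫ x in Ω, φ x •
        ((0 : Lp (EuclideanSpace 𝕜 (Fin d)) 2 (volume.restrict Ω)) x) i = 0 := by
      apply integral_eq_zero_of_ae
      filter_upwards [Lp.coeFn_zero (EuclideanSpace 𝕜 (Fin d)) 2 (volume.restrict Ω)] with x hx
      rw [hx, Pi.zero_apply, PiLp.zero_apply, smul_zero, Pi.zero_apply]
    exact h1.trans (by rw [← neg_zero, ← h2]; rfl)
  add_mem' := by
    intro a b ha hb φ hφ hs ht i
    have h1 : ∫ x in Ω, (fderiv ℝ φ x (EuclideanSpace.single i 1)) • ((a.fst + b.fst :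
        Lp 𝕜 2 (volume.restrict Ω)) x) =
        (∫ x in Ω, (fderiv ℝ φ x (EuclideanSpace.single i 1)) • a.fst x) +
        ∫ x in Ω, (fderiv ℝ φ x (EuclideanSpace.single i 1)) • b.fst x := by
      rw [← integral_add (integrable_testFun_fderiv_smul hφ hs i (Lp.memLp a.fst))
        (integrable_testFun_fderiv_smul hφ hs i (Lp.memLp b.fst))]
      apply integral_congr_ae
      filter_upwards [Lp.coeFn_add a.fst b.fst] with x hx
      rw [hx, Pi.add_apply, smul_add]
    have h2 : ∫ x in Ω, φ x • ((a.snd + b.snd :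
        Lp (EuclideanSpace 𝕜 (Fin d)) 2 (volume.restrict Ω)) x) i =
        (∫ x in Ω, φ x • a.snd x i) + ∫ x in Ω, φ x • b.snd x i := by
      rw [← integral_add
        (integrable_testFun_smul hφ.continuous hs (memLp_coord (Lp.memLp a.snd) i))
        (integrable_testFun_smul hφ.continuous hs (memLp_coord (Lp.memLp b.snd) i))]
      apply integral_congr_ae
      filter_upwards [Lp.coeFn_add a.snd b.snd] with x hx
      rw [hx, Pi.add_apply, PiLp.add_apply, smul_add]
    have h3 := ha φ hφ hs ht i
    have h4 := hb φ hφ hs ht i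
    calc _ = _ := h1
      _ = _ := by rw [h3, h4, ← neg_add, ← h2]; rfl
  smul_mem' := by
    intro c a ha φ hφ hs ht i
    have h1 : ∫ x in Ω, (fderiv ℝ φ x (EuclideanSpace.single i 1)) • ((c • a.fst :
        Lp 𝕜 2 (volume.restrict Ω)) x) =
        c * ∫ x in Ω, (fderiv ℝ φ x (EuclideanSpace.single i 1)) • a.fst x := by
      rw [← integral_const_mul]
      apply integral_congr_ae
      filter_upwards [Lp.coeFn_smul c a.fst] with x hx
      rw [hx, Pi.smul_apply, smul_eq_mul, mul_smul_comm]
    have h2 : ∫ x in Ω, φ x • ((c • a.snd :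
        Lp (EuclideanSpace 𝕜 (Fin d)) 2 (volume.restrict Ω)) x) i =
        c * ∫ x in Ω, φ x • a.snd x i := by
      rw [← integral_const_mul]
      apply integral_congr_ae
      filter_upwards [Lp.coeFn_smul c a.snd] with x hx
      rw [hx, Pi.smul_apply, PiLp.smul_apply, smul_eq_mul, mul_smul_comm]
    have h3 := ha φ hφ hs ht i
    calc _ = _ := h1
      _ = _ := by rw [h3, mul_neg, ← h2]; rfl

/-- The function underlying an element of `H¹(Ω; 𝕜)`, as an element of `L²(Ω; 𝕜)`. -/
def SobolevH1.toL2 {𝕜 : Type} [RCLike 𝕜] {d : ℕ} {Ω : Set (Eucl d)} (u : SobolevH1 𝕜 Ω) :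
    Lp 𝕜 2 (volume.restrict Ω) :=
  (u : WithLp 2 (Lp 𝕜 2 (volume.restrict Ω) ×
    Lp (EuclideanSpace 𝕜 (Fin d)) 2 (volume.restrict Ω))).fst

/-- `v ∈ L²(Γ)` is the trace on `Γ = ∂Ω` of `u ∈ H¹(Ω)`. The trace is the continuous extension of
the restriction `φ|_Ω ↦ φ|_Γ` of functions `φ` that are smooth up to the boundary; that is, its
graph is the closure in `H¹(Ω) × L²(Γ)` of the set of all pairs `(φ|_Ω, φ|_Γ)`. -/
def HasTrace {𝕜 : Type} [RCLike 𝕜] {d : ℕ} {Ω : Set (Eucl d)}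
    (u : SobolevH1 𝕜 Ω) (v : Lp 𝕜 2 (surfaceMeasure Ω)) : Prop :=
  (u, v) ∈ closure {z : SobolevH1 𝕜 Ω × Lp 𝕜 2 (surfaceMeasure Ω) |
    ∃ φ : Eucl d → 𝕜, ContDiff ℝ ∞ φ ∧
      SobolevH1.toL2 z.1 =ᵐ[volume.restrict Ω] φ ∧ z.2 =ᵐ[surfaceMeasure Ω] φ}

/-- `u ∈ H¹(Ω; ℂ)` is the weak solution of `-Δu + u = f` in `Ω`, `∂u/∂n + i u = g` on `Γ`:
`∫_Ω (∇u·∇ψ̄ + u ψ̄) + i ∫_Γ u ψ̄ = ∫_Ω f ψ̄ + ∫_Γ g ψ̄` for all `ψ ∈ H¹(Ω; ℂ)`. (The first integral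
is the inner product of `H¹(Ω; ℂ)`, which is conjugate-linear in its first slot here.) -/
def IsRobinSolution {d : ℕ} (Ω : Set (Eucl d)) (f g : Eucl d → ℂ) (u : SobolevH1 ℂ Ω) : Prop :=
  ∃ u' : Lp ℂ 2 (surfaceMeasure Ω), HasTrace u u' ∧
    ∀ (ψ : SobolevH1 ℂ Ω) (ψ' : Lp ℂ 2 (surfaceMeasure Ω)), HasTrace ψ ψ' →
      inner ℂ ψ u + Complex.I * ∫ x, u' x * star (ψ' x) ∂(surfaceMeasure Ω) =
        (∫ x in Ω, f x * star (SobolevH1.toL2 ψ x)) + ∫ x, g x * star (ψ' x) ∂(surfaceMeasure Ω)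

/-- `‖u_im‖_{0,Ω}`, the `L²(Ω)` norm of the imaginary part of `u`. -/
def imNorm {d : ℕ} {Ω : Set (Eucl d)} (u : SobolevH1 ℂ Ω) : ℝ :=
  Real.sqrt (∫ x in Ω, (SobolevH1.toL2 u x).im ^ 2)

/-- The two choices of the solution space `P`: `L²(Ω₀)` and `H¹(Ω₀)`. -/
inductive SourceKind where
  | L2
  | H1

/-- The (real Hilbert) solution space `P = L²(Ω₀)` or `P = H¹(Ω₀)`. -/
def SourceSpace {d : ℕ} (k : SourceKind) (Ω₀ : Set (Eucl d)) : Type :=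
  match k with
  | .L2 => Lp ℝ 2 (volume.restrict Ω₀)
  | .H1 => SobolevH1 ℝ Ω₀

instance {d : ℕ} (k : SourceKind) (Ω₀ : Set (Eucl d)) : NormedAddCommGroup (SourceSpace k Ω₀) :=
  match k with
  | .L2 => inferInstanceAs (NormedAddCommGroup (Lp ℝ 2 (volume.restrict Ω₀)))
  | .H1 => inferInstanceAs (NormedAddCommGroup (SobolevH1 ℝ Ω₀))

instance {d : ℕ} (k : SourceKind) (Ω₀ : Set (Eucl d)) : InnerProductSpace ℝ (SourceSpace k Ω₀) :=
  match k with
  | .L2 => inferInstanceAs (InnerProductSpace ℝ (Lp ℝ 2 (volume.restrict Ω₀)))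
  | .H1 => inferInstanceAs (InnerProductSpace ℝ (SobolevH1 ℝ Ω₀))

/-- The function on `Ω₀` underlying an element of `P`. -/
def SourceSpace.toL2 {d : ℕ} {k : SourceKind} {Ω₀ : Set (Eucl d)} (p : SourceSpace k Ω₀) :
    Lp ℝ 2 (volume.restrict Ω₀) :=
  match k, p with
  | .L2, p => p
  | .H1, p => SobolevH1.toL2 (𝕜 := ℝ) p

/-- The source term `p χ_{Ω₀}`, a function on `ℝᵈ`. -/
def SourceSpace.extend {d : ℕ} {k : SourceKind} {Ω₀ : Set (Eucl d)} (p : SourceSpace k Ω₀) :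
    Eucl d → ℝ :=
  Set.indicator Ω₀ (p.toL2 : Eucl d → ℝ)

/-- `p` is an exact source for the Cauchy data `(g₁, g₂)`: for some `u ∈ H¹(Ω)`,
`-Δu + u = p χ_{Ω₀}` in `Ω` with `u = g₁` and `∂u/∂n = g₂` on `Γ`, in the weak sense. -/
def IsExactSource {d : ℕ} {k : SourceKind} (Ω : Set (Eucl d)) {Ω₀ : Set (Eucl d)}
    (g₁ g₂ : Eucl d → ℝ) (p : SourceSpace k Ω₀) : Prop :=
  ∃ (u : SobolevH1 ℝ Ω) (u' : Lp ℝ 2 (surfaceMeasure Ω)),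
    HasTrace u u' ∧ u' =ᵐ[surfaceMeasure Ω] g₁ ∧
    ∀ (ψ : SobolevH1 ℝ Ω) (ψ' : Lp ℝ 2 (surfaceMeasure Ω)), HasTrace ψ ψ' →
      inner ℝ u ψ =
        (∫ x in Ω, p.extend x * SobolevH1.toL2 ψ x) + ∫ x, g₂ x * ψ' x ∂(surfaceMeasure Ω)

/-- `u = u(p)` is the weak solution of the coupled complex boundary problem
`-Δu + u = p χ_{Ω₀}` in `Ω`, `∂u/∂n + i u = g₂ + i g₁` on `Γ`. -/
def IsState {d : ℕ} {k : SourceKind} (Ω : Set (Eucl d)) {Ω₀ : Set (Eucl d)}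
    (g₁ g₂ : Eucl d → ℝ) (p : SourceSpace k Ω₀) (u : SobolevH1 ℂ Ω) : Prop :=
  IsRobinSolution Ω (fun x => (p.extend x : ℂ)) (fun x => (g₂ x : ℂ) + Complex.I * (g₁ x : ℂ)) u

/-- `w` is the weak solution of the adjoint problem
`-Δw + w = u_im` in `Ω`, `∂w/∂n + i w = 0` on `Γ`. -/
def IsAdjointState {d : ℕ} (Ω : Set (Eucl d)) (u w : SobolevH1 ℂ Ω) : Prop :=
  IsRobinSolution Ω (fun x => ((SobolevH1.toL2 u x).im : ℂ)) 0 w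

/-- `C₀` is an admissible constant `C₀(Ω)` in the discrepancy principles: perturbing the exact
boundary data in `L^∞(Γ)` by at most `δ` contributes at most `C₀ δ` to `‖u_im‖_{0,Ω}`. -/
def IsNoiseConstant {d : ℕ} (Ω : Set (Eucl d)) (C₀ : ℝ) : Prop :=
  0 < C₀ ∧ ∀ (δ : ℝ) (h₁ h₂ : Eucl d → ℝ), 0 < δ →
    MemLp h₁ ∞ (surfaceMeasure Ω) → MemLp h₂ ∞ (surfaceMeasure Ω) →
    eLpNorm h₁ ∞ (surfaceMeasure Ω) ≤ ENNReal.ofReal δ →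
    eLpNorm h₂ ∞ (surfaceMeasure Ω) ≤ ENNReal.ofReal δ →
    ∀ v : SobolevH1 ℂ Ω,
      IsRobinSolution Ω 0 (fun x => (h₂ x : ℂ) + Complex.I * (h₁ x : ℂ)) v → imNorm v ≤ C₀ * δ

/-- The initial time and damping of the flow: either `t₀ = 0` and `η` is a constant `≥ 1`, or
`t₀ = 1` and `η(t) = r / t` with `r > 3`. -/
def IsDamping (t₀ : ℝ) (η : ℝ → ℝ) : Prop :=
  (t₀ = 0 ∧ ∃ c : ℝ, 1 ≤ c ∧ ∀ t, η t = c) ∨ (t₀ = 1 ∧ ∃ r : ℝ, 3 < r ∧ ∀ t, η t = r / t)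

/-- `p`, with velocity `q = ṗ`, is the solution in `P` on `[t₀, ∞)` of the second order flow
`p̈ + η(t) ṗ + ∇V(p) = 0`, `p(t₀) = p₀`, `ṗ(t₀) = v₀`, with boundary data `(g₁, g₂)`. The derivative
of `V(p) = ½ ‖u_im(p)‖²` at `p` is `h ↦ ∫_{Ω₀} w_im h`, with `u` the state of `p` and `w` the adjoint
state, so that for `P = L²(Ω₀)` the equation reads `p̈ + η(t) ṗ + w_im = 0` in `Ω₀`. -/
structure IsSOARFlow {d : ℕ} {k : SourceKind} (Ω : Set (Eucl d)) {Ω₀ : Set (Eucl d)}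
    (t₀ : ℝ) (η : ℝ → ℝ) (p₀ v₀ : SourceSpace k Ω₀) (g₁ g₂ : Eucl d → ℝ)
    (p q : ℝ → SourceSpace k Ω₀) : Prop where
  init_p : p t₀ = p₀
  init_q : q t₀ = v₀
  continuousOn_p : ContinuousOn p (Ici t₀)
  continuousOn_q : ContinuousOn q (Ici t₀)
  hasDerivAt_p : ∀ t, t₀ < t → HasDerivAt p (q t) t
  flow : ∀ t, t₀ < t → ∃ (a : SourceSpace k Ω₀) (u w : SobolevH1 ℂ Ω),
    HasDerivAt q a t ∧ IsState Ω g₁ g₂ (p t) u ∧ IsAdjointState Ω u w ∧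
    ∀ h : SourceSpace k Ω₀,
      inner ℝ (a + η t • q t) h + ∫ x in Ω₀, (SobolevH1.toL2 w x).im * h.toL2 x = 0

/-- `T` is a root of Morozov's discrepancy function
`χ(T) = ‖u_im(p(T))‖_{0,Ω} - C₀ τ δ`. -/
def IsMorozovRoot {d : ℕ} {k : SourceKind} (Ω : Set (Eucl d)) {Ω₀ : Set (Eucl d)}
    (t₀ C₀ τ δ : ℝ) (g₁ g₂ : Eucl d → ℝ) (p : ℝ → SourceSpace k Ω₀) (T : ℝ) : Prop :=
  t₀ ≤ T ∧ ∃ u : SobolevH1 ℂ Ω, IsState Ω g₁ g₂ (p T) u ∧ imNorm u - C₀ * τ * δ = 0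

/-- `T` is a root of the total energy discrepancy function
`χ_TE(T) = ‖u_im(p(T))‖²_{0,Ω} + ‖ṗ(T)‖²_P - C₀² τ² δ²`. -/
def IsTotalEnergyRoot {d : ℕ} {k : SourceKind} (Ω : Set (Eucl d)) {Ω₀ : Set (Eucl d)}
    (t₀ C₀ τ δ : ℝ) (g₁ g₂ : Eucl d → ℝ) (p q : ℝ → SourceSpace k Ω₀) (T : ℝ) : Prop :=
  t₀ ≤ T ∧ ∃ u : SobolevH1 ℂ Ω, IsState Ω g₁ g₂ (p T) u ∧
    imNorm u ^ 2 + ‖q T‖ ^ 2 - C₀ ^ 2 * τ ^ 2 * δ ^ 2 = 0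

/-- Noise levels `δₙ > 0` tending to zero, noisy data `(g₁ₙ, g₂ₙ)` in `L^∞(Γ)` within `δₙ` of the
exact data `(g₁, g₂)`, and the flows `pₙ` (with velocities `qₙ`) driven by these noisy data. -/
structure IsNoisyFlowSequence {d : ℕ} {k : SourceKind} (Ω : Set (Eucl d)) {Ω₀ : Set (Eucl d)}
    (t₀ : ℝ) (η : ℝ → ℝ) (p₀ v₀ : SourceSpace k Ω₀) (g₁ g₂ : Eucl d → ℝ)
    (δ : ℕ → ℝ) (g₁n g₂n : ℕ → Eucl d → ℝ) (p q : ℕ → ℝ → SourceSpace k Ω₀) : Prop where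
  pos : ∀ n, 0 < δ n
  tendsto_zero : Tendsto δ atTop (𝓝 0)
  memLp₁ : ∀ n, MemLp (g₁n n) ∞ (surfaceMeasure Ω)
  memLp₂ : ∀ n, MemLp (g₂n n) ∞ (surfaceMeasure Ω)
  noise₁ : ∀ n, eLpNorm (g₁n n - g₁) ∞ (surfaceMeasure Ω) ≤ ENNReal.ofReal (δ n)
  noise₂ : ∀ n, eLpNorm (g₂n n - g₂) ∞ (surfaceMeasure Ω) ≤ ENNReal.ofReal (δ n)
  flow : ∀ n, IsSOARFlow Ω t₀ η p₀ v₀ (g₁n n) (g₂n n) (p n) (q n)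

/-- Weak convergence of a sequence in a Hilbert space. -/
def WeaklyConverges {H : Type} [NormedAddCommGroup H] [InnerProductSpace ℝ H]
    (x : ℕ → H) (y : H) : Prop :=
  ∀ h : H, Tendsto (fun n => inner ℝ (x n) h) atTop (𝓝 (inner ℝ y h))

end

/-! ### Abstract damped flows: energy decay and stability in the data -/

section DampedFlow

variable {H Y : Type} [NormedAddCommGroup H] [InnerProductSpace ℝ H]
  [NormedAddCommGroup Y] [InnerProductSpace ℝ Y]

/-! The imaginary part of the state is affine in the source: it equals A p - y, where A is the
bounded operator `forwardMap` from P to L²(Ω) and y is determined by the boundary data. Reciprocity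
of the Robin problem turns the term with the adjoint state into A†(A p - y), and the exact sources
are precisely the solutions of A p = y (`isExactSource_iff`). The flow is therefore a damped flow
for a linear least squares problem, and noise only replaces y by some y' with ‖y' - y‖ ≤ C₀ δ. The
theorem becomes a statement about Hilbert spaces.

Weak convergence is reduced to ker A. The range of A† is dense in the orthogonal complement of ker
A, so a bounded sequence with A xₙ → y converges weakly as soon as its components along ker A do
(`weaklyConverges_of_ker`). At a root the residual is at most C₀ τ δₙ, so A pₙ(Tₙ) → y. Along ker A
no force acts: the velocity component is that of v₀ times a scalar profile γ(t), and the position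
component is that of p₀ plus G(γ(t)) times that of v₀, with G continuous and both functions
independent of the data. Only the limit of γ(Tₙ) matters. Under the total energy principle the
stopped velocity vanishes in the limit, so γ(Tₙ) → 0 whenever v₀ has a component in ker A; if v₀ is
orthogonal to ker A there is nothing to show; first roots converge to a time fixed by the noise-free
problem or diverge (`exists_limit_at_firstRoot`); for arbitrary roots γ(Tₙ) lies in [0, 1] and a
subsequence converges.

Boundedness of pₙ(Tₙ) is `exists_bound`. For constant damping a Lyapunov function decreases as long
as the energy dominates the noise, which τ > 1 guarantees up to the root. For damping r/t the
Lyapunov function is controlled only up to an error of order noise times T². That estimate is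
applied instead to another member of the sequence whose noise is negligible at that time. Flows with
common initial data differ in velocity and residual by at most the difference of their data, which
first bounds δₙ Tₙ and then the distance of the two flows.

On the PDE side no trace operator is used. The closed graph of the trace relation is itself a
Hilbert space with the norm of H¹(Ω) × L²(Γ), and the Robin problem becomes a 2 × 2 operator system
there, solvable by an explicit coercive operator (`exists_robinResolvent`). -/

/-- `p`, with velocity `q`, solves `p̈ + η ṗ + A†(A p - y) = 0` on `(t₀, ∞)`, in variational form. -/
structure IsDampedFlow (A : H →L[ℝ] Y) (t₀ : ℝ) (η : ℝ → ℝ) (y : Y) (p q : ℝ → H) : Prop where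
  continuousOn_p : ContinuousOn p (Ici t₀)
  continuousOn_q : ContinuousOn q (Ici t₀)
  hasDerivAt_p : ∀ t, t₀ < t → HasDerivAt p (q t) t
  flow : ∀ t, t₀ < t → ∃ a : H, HasDerivAt q a t ∧
    ∀ h : H, inner ℝ (a + η t • q t) h + inner ℝ (A (p t) - y) (A h) = 0

namespace IsDampedFlow

variable {A : H →L[ℝ] Y} {t₀ : ℝ} {η : ℝ → ℝ} {y y' : Y} {p q p' q' : ℝ → H}

/-- The equation is affine in the pair of flow and datum. When the initial data agree they cancel in
the difference, and every stability bound is then energy decay for a flow starting at rest from 0.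
-/
lemma sub (h : IsDampedFlow A t₀ η y p q) (h' : IsDampedFlow A t₀ η y' p' q') :
    IsDampedFlow A t₀ η (y - y') (p - p') (q - q') where
  continuousOn_p := h.continuousOn_p.sub h'.continuousOn_p
  continuousOn_q := h.continuousOn_q.sub h'.continuousOn_q
  hasDerivAt_p t ht := (h.hasDerivAt_p t ht).sub (h'.hasDerivAt_p t ht)
  flow t ht := by
    obtain ⟨a, ha, hf⟩ := h.flow t ht
    obtain ⟨a', ha', hf'⟩ := h'.flow t ht
    refine ⟨a - a', ha.sub ha', fun x => ?_⟩
    have e := hf x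
    have e' := hf' x
    simp only [Pi.sub_apply, map_sub, smul_sub, inner_add_left, inner_sub_left] at *
    linarith

lemma continuousOn_residual (h : IsDampedFlow A t₀ η y p q) :
    ContinuousOn (fun t => A (p t) - y) (Ici t₀) :=
  (A.continuous.comp_continuousOn h.continuousOn_p).sub continuousOn_const

lemma hasDerivAt_residual (h : IsDampedFlow A t₀ η y p q) {t : ℝ} (ht : t₀ < t) :
    HasDerivAt (fun t => A (p t) - y) (A (q t)) t :=
  (A.hasFDerivAt.comp_hasDerivAt t (h.hasDerivAt_p t ht)).sub_const y

/-- Common frame of the Lyapunov arguments: the equation holds only after the initial time, so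
differentiability is asked for in the interior and continuity up to the endpoints. -/
lemma antitoneOn_Icc_of_hasDerivAt {f f' : ℝ → ℝ} {T : ℝ} (hf : ContinuousOn f (Icc t₀ T))
    (hd : ∀ t, t₀ < t → t < T → HasDerivAt f (f' t) t) (h0 : ∀ t, t₀ < t → t < T → f' t ≤ 0) :
    AntitoneOn f (Icc t₀ T) := by
  refine antitoneOn_of_hasDerivWithinAt_nonpos (f' := f') (convex_Icc _ _) hf ?_ ?_
  · intro x hx
    rw [interior_Icc] at hx
    exact (hd x hx.1 hx.2).hasDerivWithinAt
  · intro x hx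
    rw [interior_Icc] at hx
    exact h0 x hx.1 hx.2

/-- The total energy of a damped flow is nonincreasing. -/
lemma energy_le (h : IsDampedFlow A t₀ η y p q) (hη : ∀ t, t₀ < t → 0 ≤ η t)
    {s t : ℝ} (hs : t₀ ≤ s) (hst : s ≤ t) :
    ‖q t‖ ^ 2 + ‖A (p t) - y‖ ^ 2 ≤ ‖q s‖ ^ 2 + ‖A (p s) - y‖ ^ 2 := by
  have hq := h.continuousOn_q.mono (Icc_subset_Ici_self : Icc t₀ t ⊆ _)
  have hr := h.continuousOn_residual.mono (Icc_subset_Ici_self : Icc t₀ t ⊆ _)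
  have key : AntitoneOn (fun t => ‖q t‖ ^ 2 + ‖A (p t) - y‖ ^ 2) (Icc t₀ t) := by
    refine antitoneOn_Icc_of_hasDerivAt (f' := fun t => -2 * (η t * ‖q t‖ ^ 2))
      ((hq.norm.pow 2).add (hr.norm.pow 2)) ?_ ?_
    · intro x hx _
      obtain ⟨a, ha, hf⟩ := h.flow x hx
      -- Testing the equation with the velocity cancels the work of the force against the change of
      -- the residual; only the dissipation -2η‖q‖² is left.
      have e := hf (q x)
      convert! ha.norm_sq.add (h.hasDerivAt_residual hx).norm_sq using 1
      simp only [inner_add_left, inner_smul_left, real_inner_self_eq_norm_sq] at e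
      simp only [RCLike.conj_to_real] at e
      rw [real_inner_comm]
      linarith
    · intro x hx _
      have := mul_nonneg (hη x hx) (sq_nonneg ‖q x‖)
      linarith
  exact key ⟨hs, hst⟩ ⟨hs.trans hst, le_rfl⟩ hst

/-- Stability: flows with the same initial data and data `y`, `y'` stay within `‖y - y'‖` of each
other in velocity and residual. -/
lemma dist_sq_le (h : IsDampedFlow A t₀ η y p q) (h' : IsDampedFlow A t₀ η y' p' q')
    (hη : ∀ t, t₀ < t → 0 ≤ η t) (hp : p t₀ = p' t₀) (hq : q t₀ = q' t₀) {t : ℝ} (ht : t₀ ≤ t) :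
    ‖q t - q' t‖ ^ 2 + ‖(A (p t) - y) - (A (p' t) - y')‖ ^ 2 ≤ ‖y - y'‖ ^ 2 := by
  -- The difference starts at rest from 0, so its initial energy is exactly ‖y - y'‖².
  have := (h.sub h').energy_le hη le_rfl ht
  simp only [Pi.sub_apply, hp, hq, sub_self, norm_zero, map_zero, zero_sub, norm_neg, map_sub] at this
  rw [sub_sub_sub_comm]
  linarith

lemma residual_dist_le (h : IsDampedFlow A t₀ η y p q) (h' : IsDampedFlow A t₀ η y' p' q')
    (hη : ∀ t, t₀ < t → 0 ≤ η t) (hp : p t₀ = p' t₀) (hq : q t₀ = q' t₀) {t : ℝ} (ht : t₀ ≤ t) :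
    ‖(A (p t) - y) - (A (p' t) - y')‖ ≤ ‖y - y'‖ := by
  have := h.dist_sq_le h' hη hp hq ht
  exact abs_le_of_sq_le_sq' (by nlinarith [sq_nonneg ‖q t - q' t‖]) (norm_nonneg _) |>.2

lemma velocity_dist_le (h : IsDampedFlow A t₀ η y p q) (h' : IsDampedFlow A t₀ η y' p' q')
    (hη : ∀ t, t₀ < t → 0 ≤ η t) (hp : p t₀ = p' t₀) (hq : q t₀ = q' t₀) {t : ℝ} (ht : t₀ ≤ t) :
    ‖q t - q' t‖ ≤ ‖y - y'‖ := by
  have := h.dist_sq_le h' hη hp hq ht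
  exact abs_le_of_sq_le_sq'
    (by nlinarith [sq_nonneg ‖(A (p t) - y) - (A (p' t) - y')‖]) (norm_nonneg _) |>.2

/-- Stability of the total energy under perturbations of the data. -/
lemma sqrt_energy_le (h : IsDampedFlow A t₀ η y p q) (h' : IsDampedFlow A t₀ η y' p' q')
    (hη : ∀ t, t₀ < t → 0 ≤ η t) (hp : p t₀ = p' t₀) (hq : q t₀ = q' t₀) {t : ℝ} (ht : t₀ ≤ t) :
    Real.sqrt (‖q t‖ ^ 2 + ‖A (p t) - y‖ ^ 2) ≤
      Real.sqrt (‖q' t‖ ^ 2 + ‖A (p' t) - y'‖ ^ 2) + ‖y - y'‖ := by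
  have h1 := h.dist_sq_le h' hη hp hq ht
  -- The square root of the energy is a norm on the ℓ² product, so the triangle inequality applies
  -- to velocity and residual jointly.
  have e : ∀ (a : H) (b : Y), Real.sqrt (‖a‖ ^ 2 + ‖b‖ ^ 2) = ‖WithLp.toLp 2 (a, b)‖ := fun a b => by
    rw [WithLp.prod_norm_eq_of_L2]
    rfl
  rw [← Real.sqrt_le_left (norm_nonneg _), e] at h1
  rw [e, e]
  refine (norm_le_norm_add_norm_sub' _ (WithLp.toLp 2 (q' t, A (p' t) - y'))).trans ?_
  gcongr
  exact h1

/-- Pairing the curve with its own total displacement reduces the mean value inequality to the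
monotonicity of a real function. -/
lemma dist_le_of_velocity_dist_le {M : ℝ} (hc : ContinuousOn p (Ici t₀))
    (hd : ∀ t, t₀ < t → HasDerivAt p (q t) t) (hM : ∀ t, t₀ < t → ‖q t‖ ≤ M)
    {t : ℝ} (ht : t₀ ≤ t) : ‖p t - p t₀‖ ≤ M * (t - t₀) := by
  set u := p t - p t₀ with hu
  have key : AntitoneOn (fun s => inner ℝ (p s) u - M * ‖u‖ * s) (Icc t₀ t) := by
    refine antitoneOn_Icc_of_hasDerivAt (f' := fun s => inner ℝ (q s) u - M * ‖u‖) ?_ ?_ ?_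
    · refine ContinuousOn.sub ?_ (by fun_prop)
      exact (hc.mono Icc_subset_Ici_self).inner continuousOn_const
    · intro x hx _
      have h1 := (hd x hx).inner ℝ (hasDerivAt_const x u)
      have h2 := (hasDerivAt_id x).const_mul (M * ‖u‖)
      convert! h1.sub h2 using 1
      simp
    · intro x hx _
      have := real_inner_le_norm (q x) u
      have := mul_le_mul_of_nonneg_right (hM x hx) (norm_nonneg u)
      linarith
  have h1 := key ⟨le_rfl, ht⟩ ⟨ht, le_rfl⟩ ht
  have h2 : ‖u‖ ^ 2 ≤ M * ‖u‖ * (t - t₀) := by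
    rw [← real_inner_self_eq_norm_sq, hu, inner_sub_left, ← hu]
    simp only at h1
    linarith
  rcases (norm_nonneg u).eq_or_lt with h0 | h0
  · rw [← h0]
    rcases ht.eq_or_lt with rfl | ht'
    · simp
    · exact mul_nonneg ((norm_nonneg _).trans (hM t ht')) (by linarith)
  · by_contra! hcon
    nlinarith

end IsDampedFlow

/-! ### Free motion along the kernel, and a criterion for weak convergence -/

/-- `γ` and `c` solve the damped equation without force: `γ` is the velocity and `c` the position. -/
structure IsFreeProfile (t₀ : ℝ) (η γ c : ℝ → ℝ) : Prop where
  continuousOn_vel : ContinuousOn γ (Ici t₀)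
  continuousOn_pos : ContinuousOn c (Ici t₀)
  vel_init : γ t₀ = 1
  pos_init : c t₀ = 0
  vel_pos : ∀ t, t₀ ≤ t → 0 < γ t
  hasDerivAt_vel : ∀ t, t₀ < t → HasDerivAt γ (-η t * γ t) t
  hasDerivAt_pos : ∀ t, t₀ < t → HasDerivAt c (γ t) t

lemma IsDampedFlow.eq_of_hasDerivAt_zero {f : ℝ → ℝ} {t₀ : ℝ} (hf : ContinuousOn f (Ici t₀))
    (hd : ∀ t, t₀ < t → HasDerivAt f 0 t) {t : ℝ} (ht : t₀ ≤ t) : f t = f t₀ := by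
  have h1 := dist_le_of_velocity_dist_le (q := 0) (M := 0) hf hd (by simp) ht
  rw [zero_mul] at h1
  exact sub_eq_zero.1 (norm_le_zero_iff.1 h1)

/-- Along the kernel of `A` a damped flow moves freely, whatever the data. -/
lemma IsDampedFlow.inner_velocity {A : H →L[ℝ] Y} {t₀ : ℝ} {η γ c : ℝ → ℝ} {y : Y} {p q : ℝ → H}
    (h : IsDampedFlow A t₀ η y p q) (hg : IsFreeProfile t₀ η γ c) {w : H} (hw : A w = 0)
    {t : ℝ} (ht : t₀ ≤ t) : inner ℝ (q t) w = γ t * inner ℝ (q t₀) w := by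
  have h1 : (fun t => inner ℝ (q t) w / γ t) t = (fun t => inner ℝ (q t) w / γ t) t₀ := by
    refine eq_of_hasDerivAt_zero (f := fun t => inner ℝ (q t) w / γ t) ?_ ?_ ht
    · exact (h.continuousOn_q.inner continuousOn_const).div hg.continuousOn_vel
        fun s hs => (hg.vel_pos s hs).ne'
    · intro s hs
      obtain ⟨a, ha, hf⟩ := h.flow s hs
      have e := hf w
      simp only [hw, inner_zero_right, add_zero, inner_add_left, inner_smul_left,
        RCLike.conj_to_real] at e
      have hγ := (hg.vel_pos s hs.le).ne'
      convert! (ha.inner ℝ (hasDerivAt_const s w)).div (hg.hasDerivAt_vel s hs) hγ using 1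
      rw [eq_div_iff (pow_ne_zero 2 hγ), inner_zero_right, zero_add,
        eq_neg_of_add_eq_zero_left e]
      ring
  simp only [hg.vel_init, div_one] at h1
  rw [← h1, mul_div_cancel₀ _ (hg.vel_pos t ht).ne']

/-- Integrated form of `inner_velocity`. The datum does not enter, so the kernel component of a
stopped flow depends on the noise only through the stopping time. -/
lemma IsDampedFlow.inner_position {A : H →L[ℝ] Y} {t₀ : ℝ} {η γ c : ℝ → ℝ} {y : Y} {p q : ℝ → H}
    (h : IsDampedFlow A t₀ η y p q) (hg : IsFreeProfile t₀ η γ c) {w : H} (hw : A w = 0)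
    {t : ℝ} (ht : t₀ ≤ t) : inner ℝ (p t) w = inner ℝ (p t₀) w + c t * inner ℝ (q t₀) w := by
  have h1 : (fun t => inner ℝ (p t) w - c t * inner ℝ (q t₀) w) t =
      (fun t => inner ℝ (p t) w - c t * inner ℝ (q t₀) w) t₀ := by
    refine eq_of_hasDerivAt_zero
      (f := fun t => inner ℝ (p t) w - c t * inner ℝ (q t₀) w) ?_ ?_ ht
    · exact (h.continuousOn_p.inner continuousOn_const).sub
        (hg.continuousOn_pos.mul continuousOn_const)
    · intro s hs
      convert! ((h.hasDerivAt_p s hs).inner ℝ (hasDerivAt_const s w)).sub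
        ((hg.hasDerivAt_pos s hs).mul_const (inner ℝ (q t₀) w)) using 1
      rw [inner_zero_right, zero_add, h.inner_velocity hg hw hs.le, sub_self]
  simp only [hg.pos_init, zero_mul, sub_zero] at h1
  linarith

/-- Weak convergence to `x'` of a bounded sequence `x` with `A x → A x'` whose components along
`ker A` converge. -/
lemma weaklyConverges_of_ker [CompleteSpace H] [CompleteSpace Y] (A : H →L[ℝ] Y) {x : ℕ → H}
    {x' : H} {R : ℝ} (hR : ∀ n, ‖x n‖ ≤ R) (hA : Tendsto (fun n => A (x n)) atTop (𝓝 (A x')))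
    (hker : ∀ w, A w = 0 → Tendsto (fun n => inner ℝ (x n) w) atTop (𝓝 (inner ℝ x' w))) :
    WeaklyConverges x x' := by
  set S : Set H := {h | Tendsto (fun n => inner ℝ (x n) h) atTop (𝓝 (inner ℝ x' h))} with hS
  have hadd : ∀ a ∈ S, ∀ b ∈ S, a + b ∈ S := fun a ha b hb => by
    simp only [hS, mem_ofPred_eq, inner_add_right] at *
    exact ha.add hb
  have hran : ∀ w, A.adjoint w ∈ S := fun w => by
    simp only [hS, mem_ofPred_eq, ContinuousLinearMap.adjoint_inner_right]
    exact hA.inner tendsto_const_nhds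
  have hclosed : ∀ a ∈ closure S, a ∈ S := by
    intro a ha
    rw [hS, mem_ofPred_eq, Metric.tendsto_atTop]
    intro ε hε
    set K := R + ‖x'‖ + 1 with hK
    have hR0 : 0 ≤ R := (norm_nonneg _).trans (hR 0)
    have hK0 : 0 < K := by positivity
    obtain ⟨b, hb, hab⟩ := Metric.mem_closure_iff.1 ha (ε / (2 * K)) (by positivity)
    obtain ⟨N, hN⟩ := Metric.tendsto_atTop.1 hb (ε / 2) (by positivity)
    refine ⟨N, fun n hn => ?_⟩
    have h1 := hN n hn
    rw [Real.dist_eq] at h1 ⊢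
    have e : inner ℝ (x n) a - inner ℝ x' a =
        inner ℝ (x n - x') (a - b) + (inner ℝ (x n) b - inner ℝ x' b) := by
      simp only [inner_sub_left, inner_sub_right]
      ring
    rw [dist_eq_norm] at hab
    have h2 : |inner ℝ (x n - x') (a - b)| ≤ K * (ε / (2 * K)) := by
      refine (abs_real_inner_le_norm _ _).trans ?_
      gcongr
      refine (norm_sub_le _ _).trans ?_
      linarith [hR n]
    have h3 : K * (ε / (2 * K)) = ε / 2 := by field_simp
    rw [e]
    refine (abs_add_le _ _).trans_lt ?_
    linarith
  intro h
  -- A test vector splits along ker A and its orthogonal complement, the closure of the range of A†.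
  -- Boundedness of the sequence makes the set of admissible test vectors closed.
  obtain ⟨a, ha, b, hb, rfl⟩ := A.ker.exists_add_mem_mem_orthogonal h
  refine hadd _ (hker a (by simpa using ha)) _ (hclosed _ ?_)
  rw [A.orthogonal_ker] at hb
  refine closure_mono ?_ hb
  rintro _ ⟨w, rfl⟩
  exact hran w

end DampedFlow

lemma norm_sq_le_two_mul_add {E : Type*} [SeminormedAddCommGroup E] {a b : E} :
    ‖b - a‖ ^ 2 ≤ 2 * (‖b‖ ^ 2 + ‖a‖ ^ 2) := by
  have := norm_sub_le b a
  nlinarith [norm_nonneg (b - a), sq_nonneg (‖b‖ - ‖a‖)]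

/-! ### Lyapunov estimates and the explicit free profiles -/

section NoisyFlows

variable {H Y : Type} [NormedAddCommGroup H] [InnerProductSpace ℝ H]
  [NormedAddCommGroup Y] [InnerProductSpace ℝ Y]

/-- Lyapunov estimate for constant damping, valid as long as the noise is below the energy. -/
lemma IsDampedFlow.norm_sub_sq_le_of_const {A : H →L[ℝ] Y} {t₀ c : ℝ} {η : ℝ → ℝ} {y y' : Y}
    {p q : ℝ → H} (h : IsDampedFlow A t₀ η y' p q) (hη : ∀ t, η t = c) (hc : 0 < c) {z : H}
    (hz : A z = y) {ε T : ℝ} (hε : ‖y' - y‖ ≤ ε) (hT : t₀ ≤ T)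
    (hE : ε ^ 2 ≤ ‖q T‖ ^ 2 + ‖A (p T) - y'‖ ^ 2) :
    c ^ 2 * ‖p T - z‖ ^ 2 ≤
      2 * (‖q t₀ + c • (p t₀ - z)‖ ^ 2 + ‖q t₀‖ ^ 2 + 2 * ‖A (p t₀) - y'‖ ^ 2) := by
  have hp := h.continuousOn_p.mono (Icc_subset_Ici_self : Icc t₀ T ⊆ _)
  have hq := h.continuousOn_q.mono (Icc_subset_Ici_self : Icc t₀ T ⊆ _)
  have hr := h.continuousOn_residual.mono (Icc_subset_Ici_self : Icc t₀ T ⊆ _)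
  -- Since c is constant, q + c (p - z) has derivative -A†(A p - y'). The weight 2 on the residual
  -- cancels the two cross terms between the residual and A q.
  have key : AntitoneOn (fun t => ‖q t + c • (p t - z)‖ ^ 2 + ‖q t‖ ^ 2 + 2 * ‖A (p t) - y'‖ ^ 2)
      (Icc t₀ T) := by
    refine IsDampedFlow.antitoneOn_Icc_of_hasDerivAt
      (f' := fun t => -2 * c * (inner ℝ (A (p t) - y') (A (p t - z)) + ‖q t‖ ^ 2)) ?_ ?_ ?_
    · exact (((hq.add (continuousOn_const.smul (hp.sub continuousOn_const))).norm.pow 2).add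
        (hq.norm.pow 2)).add (continuousOn_const.mul (hr.norm.pow 2))
    · intro x hx _
      obtain ⟨a, ha, hf⟩ := h.flow x hx
      have e1 := hf (q x)
      have e2 := hf (p x - z)
      have d1 := (ha.add (((h.hasDerivAt_p x hx).sub_const z).const_smul c)).norm_sq
      convert! (d1.add ha.norm_sq).add ((h.hasDerivAt_residual hx).norm_sq.const_mul 2) using 1
      rw [hη] at e1 e2
      simp only [inner_add_left, inner_add_right, inner_smul_left, inner_smul_right,
        real_inner_self_eq_norm_sq, RCLike.conj_to_real, Pi.add_apply, Pi.smul_apply] at e1 e2 ⊢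
      rw [real_inner_comm a (q x), real_inner_comm (q x) (p x - z), real_inner_comm a (p x - z)]
        at *
      linear_combination -4 * e1 - 2 * c * e2
    · intro x hx hxT
      have hη' : ∀ t, t₀ < t → 0 ≤ η t := fun t _ => by rw [hη]; exact hc.le
      -- The energy decreases, so its lower bound ε² at T holds at all earlier times. The noise term
      -- is at most (‖residual‖² + ε²)/2 and is absorbed by the energy.
      have h1 := h.energy_le hη' hx.le hxT.le
      have e : A (p x - z) = (A (p x) - y') + (y' - y) := by
        rw [map_sub, hz]
        abel
      rw [e, inner_add_right, real_inner_self_eq_norm_sq]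
      have h2 := neg_le_of_abs_le (abs_real_inner_le_norm (A (p x) - y') (y' - y))
      have h3 : ‖A (p x) - y'‖ * ‖y' - y‖ ≤ ‖A (p x) - y'‖ * ε := by gcongr
      have h4 : 0 ≤ ‖A (p x) - y'‖ ^ 2 + inner ℝ (A (p x) - y') (y' - y) + ‖q x‖ ^ 2 := by
        nlinarith [sq_nonneg (‖A (p x) - y'‖ - ε)]
      nlinarith
  have h1 := key ⟨le_rfl, hT⟩ ⟨hT, le_rfl⟩ hT
  have h2 := norm_sq_le_two_mul_add (a := q T) (b := q T + c • (p T - z))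
  rw [add_sub_cancel_left, norm_smul, mul_pow, Real.norm_eq_abs, sq_abs] at h2
  simp only at h1
  nlinarith [sq_nonneg ‖A (p T) - y'‖]

/-- Lyapunov estimate for the damping `r / t`. -/
lemma IsDampedFlow.lyapunov_le_of_div {A : H →L[ℝ] Y} {r : ℝ} {η : ℝ → ℝ} {y y' : Y}
    {p q : ℝ → H} (h : IsDampedFlow A 1 η y' p q) (hη : ∀ t, η t = r / t) (hr : 3 < r) {z : H}
    (hz : A z = y) {ε K T : ℝ} (hε : ‖y' - y‖ ≤ ε) (hT : 1 ≤ T) (hK : 0 ≤ K)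
    (hE : ‖q 1‖ ^ 2 + ‖A (p 1) - y'‖ ^ 2 ≤ K ^ 2) :
    2 * (T ^ 2 * ‖A (p T) - y'‖ ^ 2) + ‖(r - 1) • (p T - z) + T • q T‖ ^ 2 + T ^ 2 * ‖q T‖ ^ 2 ≤
      2 * ‖A (p 1) - y'‖ ^ 2 + ‖(r - 1) • (p 1 - z) + q 1‖ ^ 2 + ‖q 1‖ ^ 2 +
        (r - 1) * ε * K * T ^ 2 := by
  have hcp := h.continuousOn_p.mono (Icc_subset_Ici_self : Icc 1 T ⊆ _)
  have hcq := h.continuousOn_q.mono (Icc_subset_Ici_self : Icc 1 T ⊆ _)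
  have hcr := h.continuousOn_residual.mono (Icc_subset_Ici_self : Icc 1 T ⊆ _)
  have hε0 : 0 ≤ ε := (norm_nonneg _).trans hε
  -- The factor r - 1 makes the derivative of (r - 1)(p - z) + t q equal to -t A†(A p - y'). The
  -- residual then carries the coefficient 3 - r, negative by the choice of r. The subtracted
  -- multiple of t² pays for the noise, with K bounding the residual through energy decay.
  have key : AntitoneOn (fun t => 2 * (t ^ 2 * ‖A (p t) - y'‖ ^ 2) +
      ‖(r - 1) • (p t - z) + t • q t‖ ^ 2 + t ^ 2 * ‖q t‖ ^ 2 - (r - 1) * ε * K * t ^ 2)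
      (Icc 1 T) := by
    refine IsDampedFlow.antitoneOn_Icc_of_hasDerivAt
      (f' := fun t => 2 * t * ((3 - r) * ‖A (p t) - y'‖ ^ 2 -
        (r - 1) * inner ℝ (A (p t) - y') (y' - y) - (r - 1) * ‖q t‖ ^ 2 - (r - 1) * ε * K)) ?_ ?_ ?_
    · fun_prop
    · intro x hx _
      have hx0 : x ≠ 0 := by positivity
      obtain ⟨a, ha, hf⟩ := h.flow x hx
      have e1 := hf (q x)
      have e2 := hf (p x - z)
      have d0 := hasDerivAt_pow 2 x
      have d1 := ((((h.hasDerivAt_p x hx).sub_const z).const_smul (r - 1)).add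
        ((hasDerivAt_id x).smul ha)).norm_sq
      convert! (((d0.mul (h.hasDerivAt_residual hx).norm_sq).const_mul 2).add d1).add
        (d0.mul ha.norm_sq) |>.sub (d0.const_mul ((r - 1) * ε * K)) using 1
      have e : A (p x - z) = (A (p x) - y') + (y' - y) := by
        rw [map_sub, hz]
        abel
      rw [hη] at e1 e2
      rw [e] at e2
      simp only [inner_add_left, inner_add_right, inner_smul_left, inner_smul_right,
        real_inner_self_eq_norm_sq, RCLike.conj_to_real, Pi.add_apply, Pi.smul_apply, id,
        Pi.smul_apply', one_smul, Nat.cast_ofNat] at e1 e2 ⊢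
      rw [real_inner_comm a (q x), real_inner_comm (q x) (p x - z), real_inner_comm a (p x - z)]
        at *
      field_simp at e1 e2
      linear_combination -4 * x * e1 - 2 * (r - 1) * e2
    · intro x hx _
      have hη' : ∀ t, 1 < t → 0 ≤ η t := fun t ht => by rw [hη]; positivity
      have h1 := h.energy_le hη' le_rfl hx.le
      have h2 := neg_le_of_abs_le (abs_real_inner_le_norm (A (p x) - y') (y' - y))
      have h3 : ‖A (p x) - y'‖ ≤ K :=
        (abs_le_of_sq_le_sq' (by nlinarith [sq_nonneg ‖q x‖]) hK).2
      have h4 : ‖A (p x) - y'‖ * ‖y' - y‖ ≤ K * ε := by gcongr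
      refine mul_nonpos_of_nonneg_of_nonpos (by positivity) ?_
      nlinarith [sq_nonneg ‖q x‖, sq_nonneg ‖A (p x) - y'‖]
  have h1 := key ⟨le_rfl, hT⟩ ⟨hT, le_rfl⟩ hT
  simp only [one_pow, one_mul, one_smul, mul_one] at h1
  have : 0 ≤ (r - 1) * ε * K := by
    have : 0 ≤ r - 1 := by linarith
    positivity
  linarith

/-- A sequence of damped flows with common initial data, driven by data converging to `y`. -/
structure IsNoisyDampedFlows (A : H →L[ℝ] Y) (t₀ : ℝ) (η : ℝ → ℝ) (C : ℝ) (y : Y) (p₀ v₀ : H)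
    (δ : ℕ → ℝ) (yn : ℕ → Y) (p q : ℕ → ℝ → H) : Prop where
  pos : ∀ n, 0 < δ n
  tendsto_zero : Tendsto δ atTop (𝓝 0)
  noise : ∀ n, ‖yn n - y‖ ≤ C * δ n
  flow : ∀ n, IsDampedFlow A t₀ η (yn n) (p n) (q n)
  init_p : ∀ n, p n t₀ = p₀
  init_q : ∀ n, q n t₀ = v₀

lemma IsNoisyDampedFlows.comp {A : H →L[ℝ] Y} {t₀ : ℝ} {η : ℝ → ℝ} {C : ℝ} {y : Y} {p₀ v₀ : H}
    {δ : ℕ → ℝ} {yn : ℕ → Y} {p q : ℕ → ℝ → H}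
    (h : IsNoisyDampedFlows A t₀ η C y p₀ v₀ δ yn p q) {s : ℕ → ℕ} (hs : StrictMono s) :
    IsNoisyDampedFlows A t₀ η C y p₀ v₀ (δ ∘ s) (yn ∘ s) (p ∘ s) (q ∘ s) where
  pos _ := h.pos _
  tendsto_zero := h.tendsto_zero.comp hs.tendsto_atTop
  noise _ := h.noise _
  flow _ := h.flow _
  init_p _ := h.init_p _
  init_q _ := h.init_q _

lemma IsDamping.nonneg {t₀ : ℝ} {η : ℝ → ℝ} (h : IsDamping t₀ η) {t : ℝ} (ht : t₀ < t) :
    0 ≤ η t := by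
  rcases h with ⟨rfl, c, hc, h⟩ | ⟨rfl, r, hr, h⟩
  · rw [h]; linarith
  · rw [h]; positivity

/-- The free motion under an admissible damping; the position is a function of the velocity. -/
lemma IsDamping.exists_freeProfile {t₀ : ℝ} {η : ℝ → ℝ} (h : IsDamping t₀ η) :
    ∃ γ G : ℝ → ℝ, Continuous G ∧ IsFreeProfile t₀ η γ (fun t => G (γ t)) ∧
      Tendsto γ atTop (𝓝 0) ∧ ∀ t, t₀ ≤ t → γ t ≤ 1 := by
  rcases h with ⟨rfl, c, hc, h⟩ | ⟨rfl, r, hr, h⟩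
  · have hc0 : c ≠ 0 := by positivity
    have hd : ∀ t, HasDerivAt (fun t => Real.exp (-c * t)) (-c * Real.exp (-c * t)) t := by
      intro t
      convert! ((hasDerivAt_id t).const_mul (-c)).exp using 1
      simp [mul_comm]
    refine ⟨fun t => Real.exp (-c * t), fun x => (1 - x) / c, by fun_prop, ?_, ?_, ?_⟩
    · refine ⟨by fun_prop, by fun_prop, by simp, by simp, fun t _ => Real.exp_pos _,
        fun t _ => by rw [h]; exact hd t, fun t _ => ?_⟩
      convert! ((hd t).const_sub 1).div_const c using 1
      field_simp
    · refine Real.tendsto_exp_atBot.comp ?_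
      exact (tendsto_const_mul_atBot_of_neg (by linarith)).2 tendsto_id
    · intro t ht
      rw [Real.exp_le_one_iff]
      nlinarith
  · have hr0 : r ≠ 0 := by positivity
    have hr1 : r - 1 ≠ 0 := by linarith
    -- The velocity t^(-r) integrates to (1 - t^(1-r))/(r - 1). Writing t^(1-r) as a power of the
    -- velocity gives a function of γ that is continuous also at γ = 0, the limit as t → ∞.
    have hpow : ∀ t : ℝ, 0 < t → (t ^ (-r)) ^ ((r - 1) / r) = t ^ (1 - r) := fun t ht => by
      rw [← Real.rpow_mul ht.le]
      congr 1
      field_simp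
      ring
    have hd : ∀ s t : ℝ, 0 < t → HasDerivAt (fun t => t ^ s) (s * t ^ (s - 1)) t :=
      fun s t ht => Real.hasDerivAt_rpow_const (Or.inl ht.ne')
    have hvel : ContinuousOn (fun t : ℝ => t ^ (-r)) (Ici 1) := fun t ht =>
      (hd _ t (zero_lt_one.trans_le ht)).continuousAt.continuousWithinAt
    have hG : Continuous (fun x : ℝ => (1 - x ^ ((r - 1) / r)) / (r - 1)) := by
      refine (continuous_const.sub (Real.continuous_rpow_const ?_)).div_const _
      exact div_nonneg (by linarith) (by linarith)
    refine ⟨fun t => t ^ (-r), fun x => (1 - x ^ ((r - 1) / r)) / (r - 1), hG, ?_, ?_, ?_⟩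
    · refine ⟨hvel, hG.comp_continuousOn hvel, by simp, by simp, fun t ht =>
        Real.rpow_pos_of_pos (zero_lt_one.trans_le ht) _, fun t ht => ?_, fun t ht => ?_⟩
      · convert! hd (-r) t (by linarith) using 1
        rw [h, Real.rpow_sub_one (by linarith)]
        ring
      · have : HasDerivAt (fun t : ℝ => (1 - t ^ (1 - r)) / (r - 1)) (t ^ (-r)) t := by
          convert! ((hd (1 - r) t (by linarith)).const_sub 1).div_const (r - 1) using 1
          rw [sub_sub_cancel_left]
          field_simp
          ring
        refine this.congr_of_eventuallyEq ?_
        filter_upwards [lt_mem_nhds (zero_lt_one.trans ht)] with s hs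
        rw [hpow s hs]
    · exact tendsto_rpow_neg_atTop (by linarith)
    · intro t ht
      exact Real.rpow_le_one_of_one_le_of_nonpos ht (by linarith)

end NoisyFlows

/-! ### Boundedness and weak convergence at the stopping times -/

section NoisyFlows

variable {H Y : Type} [NormedAddCommGroup H] [InnerProductSpace ℝ H]
  [NormedAddCommGroup Y] [InnerProductSpace ℝ Y]

namespace IsNoisyDampedFlows

variable {A : H →L[ℝ] Y} {t₀ : ℝ} {η : ℝ → ℝ} {C : ℝ} {y : Y} {p₀ v₀ : H}
  {δ : ℕ → ℝ} {yn : ℕ → Y} {p q : ℕ → ℝ → H}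

lemma norm_data_sub_le (h : IsNoisyDampedFlows A t₀ η C y p₀ v₀ δ yn p q) (n m : ℕ) :
    ‖yn n - yn m‖ ≤ C * (δ n + δ m) := by
  have h1 := norm_sub_le (yn n - y) (yn m - y)
  rw [sub_sub_sub_cancel_right] at h1
  linarith [h.noise n, h.noise m]

lemma exists_initial_residual_le (h : IsNoisyDampedFlows A t₀ η C y p₀ v₀ δ yn p q) (hC : 0 < C) :
    ∃ K, 0 ≤ K ∧ ∀ n, ‖A (p n t₀) - yn n‖ ≤ K := by
  obtain ⟨D, hD⟩ := h.tendsto_zero.bddAbove_range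
  have hD' : ∀ n, δ n ≤ D := fun n => hD ⟨n, rfl⟩
  have hb : ∀ n, ‖A (p n t₀) - yn n‖ ≤ ‖A p₀ - y‖ + C * D := fun n => by
    have h1 := norm_sub_le (A p₀ - y) (yn n - y)
    rw [sub_sub_sub_cancel_right] at h1
    rw [h.init_p]
    have := mul_le_mul_of_nonneg_left (hD' n) hC.le
    linarith [h.noise n]
  exact ⟨_, (norm_nonneg _).trans (hb 0), hb⟩

/-- Up to a time at which the energy still dominates the noise, the flows stay bounded. -/
lemma exists_bound (h : IsNoisyDampedFlows A t₀ η C y p₀ v₀ δ yn p q) (hη : IsDamping t₀ η)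
    (hC : 0 < C) {τ : ℝ} (hτ : 1 < τ) {z : H} (hz : A z = y) {T : ℕ → ℝ} (hT : ∀ n, t₀ ≤ T n)
    (hE : ∀ n, (C * τ * δ n) ^ 2 ≤ ‖q n (T n)‖ ^ 2 + ‖A (p n (T n)) - yn n‖ ^ 2) :
    ∃ R, ∀ n, ‖p n (T n)‖ ≤ R := by
  obtain ⟨K₀, hK₀, hK₀'⟩ := h.exists_initial_residual_le hC
  have hη0 : ∀ t, t₀ < t → 0 ≤ η t := fun t ht => hη.nonneg ht
  have tri : ∀ n, ‖p n (T n)‖ ≤ ‖z‖ + ‖p n (T n) - z‖ := fun n => norm_le_norm_add_norm_sub' _ _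
  rcases hη with ⟨rfl, c, hc, hη⟩ | ⟨rfl, r, hr, hη⟩
  · set M := 2 * (‖v₀ + c • (p₀ - z)‖ ^ 2 + ‖v₀‖ ^ 2 + 2 * K₀ ^ 2) with hM
    refine ⟨‖z‖ + Real.sqrt M, fun n => (tri n).trans ?_⟩
    gcongr
    apply Real.le_sqrt_of_sq_le
    have hε : ‖yn n - y‖ ≤ C * τ * δ n := by
      have := h.noise n
      have := h.pos n
      have : 0 < C * δ n := by positivity
      nlinarith
    have h1 := (h.flow n).norm_sub_sq_le_of_const hη (by linarith) hz hε (hT n) (hE n)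
    have h2 := pow_le_pow_left₀ (norm_nonneg _) (hK₀' n) 2
    rw [h.init_p, h.init_q] at h1
    rw [h.init_p] at h2
    have h3 : ‖p n (T n) - z‖ ^ 2 ≤ c ^ 2 * ‖p n (T n) - z‖ ^ 2 :=
      le_mul_of_one_le_left (sq_nonneg _) (by nlinarith)
    linarith
  · set K := Real.sqrt (‖v₀‖ ^ 2 + K₀ ^ 2) with hK
    set β := 2 * K₀ ^ 2 + ‖(r - 1) • (p₀ - z) + v₀‖ ^ 2 + ‖v₀‖ ^ 2 + 1 with hβ
    have hβ0 : 0 ≤ β := by positivity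
    -- The first summand bounds the distance from z of a comparison flow with tiny noise, the second
    -- the distance between the two flows.
    set N := Real.sqrt (2 * β) + (τ + 1) * (Real.sqrt β / (τ - 1)) with hN
    refine ⟨‖z‖ + N, fun n => (tri n).trans ?_⟩
    gcongr
    set t := T n with ht
    have ht1 : 1 ≤ t := hT n
    have hδ := h.pos n
    -- The index m plays the role of the noise-free flow, chosen after n. Its Lyapunov error at the
    -- time t is below 1, the summand reserved in β, and half of the margin τ - 1 survives after δₘ
    -- is subtracted.
    have ev1 : ∀ᶠ m in atTop, δ m < (τ - 1) / 2 * δ n :=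
      h.tendsto_zero.eventually_lt_const (mul_pos (by linarith) hδ)
    have ev2 : ∀ᶠ m in atTop, (r - 1) * (C * δ m) * K * t ^ 2 < 1 := by
      have : Tendsto (fun m => (r - 1) * (C * δ m) * K * t ^ 2) atTop
          (𝓝 ((r - 1) * (C * 0) * K * t ^ 2)) :=
        (((h.tendsto_zero.const_mul C).const_mul _).mul_const _).mul_const _
      exact this.eventually_lt_const (by simp)
    obtain ⟨m, hm1, hm2⟩ := (ev1.and ev2).exists
    have hr0 := hK₀' m
    have hr0' := pow_le_pow_left₀ (norm_nonneg _) hr0 2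
    have hEK : ‖q m 1‖ ^ 2 + ‖A (p m 1) - yn m‖ ^ 2 ≤ K ^ 2 := by
      rw [hK, Real.sq_sqrt (by positivity), h.init_q]
      gcongr
    have hL := (h.flow m).lyapunov_le_of_div hη hr hz (h.noise m) ht1 (Real.sqrt_nonneg _) hEK
    rw [h.init_q] at hL
    rw [h.init_p] at hL hr0'
    have hLβ : 2 * (t ^ 2 * ‖A (p m t) - yn m‖ ^ 2) + ‖(r - 1) • (p m t - z) + t • q m t‖ ^ 2 +
        t ^ 2 * ‖q m t‖ ^ 2 ≤ β := by linarith
    have hem : ‖p m t - z‖ ≤ Real.sqrt (2 * β) := by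
      apply Real.le_sqrt_of_sq_le
      have h2 := norm_sq_le_two_mul_add (a := t • q m t) (b := (r - 1) • (p m t - z) + t • q m t)
      rw [add_sub_cancel_right, norm_smul, norm_smul, mul_pow, mul_pow, Real.norm_eq_abs,
        Real.norm_eq_abs, sq_abs, sq_abs] at h2
      have h3 : ‖p m t - z‖ ^ 2 ≤ (r - 1) ^ 2 * ‖p m t - z‖ ^ 2 :=
        le_mul_of_one_le_left (sq_nonneg _) (by nlinarith)
      have h4 : 0 ≤ t ^ 2 * ‖A (p m t) - yn m‖ ^ 2 := by positivity
      linarith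
    have hsm : t * Real.sqrt (‖q m t‖ ^ 2 + ‖A (p m t) - yn m‖ ^ 2) ≤ Real.sqrt β := by
      apply Real.le_sqrt_of_sq_le
      rw [mul_pow, Real.sq_sqrt (by positivity)]
      have h4 : 0 ≤ t ^ 2 * ‖A (p m t) - yn m‖ ^ 2 := by positivity
      nlinarith [sq_nonneg ‖(r - 1) • (p m t - z) + t • q m t‖]
    have hip : p n 1 = p m 1 := by rw [h.init_p, h.init_p]
    have hiq : q n 1 = q m 1 := by rw [h.init_q, h.init_q]
    have hyy := h.norm_data_sub_le n m
    -- The energy of flow n at t is at least (C τ δₙ)², while that of flow m decays like 1/t². As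
    -- the square roots differ by at most C (δₙ + δₘ), the product δₙ t is bounded independently of
    -- n.
    have hδt : (τ - 1) * (C * δ n * t) ≤ 2 * Real.sqrt β := by
      have h1 := (h.flow n).sqrt_energy_le (h.flow m) hη0 hip hiq ht1
      have h2 := Real.le_sqrt_of_sq_le (hE n)
      have h3 : C * τ * δ n ≤ Real.sqrt (‖q m t‖ ^ 2 + ‖A (p m t) - yn m‖ ^ 2) +
          C * (δ n + (τ - 1) / 2 * δ n) := by
        have := mul_le_mul_of_nonneg_left hm1.le hC.le
        linarith
      have h4 : C * ((τ - 1) / 2 * δ n) ≤ Real.sqrt (‖q m t‖ ^ 2 + ‖A (p m t) - yn m‖ ^ 2) := by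
        linarith
      have := mul_le_mul_of_nonneg_left h4 (zero_le_one.trans ht1)
      linarith
    -- The velocities differ by at most the data difference, so the positions drift apart at most
    -- linearly in t; this is harmless because δₙ t is bounded.
    have hpp : ‖p n t - p m t‖ ≤ C * (δ n + δ m) * t := by
      have h1 := IsDampedFlow.dist_le_of_velocity_dist_le
        (M := ‖yn n - yn m‖) ((h.flow n).sub (h.flow m)).continuousOn_p
        ((h.flow n).sub (h.flow m)).hasDerivAt_p
        (fun s hs => (h.flow n).velocity_dist_le (h.flow m) hη0 hip hiq hs.le) ht1
      rw [Pi.sub_apply, Pi.sub_apply, hip, sub_self, sub_zero] at h1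
      refine h1.trans (mul_le_mul hyy (by linarith) (by linarith) ((norm_nonneg _).trans hyy))
    have hpp' : ‖p n t - p m t‖ ≤ (τ + 1) * (Real.sqrt β / (τ - 1)) := by
      have h5 : C * δ n * t ≤ 2 * (Real.sqrt β / (τ - 1)) := by
        rw [← mul_div_assoc, le_div_iff₀ (by linarith)]
        linarith
      have h6 : C * (δ n + δ m) * t ≤ (τ + 1) / 2 * (C * δ n * t) := by
        have : C * (δ n + δ m) ≤ C * ((τ + 1) / 2 * δ n) := by
          apply mul_le_mul_of_nonneg_left _ hC.le
          linarith
        have := mul_le_mul_of_nonneg_right this (zero_le_one.trans ht1)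
        linarith
      have := mul_le_mul_of_nonneg_left h5 (by linarith : 0 ≤ (τ + 1) / 2)
      linarith
    have := norm_sub_le_norm_sub_add_norm_sub (p n t) (p m t) z
    linarith

/-- If the stopped residuals vanish asymptotically, the stopped flows converge weakly as soon as
their components along `ker A` do. -/
lemma weaklyConverges [CompleteSpace H] [CompleteSpace Y]
    (h : IsNoisyDampedFlows A t₀ η C y p₀ v₀ δ yn p q) (hη : IsDamping t₀ η)
    (hC : 0 < C) {τ : ℝ} (hτ : 1 < τ) {T : ℕ → ℝ} (hT : ∀ n, t₀ ≤ T n)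
    (hE : ∀ n, (C * τ * δ n) ^ 2 ≤ ‖q n (T n)‖ ^ 2 + ‖A (p n (T n)) - yn n‖ ^ 2)
    (hr : ∀ n, ‖A (p n (T n)) - yn n‖ ≤ C * τ * δ n)
    {γ c : ℝ → ℝ} (hγ : IsFreeProfile t₀ η γ c) {c' : ℝ} {pdag : H} (hp : A pdag = y)
    (hpk : ∀ w, A w = 0 → inner ℝ pdag w = inner ℝ p₀ w + c' * inner ℝ v₀ w)
    (hlim : ∀ w, A w = 0 → Tendsto (fun n => c (T n) * inner ℝ v₀ w) atTop
      (𝓝 (c' * inner ℝ v₀ w))) :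
    WeaklyConverges (fun n => p n (T n)) pdag := by
  obtain ⟨R, hR⟩ := h.exists_bound hη hC hτ hp hT hE
  refine weaklyConverges_of_ker A hR ?_ fun w hw => ?_
  · rw [hp, tendsto_iff_norm_sub_tendsto_zero]
    have hb : Tendsto (fun n => C * τ * δ n + C * δ n) atTop (𝓝 0) := by
      simpa using (h.tendsto_zero.const_mul (C * τ)).add (h.tendsto_zero.const_mul C)
    refine squeeze_zero (fun _ => norm_nonneg _) (fun n => ?_) hb
    have := norm_sub_le_norm_sub_add_norm_sub (A (p n (T n))) (yn n) y
    linarith [hr n, h.noise n]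
  · simp_rw [fun n => (h.flow n).inner_position hγ hw (hT n), h.init_p, h.init_q]
    rw [hpk w hw]
    exact tendsto_const_nhds.add (hlim w hw)

end IsNoisyDampedFlows

/-- There are solutions of `A x = y` with prescribed component along `ker A`. -/
lemma exists_solution_with_ker_component [CompleteSpace H] (A : H →L[ℝ] Y) (z x : H) :
    ∃ x', A x' = A z ∧ ∀ w, A w = 0 → inner ℝ x' w = inner ℝ x w := by
  obtain ⟨a, ha, b, hb, hab⟩ := A.ker.exists_add_mem_mem_orthogonal (x - z)
  refine ⟨z + a, ?_, fun w hw => ?_⟩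
  · have : A a = 0 := by simpa using ha
    rw [map_add, this, add_zero]
  · have h1 : inner ℝ b w = 0 := by
      rw [real_inner_comm]
      exact hb w (by simpa using hw)
    have h2 : x = z + a + b := by rw [add_assoc, ← hab]; abel
    rw [h2, inner_add_left (z + a), h1, add_zero]

/-- Convergence for the total energy principle, and for arbitrary roots of the discrepancy function
when the initial velocity is orthogonal to `ker A`. -/
theorem exists_weak_limit_totalEnergy [CompleteSpace H] [CompleteSpace Y] {A : H →L[ℝ] Y}
    {t₀ : ℝ} {η : ℝ → ℝ} (hη : IsDamping t₀ η) {C τ : ℝ} (hC : 0 < C) (hτ : 1 < τ)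
    {y : Y} (hy : ∃ z, A z = y) (p₀ v₀ : H) :
    ∃ pdag, A pdag = y ∧
      (∀ (δ : ℕ → ℝ) (yn : ℕ → Y) (p q : ℕ → ℝ → H) (T : ℕ → ℝ),
        IsNoisyDampedFlows A t₀ η C y p₀ v₀ δ yn p q → (∀ n, t₀ ≤ T n) →
        (∀ n, ‖q n (T n)‖ ^ 2 + ‖A (p n (T n)) - yn n‖ ^ 2 = (C * τ * δ n) ^ 2) →
        WeaklyConverges (fun n => p n (T n)) pdag) ∧
      ((∀ w, A w = 0 → inner ℝ v₀ w = 0) →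
        ∀ (δ : ℕ → ℝ) (yn : ℕ → Y) (p q : ℕ → ℝ → H) (T : ℕ → ℝ),
          IsNoisyDampedFlows A t₀ η C y p₀ v₀ δ yn p q → (∀ n, t₀ ≤ T n) →
          (∀ n, ‖A (p n (T n)) - yn n‖ = C * τ * δ n) →
          WeaklyConverges (fun n => p n (T n)) pdag) := by
  obtain ⟨γ, G, hG, hγ, hγ0, hγ1⟩ := hη.exists_freeProfile
  obtain ⟨z, rfl⟩ := hy
  -- G 0 is the position coefficient at which the free velocity has died out, so the limit has the
  -- kernel component of p₀ + G 0 • v₀. If v₀ is orthogonal to ker A, this coefficient plays no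
  -- role.
  obtain ⟨x, hx, hxk⟩ := exists_solution_with_ker_component A z (p₀ + G 0 • v₀)
  simp only [inner_add_left, inner_smul_left, RCLike.conj_to_real] at hxk
  refine ⟨x, hx, fun δ yn p q T h hT hE => ?_, fun hv δ yn p q T h hT hE => ?_⟩
  · have hpos : ∀ n, 0 ≤ C * τ * δ n := fun n => by have := h.pos n; positivity
    refine h.weaklyConverges hη hC hτ hT (fun n => (hE n).ge) (fun n => ?_) hγ hx hxk
      fun w hw => ?_
    · exact (abs_le_of_sq_le_sq' (by nlinarith [hE n, sq_nonneg ‖q n (T n)‖]) (hpos n)).2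
    · by_cases hv : inner ℝ v₀ w = 0
      · simp [hv]
      · refine Tendsto.mul_const _ ((hG.tendsto 0).comp ?_)
        -- A total energy root also controls the velocity. Its component along w is γ(Tₙ) times that
        -- of v₀, hence γ(Tₙ) → 0 without any knowledge of the times Tₙ.
        have h1 : Tendsto (fun n => q n (T n)) atTop (𝓝 0) := by
          rw [tendsto_zero_iff_norm_tendsto_zero]
          refine squeeze_zero (fun _ => norm_nonneg _) (g := fun n => C * τ * δ n) (fun n => ?_) ?_
          · exact (abs_le_of_sq_le_sq'
              (by nlinarith [hE n, sq_nonneg ‖A (p n (T n)) - yn n‖]) (hpos n)).2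
          · simpa using h.tendsto_zero.const_mul (C * τ)
        have h2 := h1.inner (tendsto_const_nhds (x := w)) (𝕜 := ℝ)
        simp_rw [fun n => (h.flow n).inner_velocity hγ hw (hT n), h.init_q, inner_zero_left] at h2
        simpa [hv] using h2.mul_const (inner ℝ v₀ w)⁻¹
  · refine h.weaklyConverges hη hC hτ hT (fun n => ?_) (fun n => (hE n).le) hγ hx hxk
      fun w hw => ?_
    · rw [hE n]
      exact le_add_of_nonneg_left (sq_nonneg _)
    · simp [hv w hw]

/-- Subsequential convergence for arbitrary roots of the discrepancy function. -/
theorem exists_subseq_weak_limit [CompleteSpace H] [CompleteSpace Y] {A : H →L[ℝ] Y}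
    {t₀ : ℝ} {η : ℝ → ℝ} (hη : IsDamping t₀ η) {C τ : ℝ} (hC : 0 < C) (hτ : 1 < τ)
    {y : Y} (hy : ∃ z, A z = y) {p₀ v₀ : H}
    {δ : ℕ → ℝ} {yn : ℕ → Y} {p q : ℕ → ℝ → H} {T : ℕ → ℝ}
    (h : IsNoisyDampedFlows A t₀ η C y p₀ v₀ δ yn p q) (hT : ∀ n, t₀ ≤ T n)
    (hE : ∀ n, ‖A (p n (T n)) - yn n‖ = C * τ * δ n) :
    ∃ (pdag : H) (s : ℕ → ℕ), A pdag = y ∧ StrictMono s ∧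
      WeaklyConverges (fun n => p (s n) (T (s n))) pdag := by
  obtain ⟨γ, G, hG, hγ, hγ0, hγ1⟩ := hη.exists_freeProfile
  obtain ⟨z, rfl⟩ := hy
  -- Compactness is used for γ(Tₙ) in [0, 1] rather than for Tₙ, which may be unbounded. Since the
  -- position is a continuous function of γ, this is enough.
  obtain ⟨g, -, s, hs, hg⟩ := (isCompact_Icc (a := (0 : ℝ)) (b := 1)).tendsto_subseq
    (x := fun n => γ (T n)) fun n => ⟨(hγ.vel_pos _ (hT n)).le, hγ1 _ (hT n)⟩
  obtain ⟨x, hx, hxk⟩ := exists_solution_with_ker_component A z (p₀ + G g • v₀)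
  simp only [inner_add_left, inner_smul_left, RCLike.conj_to_real] at hxk
  refine ⟨x, s, hx, hs, (h.comp hs).weaklyConverges hη hC hτ (T := T ∘ s) (fun n => hT _)
    (fun n => ?_) (fun n => (hE _).le) hγ hx hxk fun w _ => ?_⟩
  · simp only [Function.comp_apply, hE]
    exact le_add_of_nonneg_left (sq_nonneg _)
  · exact ((hG.tendsto g).comp hg).mul_const _

end NoisyFlows

/-! ### First roots: comparison with the zeros of the noise-free residual -/

section FirstRoot

variable {H Y : Type} [NormedAddCommGroup H] [InnerProductSpace ℝ H]
  [NormedAddCommGroup Y] [InnerProductSpace ℝ Y]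

/-- A single damped flow with given initial data, driven by data within `C δ` of `y`. -/
structure IsNoisyDampedFlow (A : H →L[ℝ] Y) (t₀ : ℝ) (η : ℝ → ℝ) (C : ℝ) (y : Y) (p₀ v₀ : H)
    (δ : ℝ) (y' : Y) (p q : ℝ → H) : Prop where
  pos : 0 < δ
  noise : ‖y' - y‖ ≤ C * δ
  flow : IsDampedFlow A t₀ η y' p q
  init_p : p t₀ = p₀
  init_q : q t₀ = v₀

/-- The times at which the residuals of all noisy flows are at most the noise, that is, at which
the residual of the noise-free flow vanishes. -/
def exactTimes (A : H →L[ℝ] Y) (t₀ : ℝ) (η : ℝ → ℝ) (C : ℝ) (y : Y) (p₀ v₀ : H) : Set ℝ :=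
  {t | ∀ δ y' p q, IsNoisyDampedFlow A t₀ η C y p₀ v₀ δ y' p q → ‖A (p t) - y'‖ ≤ C * δ}

variable {A : H →L[ℝ] Y} {t₀ : ℝ} {η : ℝ → ℝ} {C : ℝ} {y : Y} {p₀ v₀ : H}

lemma IsNoisyDampedFlows.single {δ : ℕ → ℝ} {yn : ℕ → Y} {p q : ℕ → ℝ → H}
    (h : IsNoisyDampedFlows A t₀ η C y p₀ v₀ δ yn p q) (n : ℕ) :
    IsNoisyDampedFlow A t₀ η C y p₀ v₀ (δ n) (yn n) (p n) (q n) :=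
  ⟨h.pos n, h.noise n, h.flow n, h.init_p n, h.init_q n⟩

/-- One noisy flow whose residual exceeds its noise level bounds all the others from below: any two
residuals differ by at most the sum of the noise levels. Continuity of that single flow gives the
uniformity in time. -/
lemma exists_residual_lower_bound (hη : ∀ t, t₀ < t → 0 ≤ η t) {t : ℝ} (ht : t₀ ≤ t)
    (htZ : t ∉ exactTimes A t₀ η C y p₀ v₀) :
    ∃ κ > 0, ∀ᶠ s in 𝓝[Ici t₀] t, ∀ δ y' p q, IsNoisyDampedFlow A t₀ η C y p₀ v₀ δ y' p q →
      κ - C * δ ≤ ‖A (p s) - y'‖ := by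
  simp only [exactTimes, mem_ofPred_eq, not_forall, not_le] at htZ
  obtain ⟨δ', y', p', q', h', hlt⟩ := htZ
  -- Half of the excess over the noise, so that the bound persists at nearby times.
  set κ := (‖A (p' t) - y'‖ - C * δ') / 2 with hκ
  have hcont := (h'.flow.continuousOn_residual t ht).norm
  refine ⟨κ, by rw [hκ]; linarith, ?_⟩
  filter_upwards [hcont.eventually_const_lt (show C * δ' + κ < ‖A (p' t) - y'‖ by linarith),
    self_mem_nhdsWithin] with s hs hst δ y'' p q h
  have h1 := h'.flow.residual_dist_le h.flow hη (h'.init_p.trans h.init_p.symm)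
    (h'.init_q.trans h.init_q.symm) hst
  have h2 := norm_sub_norm_le (A (p' s) - y') (A (p s) - y'')
  have h3 := norm_sub_le (y' - y) (y'' - y)
  rw [sub_sub_sub_cancel_right] at h3
  linarith [h.noise, h'.noise]

/-- The local bounds patch together over a finite cover, with the minimum of the constants. -/
lemma exists_residual_lower_bound_of_isCompact (hη : ∀ t, t₀ < t → 0 ≤ η t) {K : Set ℝ}
    (hK : IsCompact K) (hK₀ : K ⊆ Ici t₀) (hKZ : ∀ t ∈ K, t ∉ exactTimes A t₀ η C y p₀ v₀) :
    ∃ κ > 0, ∀ s ∈ K, ∀ δ y' p q, IsNoisyDampedFlow A t₀ η C y p₀ v₀ δ y' p q →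
      κ - C * δ ≤ ‖A (p s) - y'‖ := by
  refine hK.induction_on (p := fun S => ∃ κ > 0, ∀ s ∈ S, ∀ δ y' p q,
    IsNoisyDampedFlow A t₀ η C y p₀ v₀ δ y' p q → κ - C * δ ≤ ‖A (p s) - y'‖)
    ⟨1, one_pos, fun s hs => hs.elim⟩ ?_ ?_ ?_
  · rintro s t hst ⟨κ, hκ, h⟩
    exact ⟨κ, hκ, fun x hx => h x (hst hx)⟩
  · rintro s t ⟨κ, hκ, h⟩ ⟨κ', hκ', h'⟩
    refine ⟨min κ κ', lt_min hκ hκ', ?_⟩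
    rintro x (hx | hx) δ y' p q hf
    · linarith [h x hx δ y' p q hf, min_le_left κ κ']
    · linarith [h' x hx δ y' p q hf, min_le_right κ κ']
  · intro x hx
    obtain ⟨κ, hκ, h⟩ := exists_residual_lower_bound hη (hK₀ hx) (hKZ x hx)
    exact ⟨_, nhdsWithin_mono x hK₀ h, κ, hκ, fun s hs => hs⟩

lemma isClosed_exactTimes :
    IsClosed (exactTimes A t₀ η C y p₀ v₀ ∩ Ici t₀) := by
  rw [← closure_subset_iff_isClosed]
  intro t ht
  have ht₀ : t₀ ≤ t := closure_minimal inter_subset_right isClosed_Ici ht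
  refine ⟨?_, ht₀⟩
  intro δ y' p q h
  have hc := (h.flow.continuousOn_residual t ht₀).norm
  have hmem : (𝓝[exactTimes A t₀ η C y p₀ v₀ ∩ Ici t₀] t).NeBot :=
    mem_closure_iff_nhdsWithin_neBot.1 ht
  refine le_of_tendsto (x := 𝓝[exactTimes A t₀ η C y p₀ v₀ ∩ Ici t₀] t) (hc.mono_left (nhdsWithin_mono t inter_subset_right)) ?_
  filter_upwards [self_mem_nhdsWithin] with s hs
  exact hs.1 δ y' p q h

namespace IsNoisyDampedFlows

variable {δ : ℕ → ℝ} {yn : ℕ → Y} {p q : ℕ → ℝ → H} {τ : ℝ}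

lemma residual_lt_of_mem_exactTimes (h : IsNoisyDampedFlows A t₀ η C y p₀ v₀ δ yn p q)
    (hC : 0 < C) (hτ : 1 < τ) {t : ℝ} (ht : t ∈ exactTimes A t₀ η C y p₀ v₀) (n : ℕ) :
    ‖A (p n t) - yn n‖ < C * τ * δ n := by
  have h1 := ht _ _ _ _ (h.single n)
  have := h.pos n
  have : 0 < C * δ n := by positivity
  nlinarith

lemma eventually_lt_residual (h : IsNoisyDampedFlows A t₀ η C y p₀ v₀ δ yn p q)
    (hη : ∀ t, t₀ < t → 0 ≤ η t) {K : Set ℝ} (hK : IsCompact K)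
    (hK₀ : K ⊆ Ici t₀) (hKZ : ∀ t ∈ K, t ∉ exactTimes A t₀ η C y p₀ v₀) :
    ∀ᶠ n in atTop, ∀ t ∈ K, C * τ * δ n < ‖A (p n t) - yn n‖ := by
  obtain ⟨κ, hκ, hb⟩ := exists_residual_lower_bound_of_isCompact hη hK hK₀ hKZ
  have hlim : Tendsto (fun n => C * τ * δ n + C * δ n) atTop (𝓝 0) := by
    simpa using (h.tendsto_zero.const_mul (C * τ)).add (h.tendsto_zero.const_mul C)
  filter_upwards [hlim.eventually_lt_const hκ] with n hn t ht
  linarith [hb t ht _ _ _ _ (h.single n)]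

/-- By the intermediate value theorem the first root lies below any sign change. -/
lemma firstRoot_le (h : IsNoisyDampedFlows A t₀ η C y p₀ v₀ δ yn p q) {T : ℕ → ℝ}
    (hT : ∀ n, IsLeast {S | t₀ ≤ S ∧ ‖A (p n S) - yn n‖ = C * τ * δ n} (T n)) {b : ℝ}
    (hb : t₀ ≤ b) {n : ℕ}
    (hs : C * τ * δ n ∈ uIcc ‖A (p n t₀) - yn n‖ ‖A (p n b) - yn n‖) : T n ≤ b := by
  have hc := (h.flow n).continuousOn_residual.norm.mono
    (show uIcc t₀ b ⊆ Ici t₀ by rw [uIcc_of_le hb]; exact Icc_subset_Ici_self)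
  obtain ⟨S, hS, hSe⟩ := intermediate_value_uIcc hc hs
  rw [uIcc_of_le hb] at hS
  exact ((hT n).2 ⟨hS.1, hSe⟩).trans hS.2

end IsNoisyDampedFlows

/-- The velocity profile at the first roots of the discrepancy function has a limit that does not
depend on the noise: the first roots converge to a fixed time or diverge. -/
lemma exists_limit_at_firstRoot (hη : ∀ t, t₀ < t → 0 ≤ η t) (hC : 0 < C) {τ : ℝ} (hτ : 1 < τ)
    {γ : ℝ → ℝ} (hγ : ContinuousOn γ (Ici t₀)) {γ' : ℝ} (hγ' : Tendsto γ atTop (𝓝 γ')) :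
    ∃ g : ℝ, ∀ (δ : ℕ → ℝ) (yn : ℕ → Y) (p q : ℕ → ℝ → H) (T : ℕ → ℝ),
      IsNoisyDampedFlows A t₀ η C y p₀ v₀ δ yn p q →
      (∀ n, IsLeast {S | t₀ ≤ S ∧ ‖A (p n S) - yn n‖ = C * τ * δ n} (T n)) →
      Tendsto (fun n => γ (T n)) atTop (𝓝 g) := by
  set Z := exactTimes A t₀ η C y p₀ v₀ with hZ
  have conv : ∀ {T : ℕ → ℝ} {t : ℝ}, t₀ ≤ t → (∀ n, t₀ ≤ T n) → Tendsto T atTop (𝓝 t) →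
      Tendsto (fun n => γ (T n)) atTop (𝓝 (γ t)) := fun {T t} ht hT hlim =>
    (hγ t ht).tendsto.comp (tendsto_nhdsWithin_iff.2 ⟨hlim, Eventually.of_forall hT⟩)
  by_cases h₀ : t₀ ∈ Z
  · by_cases hW : (Ici t₀ \ Z).Nonempty
    · have hbdd : BddBelow (Ici t₀ \ Z) := ⟨t₀, fun _ h => h.1⟩
      -- The residual lies below the threshold throughout Z, which excludes roots before the first
      -- exit from Z. Just after it there are times outside Z, where the residual eventually exceeds
      -- the threshold, and the intermediate value theorem places a root before them.
      refine ⟨γ (sInf (Ici t₀ \ Z)), fun δ yn p q T h hT => ?_⟩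
      refine conv (le_csInf hW fun _ h => h.1) (fun n => (hT n).1.1) (tendsto_order.2 ⟨?_, ?_⟩)
      · refine fun a ha => Eventually.of_forall fun n => ha.trans_le (csInf_le hbdd ⟨(hT n).1.1, ?_⟩)
        exact fun hm => (h.residual_lt_of_mem_exactTimes hC hτ hm n).ne (hT n).1.2
      · intro b hb
        obtain ⟨s, hs, hsb⟩ := exists_lt_of_csInf_lt hW hb
        filter_upwards [h.eventually_lt_residual (τ := τ) hη isCompact_singleton
          (singleton_subset_iff.2 hs.1) (by simpa using hs.2)] with n hn
        refine (h.firstRoot_le hT hs.1 ?_).trans_lt hsb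
        have h1 := h.residual_lt_of_mem_exactTimes hC hτ h₀ n
        have h2 := hn s rfl
        exact mem_uIcc_of_le h1.le h2.le
    -- Without times outside Z no root exists, the claim is vacuous and the value 0 is arbitrary.
    · refine ⟨0, fun δ yn p q T h hT => ?_⟩
      rw [not_nonempty_iff_eq_empty, sdiff_eq_empty] at hW
      exact absurd (hT 0).1.2 (h.residual_lt_of_mem_exactTimes hC hτ (hW (hT 0).1.1) 0).ne
  · by_cases hne : (Z ∩ Ici t₀).Nonempty
    · have hbdd : BddBelow (Z ∩ Ici t₀) := ⟨t₀, fun _ h => h.2⟩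
      have hmem := (isClosed_exactTimes (A := A) (η := η) (C := C) (y := y) (p₀ := p₀)
        (v₀ := v₀)).csInf_mem hne hbdd
      -- The residual now starts above the threshold, stays above it on compact intervals before the
      -- first time in Z, and is below it at that time; closedness puts the infimum in Z.
      refine ⟨γ (sInf (Z ∩ Ici t₀)), fun δ yn p q T h hT => ?_⟩
      refine conv hmem.2 (fun n => (hT n).1.1) (tendsto_order.2 ⟨?_, ?_⟩)
      · intro a ha
        filter_upwards [h.eventually_lt_residual (τ := τ) hη (isCompact_Icc (a := t₀) (b := a))
          Icc_subset_Ici_self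
          (fun t ht hm => (csInf_le hbdd ⟨hm, ht.1⟩).not_gt (ht.2.trans_lt ha))] with n hn
        by_contra! hcon
        exact (hn _ ⟨(hT n).1.1, hcon⟩).ne (hT n).1.2.symm
      · intro b hb
        filter_upwards [h.eventually_lt_residual (τ := τ) hη isCompact_singleton
          (singleton_subset_iff.2 (self_mem_Ici (a := t₀))) (by simpa using h₀)] with n hn
        refine (h.firstRoot_le hT hmem.2 ?_).trans_lt hb
        have h1 := h.residual_lt_of_mem_exactTimes hC hτ hmem.1 n
        have h2 := hn _ rfl
        exact mem_uIcc_of_ge h1.le h2.le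
    -- With Z empty, every compact time interval is eventually free of roots, so the stopping times
    -- diverge.
    · refine ⟨γ', fun δ yn p q T h hT => hγ'.comp (tendsto_atTop.2 fun b => ?_)⟩
      filter_upwards [h.eventually_lt_residual (τ := τ) hη (isCompact_Icc (a := t₀) (b := b))
        Icc_subset_Ici_self (fun t ht hm => hne ⟨t, hm, ht.1⟩)] with n hn
      by_contra! hcon
      exact (hn _ ⟨(hT n).1.1, hcon.le⟩).ne (hT n).1.2.symm

/-- Convergence for the first roots of the discrepancy function. -/
theorem exists_weak_limit_firstRoot [CompleteSpace H] [CompleteSpace Y]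
    (hη : IsDamping t₀ η) {τ : ℝ} (hC : 0 < C) (hτ : 1 < τ) (hy : ∃ z, A z = y) :
    ∃ pdag, A pdag = y ∧
      ∀ (δ : ℕ → ℝ) (yn : ℕ → Y) (p q : ℕ → ℝ → H) (T : ℕ → ℝ),
        IsNoisyDampedFlows A t₀ η C y p₀ v₀ δ yn p q →
        (∀ n, IsLeast {S | t₀ ≤ S ∧ ‖A (p n S) - yn n‖ = C * τ * δ n} (T n)) →
        WeaklyConverges (fun n => p n (T n)) pdag := by
  obtain ⟨γ, G, hG, hγ, hγ0, -⟩ := hη.exists_freeProfile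
  obtain ⟨g, hg⟩ := exists_limit_at_firstRoot (A := A) (y := y) (p₀ := p₀) (v₀ := v₀)
    (fun t ht => hη.nonneg ht) hC hτ hγ.continuousOn_vel hγ0
  obtain ⟨z, rfl⟩ := hy
  obtain ⟨x, hx, hxk⟩ := exists_solution_with_ker_component A z (p₀ + G g • v₀)
  simp only [inner_add_left, inner_smul_left, RCLike.conj_to_real] at hxk
  refine ⟨x, hx, fun δ yn p q T h hT => ?_⟩
  refine h.weaklyConverges hη hC hτ (fun n => (hT n).1.1) (fun n => ?_)
    (fun n => (hT n).1.2.le) hγ hx hxk fun w _ => ?_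
  · rw [(hT n).1.2]
    exact le_add_of_nonneg_left (sq_nonneg _)
  · exact ((hG.tendsto g).comp (hg δ yn p q T h hT)).mul_const _

end FirstRoot

/-! ### Finiteness of the surface measure -/

section SurfaceMeasure

/-- Near a point where a strictly differentiable function has nonzero differential, its zero set
has finite `(d - 1)`-dimensional Hausdorff measure. -/
lemma exists_nhds_hausdorffMeasure_zeroSet_lt_top {d : ℕ} {ρ : Eucl d → ℝ} {x : Eucl d}
    {L : Eucl d →L[ℝ] ℝ} (hρ : HasStrictFDerivAt ρ L x) (hL : L ≠ 0) :
    ∃ V ∈ 𝓝 x, Measure.hausdorffMeasure ((d - 1 : ℕ) : ℝ) (V ∩ {y | ρ y = 0}) < ⊤ := by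
  obtain ⟨v, hv⟩ : ∃ v, L v = 1 := by
    obtain ⟨w, hw⟩ : ∃ w, L w ≠ 0 := by
      by_contra! h
      exact hL (ContinuousLinearMap.ext h)
    exact ⟨(L w)⁻¹ • w, by simp [hw]⟩
  -- The projection onto ker L along v. Strict differentiability makes L (y - z) small relative to y
  -- - z for points of the zero set, so π is antilipschitz there and the Hausdorff measure is
  -- compared with that of a bounded set in a (d - 1)-dimensional space.
  set π : Eucl d →L[ℝ] L.ker := (ContinuousLinearMap.id ℝ _ - L.smulRight v).codRestrict L.ker
    (fun y => by simp [hv]) with hπ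
  have hπv : ∀ y, ‖π y‖ = ‖y - L y • v‖ := fun y => rfl
  have hrank : Module.finrank ℝ L.ker = d - 1 := by
    have h1 := Module.Dual.finrank_ker_add_one_of_ne_zero (f := (L : Eucl d →ₗ[ℝ] ℝ))
      (fun h => hL (ContinuousLinearMap.coe_injective h))
    rw [finrank_euclideanSpace_fin] at h1
    have h2 : Module.finrank ℝ L.ker = Module.finrank ℝ (LinearMap.ker (L : Eucl d →ₗ[ℝ] ℝ)) := rfl
    omega
  -- Chosen so that ε‖v‖ ≤ 1/2, which yields the antilipschitz constant 2.
  set ε : ℝ := 1 / (2 * (‖v‖ + 1)) with hε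
  have hε0 : 0 < ε := by positivity
  have hεv : ε * ‖v‖ ≤ 1 / 2 := by
    rw [hε, div_mul_eq_mul_div, one_mul, div_le_div_iff₀ (by positivity) (by norm_num)]
    nlinarith [norm_nonneg v]
  have hev := hρ.isLittleO.def hε0
  rw [nhds_prod_eq] at hev
  obtain ⟨V, hV, hVV⟩ := eventually_prod_self_iff'.1 hev
  obtain ⟨r, hr, hball⟩ := Metric.mem_nhds_iff.1 hV
  refine ⟨Metric.ball x r, Metric.ball_mem_nhds x hr, ?_⟩
  set S := Metric.ball x r ∩ {y | ρ y = 0} with hS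
  have hanti : AntilipschitzWith 2 (fun y : S => π y) := by
    refine AntilipschitzWith.of_le_mul_dist fun y z => ?_
    have h1 := hVV y (hball y.2.1) z (hball z.2.1)
    have hy : ρ y = 0 := y.2.2
    have hz : ρ z = 0 := z.2.2
    simp only [hy, hz, sub_self, zero_sub, norm_neg] at h1
    rw [dist_eq_norm, ← map_sub, Subtype.dist_eq, dist_eq_norm, hπv]
    set e : Eucl d := y - z
    have h2 : ‖e‖ ≤ ‖e - L e • v‖ + ‖L e • v‖ := by
      simpa using norm_add_le (e - L e • v) (L e • v)
    rw [norm_smul] at h2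
    have h3 := mul_le_mul_of_nonneg_right h1 (norm_nonneg v)
    have h4 := mul_le_mul_of_nonneg_right hεv (norm_nonneg e)
    push_cast
    linarith
  have hbd : Bornology.IsBounded ((fun y : S => π y) '' univ) := by
    have : (fun y : S => π y) '' univ ⊆ π '' Metric.ball x r := by
      rintro _ ⟨y, -, rfl⟩
      exact ⟨y, y.2.1, rfl⟩
    exact (π.lipschitz.isBounded_image Metric.isBounded_ball).subset this
  have hfin : Measure.hausdorffMeasure ((d - 1 : ℕ) : ℝ) ((fun y : S => π y) '' univ) < ⊤ := by
    rw [← hrank]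
    exact hbd.measure_lt_top
  calc Measure.hausdorffMeasure ((d - 1 : ℕ) : ℝ) S
      = Measure.hausdorffMeasure ((d - 1 : ℕ) : ℝ) (Subtype.val '' (univ : Set S)) := by simp
    _ = Measure.hausdorffMeasure ((d - 1 : ℕ) : ℝ) (univ : Set S) :=
      isometry_subtype_coe.hausdorffMeasure_image (Or.inl (Nat.cast_nonneg _)) _
    _ ≤ _ := hanti.le_hausdorffMeasure_image (Nat.cast_nonneg _) _
    _ < ⊤ := ENNReal.mul_lt_top (ENNReal.rpow_lt_top_of_nonneg (Nat.cast_nonneg _) (by simp)) hfin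

/-- The boundary is compact and locally contained in regular zero sets. Finiteness places bounded
boundary data, and restrictions of smooth compactly supported functions, in L²(Γ). -/
lemma IsSmoothBoundedDomain.isFiniteMeasure_surfaceMeasure {d : ℕ} {Ω : Set (Eucl d)}
    (hΩ : IsSmoothBoundedDomain Ω) : IsFiniteMeasure (surfaceMeasure Ω) := by
  have hcpt : IsCompact (frontier Ω) :=
    Metric.isCompact_of_isClosed_isBounded isClosed_frontier
      (hΩ.isBounded.closure.subset frontier_subset_closure)
  have hfin : Measure.hausdorffMeasure ((d - 1 : ℕ) : ℝ) (frontier Ω) < ⊤ := by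
    refine hcpt.measure_lt_top_of_nhdsWithin fun x hx => ?_
    obtain ⟨U, hU, hxU, ρ, hρ, hL, hΩU⟩ := hΩ.smooth_boundary x hx
    obtain ⟨V, hV, hfin⟩ := exists_nhds_hausdorffMeasure_zeroSet_lt_top
      (hρ.contDiffAt.hasStrictFDerivAt (by simp)) hL
    refine ⟨(U ∩ V) ∩ frontier Ω, inter_mem (mem_nhdsWithin_of_mem_nhds
      (inter_mem (hU.mem_nhds hxU) hV)) self_mem_nhdsWithin, (measure_mono ?_).trans_lt hfin⟩
    -- A boundary point is a limit of points with ρ < 0, so ρ ≤ 0 there; a negative value would put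
    -- the point inside the open set Ω.
    rintro y ⟨⟨hyU, hyV⟩, hy⟩
    refine ⟨hyV, le_antisymm ?_ ?_⟩
    · have hcl : y ∈ closure (Ω ∩ U) := by
        rw [inter_comm]
        exact hU.inter_closure ⟨hyU, frontier_subset_closure hy⟩
      refine closure_minimal (fun z hz => ?_) (isClosed_le hρ.continuous continuous_const) hcl
      rw [hΩU] at hz
      exact hz.2.le
    · by_contra! hcon
      have : y ∈ Ω ∩ U := by
        rw [hΩU]
        exact ⟨hyU, hcon⟩
      rw [hΩ.isOpen.frontier_eq] at hy
      exact hy.2 this.1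
  constructor
  rw [surfaceMeasure, Measure.restrict_apply_univ, Measure.euclideanHausdorffMeasure_def,
    Measure.smul_apply]
  exact ENNReal.mul_lt_top ENNReal.coe_lt_top hfin

end SurfaceMeasure

/-! ### Completeness of H¹, and real and imaginary parts of Sobolev functions and traces -/

noncomputable section SobolevMaps

variable {d : ℕ} {Ω : Set (Eucl d)} {𝕜 𝕜' : Type} [RCLike 𝕜] [RCLike 𝕜']

lemma continuous_integral_testFun_smul {φ : Eucl d → ℝ} (hc : Continuous φ)
    (hs : HasCompactSupport φ) :
    Continuous fun u : Lp 𝕜 2 (volume.restrict Ω) => ∫ x in Ω, φ x • u x := by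
  have hφ : MemLp (fun x => (φ x : 𝕜)) 2 (volume.restrict Ω) :=
    (hc.memLp_of_hasCompactSupport hs).ofReal
  have : (fun u : Lp 𝕜 2 (volume.restrict Ω) => ∫ x in Ω, φ x • u x) =
      fun u => inner 𝕜 hφ.toLp u := by
    funext u
    rw [L2.inner_def]
    refine integral_congr_ae ?_
    filter_upwards [hφ.coeFn_toLp] with x hx
    rw [hx, RCLike.inner_apply, RCLike.conj_ofReal, mul_comm, RCLike.real_smul_eq_coe_mul]
  rw [this]
  exact continuous_const.inner continuous_id

/-- The map `𝕜ᵈ → 𝕜'ᵈ` acting by `T` on each coordinate. -/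
def coordMap (d : ℕ) (T : 𝕜 →L[ℝ] 𝕜') :
    EuclideanSpace 𝕜 (Fin d) →L[ℝ] EuclideanSpace 𝕜' (Fin d) :=
  ((PiLp.continuousLinearEquiv 2 ℝ (fun _ : Fin d => 𝕜')).symm :
      (Fin d → 𝕜') →L[ℝ] EuclideanSpace 𝕜' (Fin d)) ∘L
    (ContinuousLinearMap.pi fun i => T ∘L ContinuousLinearMap.proj i) ∘L
    ((PiLp.continuousLinearEquiv 2 ℝ (fun _ : Fin d => 𝕜)) :
      EuclideanSpace 𝕜 (Fin d) →L[ℝ] (Fin d → 𝕜))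

lemma coordMap_apply (T : 𝕜 →L[ℝ] 𝕜') (v : EuclideanSpace 𝕜 (Fin d)) (i : Fin d) :
    coordMap d T v i = T (v i) := rfl

lemma isClosed_sobolevH1 : IsClosed (SobolevH1 𝕜 Ω : Set (WithLp 2 (Lp 𝕜 2 (volume.restrict Ω) ×
    Lp (EuclideanSpace 𝕜 (Fin d)) 2 (volume.restrict Ω)))) := by
  have : (SobolevH1 𝕜 Ω : Set (WithLp 2 (Lp 𝕜 2 (volume.restrict Ω) ×
      Lp (EuclideanSpace 𝕜 (Fin d)) 2 (volume.restrict Ω)))) =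
      ⋂ (φ : Eucl d → ℝ) (_ : ContDiff ℝ ∞ φ) (_ : HasCompactSupport φ) (_ : tsupport φ ⊆ Ω)
        (i : Fin d), {z | ∫ x in Ω, (fderiv ℝ φ x (EuclideanSpace.single i 1)) • z.fst x =
          - ∫ x in Ω, φ x • z.snd x i} := by
    ext z
    simp only [mem_iInter]
    rfl
  rw [this]
  refine isClosed_iInter fun φ => isClosed_iInter fun hφ => isClosed_iInter fun hs =>
    isClosed_iInter fun _ => isClosed_iInter fun i => isClosed_eq ?_ ?_
  · refine (continuous_integral_testFun_smul (𝕜 := 𝕜) ?_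
      (hs.fderiv_apply (𝕜 := ℝ) (EuclideanSpace.single i 1))).comp (WithLp.fstL 2 𝕜 _ _).continuous
    exact (hφ.continuous_fderiv (by simp)).clm_apply continuous_const
  · have hproj : ∀ G : Lp (EuclideanSpace 𝕜 (Fin d)) 2 (volume.restrict Ω),
        ∫ x in Ω, φ x • G x i =
          ∫ x in Ω, φ x • ((EuclideanSpace.proj i : EuclideanSpace 𝕜 (Fin d) →L[𝕜] 𝕜).compLpL 2
            (volume.restrict Ω) G) x := fun G => by
      refine integral_congr_ae ?_
      filter_upwards [(EuclideanSpace.proj i : EuclideanSpace 𝕜 (Fin d) →L[𝕜] 𝕜).coeFn_compLpL G]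
        with x hx
      rw [hx]
      rfl
    simp_rw [hproj]
    exact ((continuous_integral_testFun_smul hφ.continuous hs).comp
      (ContinuousLinearMap.continuous _)).comp (WithLp.sndL 2 𝕜 _ _).continuous |>.neg

instance completeSpace_sobolevH1 : CompleteSpace (SobolevH1 𝕜 Ω) :=
  isClosed_sobolevH1.completeSpace_coe

instance completeSpace_sourceSpace (k : SourceKind) : CompleteSpace (SourceSpace k Ω) :=
  match k with
  | .L2 => inferInstanceAs (CompleteSpace (Lp ℝ 2 (volume.restrict Ω)))
  | .H1 => inferInstanceAs (CompleteSpace (SobolevH1 ℝ Ω))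

/-- A real-linear map of the scalars acts on Sobolev functions. -/
def SobolevH1.map (T : 𝕜 →L[ℝ] 𝕜') (u : SobolevH1 𝕜 Ω) : SobolevH1 𝕜' Ω :=
  ⟨WithLp.toLp 2 (T.compLpL 2 _ u.1.fst, (coordMap d T).compLpL 2 _ u.1.snd), by
    intro φ hφ hs ht i
    have h := congrArg T (u.2 φ hφ hs ht i)
    rw [map_neg, ← T.integral_comp_comm
        (integrable_testFun_fderiv_smul hφ hs i (Lp.memLp u.1.fst)),
      ← T.integral_comp_comm
        (integrable_testFun_smul hφ.continuous hs (memLp_coord (Lp.memLp u.1.snd) i))] at h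
    convert! h using 1
    · refine integral_congr_ae ?_
      filter_upwards [T.coeFn_compLpL u.1.fst] with x hx
      rw [map_smul]
      exact congrArg _ hx
    · refine congrArg _ (integral_congr_ae ?_)
      filter_upwards [(coordMap d T).coeFn_compLpL u.1.snd] with x hx
      rw [map_smul]
      exact congrArg (fun v : EuclideanSpace 𝕜' (Fin d) => φ x • v i) hx⟩

lemma SobolevH1.toL2_map (T : 𝕜 →L[ℝ] 𝕜') (u : SobolevH1 𝕜 Ω) :
    SobolevH1.toL2 (SobolevH1.map T u) = T.compLpL 2 _ (SobolevH1.toL2 u) := rfl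

lemma SobolevH1.coeFn_fst_map (T : 𝕜 →L[ℝ] 𝕜') (u : SobolevH1 𝕜 Ω) :
    (SobolevH1.map T u).1.fst =ᵐ[volume.restrict Ω] fun x => T (u.1.fst x) :=
  T.coeFn_compLpL u.1.fst

lemma SobolevH1.coeFn_snd_map (T : 𝕜 →L[ℝ] 𝕜') (u : SobolevH1 𝕜 Ω) :
    (SobolevH1.map T u).1.snd =ᵐ[volume.restrict Ω] fun x => coordMap d T (u.1.snd x) :=
  (coordMap d T).coeFn_compLpL u.1.snd

lemma SobolevH1.continuous_map (T : 𝕜 →L[ℝ] 𝕜') :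
    Continuous (SobolevH1.map T : SobolevH1 𝕜 Ω → SobolevH1 𝕜' Ω) := by
  refine Continuous.subtype_mk ?_ _
  refine (WithLp.prod_continuous_toLp 2 _ _).comp (Continuous.prodMk ?_ ?_)
  · exact (T.compLpL 2 _).continuous.comp
      ((WithLp.fstL 2 𝕜 _ _).continuous.comp continuous_subtype_val)
  · exact ((coordMap d T).compLpL 2 _).continuous.comp
      ((WithLp.sndL 2 𝕜 _ _).continuous.comp continuous_subtype_val)

/-- The trace relation is a closure, and a real-linear scalar map is continuous and sends smooth
pairs to smooth pairs. With the real part, the imaginary part and the inclusion of ℝ, this moves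
between the complex and the real problem. -/
lemma HasTrace.map (T : 𝕜 →L[ℝ] 𝕜') {u : SobolevH1 𝕜 Ω} {v : Lp 𝕜 2 (surfaceMeasure Ω)}
    (h : HasTrace u v) : HasTrace (SobolevH1.map T u) (T.compLpL 2 _ v) := by
  refine map_mem_closure (f := fun z : SobolevH1 𝕜 Ω × Lp 𝕜 2 (surfaceMeasure Ω) =>
    (SobolevH1.map T z.1, T.compLpL 2 _ z.2)) ?_ h ?_
  · exact ((SobolevH1.continuous_map T).comp continuous_fst).prodMk
      ((T.compLpL 2 _).continuous.comp continuous_snd)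
  · rintro ⟨u, v⟩ ⟨φ, hφ, hu, hv⟩
    refine ⟨T ∘ φ, T.contDiff.comp hφ, ?_, ?_⟩
    · filter_upwards [hu, T.coeFn_compLpL (SobolevH1.toL2 u)] with x hx hTx
      simp only [SobolevH1.toL2_map, hTx, hx, Function.comp_apply]
    · filter_upwards [hv, T.coeFn_compLpL v] with x hx hTx
      simp only [hTx, Function.comp_apply]
      exact congrArg T hx

/-- The pairs of a smooth function on `Ω` and its restriction to the boundary. -/
def smoothTracePairs (𝕜 : Type) [RCLike 𝕜] (Ω : Set (Eucl d)) :
    Submodule 𝕜 (SobolevH1 𝕜 Ω × Lp 𝕜 2 (surfaceMeasure Ω)) where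
  carrier := {z | ∃ φ : Eucl d → 𝕜, ContDiff ℝ ∞ φ ∧
      SobolevH1.toL2 z.1 =ᵐ[volume.restrict Ω] φ ∧ z.2 =ᵐ[surfaceMeasure Ω] φ}
  zero_mem' := ⟨0, contDiff_const, Lp.coeFn_zero _ _ _, Lp.coeFn_zero _ _ _⟩
  add_mem' := by
    rintro a b ⟨φ, hφ, h1, h2⟩ ⟨ψ, hψ, h3, h4⟩
    exact ⟨φ + ψ, hφ.add hψ, (Lp.coeFn_add _ _).trans (h1.add h3),
      (Lp.coeFn_add _ _).trans (h2.add h4)⟩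
  smul_mem' := by
    rintro c a ⟨φ, hφ, h1, h2⟩
    exact ⟨c • φ, contDiff_const.smul hφ, (Lp.coeFn_smul _ _).trans (h1.const_smul c),
      (Lp.coeFn_smul _ _).trans (h2.const_smul c)⟩

lemma HasTrace.add {u u' : SobolevH1 𝕜 Ω} {v v' : Lp 𝕜 2 (surfaceMeasure Ω)}
    (h : HasTrace u v) (h' : HasTrace u' v') : HasTrace (u + u') (v + v') :=
  (smoothTracePairs 𝕜 Ω).topologicalClosure.add_mem h h'

lemma HasTrace.smul (c : 𝕜) {u : SobolevH1 𝕜 Ω} {v : Lp 𝕜 2 (surfaceMeasure Ω)}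
    (h : HasTrace u v) : HasTrace (c • u) (c • v) :=
  (smoothTracePairs 𝕜 Ω).topologicalClosure.smul_mem c h

section RealImaginary

lemma L2.inner_eq_add_I_mul {α E F : Type} [MeasurableSpace α] {μ : Measure α}
    [NormedAddCommGroup E] [InnerProductSpace ℂ E]
    [NormedAddCommGroup F] [InnerProductSpace ℝ F] {a b₁ b₂ : Lp F 2 μ} {a' b : Lp E 2 μ}
    (h : ∀ᵐ x ∂μ, inner ℂ (a' x) (b x) =
      (inner ℝ (a x) (b₁ x) : ℂ) + Complex.I * (inner ℝ (a x) (b₂ x) : ℂ)) :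
    inner ℂ a' b = (inner ℝ a b₁ : ℂ) + Complex.I * (inner ℝ a b₂ : ℂ) := by
  rw [L2.inner_def, L2.inner_def, L2.inner_def, ← integral_complex_ofReal, ← integral_complex_ofReal,
    ← integral_const_mul, ← integral_add (L2.integrable_inner _ _).ofReal
      ((L2.integrable_inner _ _).ofReal.const_mul _)]
  exact integral_congr_ae h

lemma inner_ofReal_left (a : ℝ) (b : ℂ) : inner ℂ (Complex.ofRealCLM a) b =
    (inner ℝ a (Complex.reCLM b) : ℂ) + Complex.I * (inner ℝ a (Complex.imCLM b) : ℂ) := by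
  apply Complex.ext <;> simp

lemma inner_coordMap_ofReal_left (a : EuclideanSpace ℝ (Fin d)) (b : EuclideanSpace ℂ (Fin d)) :
    inner ℂ (coordMap d Complex.ofRealCLM a) b =
      (inner ℝ a (coordMap d Complex.reCLM b) : ℂ) +
        Complex.I * (inner ℝ a (coordMap d Complex.imCLM b) : ℂ) := by
  simp only [PiLp.inner_apply, coordMap_apply, inner_ofReal_left, Finset.sum_add_distrib,
    Complex.ofReal_sum, Finset.mul_sum]

lemma SobolevH1.inner_eq (a b : SobolevH1 𝕜 Ω) :
    inner 𝕜 a b = inner 𝕜 a.1.fst b.1.fst + inner 𝕜 a.1.snd b.1.snd :=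
  WithLp.prod_inner_apply a.1 b.1

lemma SobolevH1.inner_map_ofReal_left (a : SobolevH1 ℝ Ω) (b : SobolevH1 ℂ Ω) :
    inner ℂ (SobolevH1.map Complex.ofRealCLM a) b =
      (inner ℝ a (SobolevH1.map Complex.reCLM b) : ℂ) +
        Complex.I * (inner ℝ a (SobolevH1.map Complex.imCLM b) : ℂ) := by
  have h1 : inner ℂ (SobolevH1.map Complex.ofRealCLM a).1.fst b.1.fst =
      (inner ℝ a.1.fst (SobolevH1.map Complex.reCLM b).1.fst : ℂ) +
        Complex.I * (inner ℝ a.1.fst (SobolevH1.map Complex.imCLM b).1.fst : ℂ) := by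
    apply L2.inner_eq_add_I_mul
    filter_upwards [SobolevH1.coeFn_fst_map Complex.ofRealCLM a,
      SobolevH1.coeFn_fst_map Complex.reCLM b, SobolevH1.coeFn_fst_map Complex.imCLM b]
      with x h1 h2 h3
    rw [h1, h2, h3]
    exact inner_ofReal_left _ _
  have h2 : inner ℂ (SobolevH1.map Complex.ofRealCLM a).1.snd b.1.snd =
      (inner ℝ a.1.snd (SobolevH1.map Complex.reCLM b).1.snd : ℂ) +
        Complex.I * (inner ℝ a.1.snd (SobolevH1.map Complex.imCLM b).1.snd : ℂ) := by
    apply L2.inner_eq_add_I_mul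
    filter_upwards [SobolevH1.coeFn_snd_map Complex.ofRealCLM a,
      SobolevH1.coeFn_snd_map Complex.reCLM b, SobolevH1.coeFn_snd_map Complex.imCLM b]
      with x h1 h2 h3
    rw [h1, h2, h3]
    exact inner_coordMap_ofReal_left _ _
  have key : ∀ {z z₁ z₂ : ℂ} {r r₁ r₂ s s₁ s₂ : ℝ}, z = z₁ + z₂ → r = r₁ + r₂ → s = s₁ + s₂ →
      z₁ = r₁ + Complex.I * s₁ → z₂ = r₂ + Complex.I * s₂ → z = r + Complex.I * s := by
    rintro z z₁ z₂ r r₁ r₂ s s₁ s₂ rfl rfl rfl rfl rfl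
    push_cast
    ring
  exact key (SobolevH1.inner_eq _ _) (SobolevH1.inner_eq _ _) (SobolevH1.inner_eq _ _) h1 h2

end RealImaginary

end SobolevMaps

/-! ### The Robin system in operator form: solvability and reciprocity -/

section RobinResolvent

variable {G : Type} [NormedAddCommGroup G] [InnerProductSpace ℝ G]

/-- The real and imaginary parts `zr`, `zi` of a Robin problem in operator form, where `J` is the
operator of the boundary form. -/
def IsRobinPair (J : G →L[ℝ] G) (F K zr zi : G) : Prop :=
  zr - J zr - J zi = F ∧ zi - J zi + J zr = K

/-- In complex notation the system reads (1 - J + iJ)(zr + i zi) = F + iK. Multiplying by 1 - J - iJ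
gives the real operator Q = (1 - J)² + J², which is coercive for symmetric J and commutes with J; S
is its inverse. -/
lemma exists_robinResolvent [CompleteSpace G] {J : G →L[ℝ] G}
    (hJ : ∀ x y, inner ℝ (J x) y = inner ℝ x (J y)) :
    ∃ S : G →L[ℝ] G, ∀ F K zr zi, IsRobinPair J F K zr zi ↔
      zr = S (F - J F + J K) ∧ zi = S (K - J K - J F) := by
  set Q : G →L[ℝ] G := (1 - J) * (1 - J) + J * J with hQ
  have hQa : ∀ x, Q x = x - J x - J (x - J x) + J (J x) := fun x => rfl
  have hunit : IsUnit Q := by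
    -- The quadratic form of Q is ‖x - Jx‖² + ‖Jx‖², and the two vectors add up to x, whence the
    -- constant 1/2.
    refine ContinuousLinearMap.isUnit_of_forall_le_norm_inner_map Q (c := 1 / 2) (by norm_num)
      fun x => ?_
    have h1 : inner ℝ (Q x) x = ‖x - J x‖ ^ 2 + ‖J x‖ ^ 2 := by
      rw [hQa, ← real_inner_self_eq_norm_sq, ← real_inner_self_eq_norm_sq]
      have := hJ (J x) x
      have := hJ x x
      have := hJ (x - J x) x
      simp only [inner_add_left, inner_sub_left, inner_sub_right] at *
      linarith
    have h2 : ‖x‖ ≤ ‖x - J x‖ + ‖J x‖ := by simpa using norm_add_le (x - J x) (J x)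
    rw [h1]
    refine le_trans ?_ (le_abs_self _)
    push_cast
    nlinarith [sq_nonneg (‖x - J x‖ - ‖J x‖), norm_nonneg x]
  obtain ⟨U, hU⟩ := hunit
  have hcomm : Commute J Q := by
    have h1 : Commute J (1 - J) := (Commute.one_right J).sub_right (Commute.refl J)
    exact (h1.mul_right h1).add_right ((Commute.refl J).mul_right (Commute.refl J))
  rw [← hU] at hcomm
  have hJS : ∀ x, J ((↑U⁻¹ : G →L[ℝ] G) x) = (↑U⁻¹ : G →L[ℝ] G) (J x) := fun x =>
    congrArg (fun T : G →L[ℝ] G => T x) hcomm.units_inv_right.eq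
  have hSQ : ∀ x, (↑U⁻¹ : G →L[ℝ] G) (Q x) = x := fun x => by
    rw [← hU]
    exact congrArg (fun T : G →L[ℝ] G => T x) U.inv_mul
  refine ⟨(↑U⁻¹ : G →L[ℝ] G), fun F K zr zi => ⟨?_, ?_⟩⟩
  · rintro ⟨rfl, rfl⟩
    constructor
    · nth_rewrite 1 [← hSQ zr]
      rw [hQa]
      congr 1
      simp only [map_sub, map_add]
      abel
    · nth_rewrite 1 [← hSQ zi]
      rw [hQa]
      congr 1
      simp only [map_sub, map_add]
      abel
  · rintro ⟨rfl, rfl⟩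
    constructor
    · rw [hJS, hJS, ← map_sub, ← map_sub]
      conv_rhs => rw [← hSQ F]
      rw [hQa]
      congr 1
      simp only [map_sub, map_add]
      abel
    · rw [hJS, hJS, ← map_sub, ← map_add]
      conv_rhs => rw [← hSQ K]
      rw [hQa]
      congr 1
      simp only [map_sub, map_add]
      abel

/-- Reciprocity: the symmetry of the Robin problem for sources without boundary data. -/
lemma IsRobinPair.inner_comm {J : G →L[ℝ] G} (hJ : ∀ x y, inner ℝ (J x) y = inner ℝ x (J y))
    {F F' zr zi wr wi : G} (hz : IsRobinPair J F 0 zr zi) (hw : IsRobinPair J F' 0 wr wi) :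
    inner ℝ wi F = inner ℝ zi F' := by
  obtain ⟨hz1, hz2⟩ := hz
  obtain ⟨hw1, hw2⟩ := hw
  -- The imaginary equation of each problem, tested with the real part of the other, writes both
  -- sides as the same expression, symmetric in z and w.
  have e1 := congrArg (inner ℝ zr) hw2
  have e2 := congrArg (inner ℝ wr) hz2
  rw [← hz1, ← hw1]
  simp only [inner_add_right, inner_sub_right, inner_zero_right] at *
  have s1 := hJ zr wr
  have s2 := hJ zi wi
  have s3 := hJ zr wi
  have s4 := hJ zi wr
  have c1 := real_inner_comm (J zr) wr
  have c2 := real_inner_comm (J zi) wi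
  have c3 := real_inner_comm (J zr) wi
  have c4 := real_inner_comm (J zi) wr
  have c5 := real_inner_comm zr wi
  have c6 := real_inner_comm zi wr
  linarith

end RobinResolvent

/-! ### A closed relation as a Hilbert space, and the weak form of the Robin system -/

noncomputable section HilbertGraph

variable {X B Y : Type} [NormedAddCommGroup X] [InnerProductSpace ℝ X]
  [NormedAddCommGroup B] [InnerProductSpace ℝ B] [NormedAddCommGroup Y] [InnerProductSpace ℝ Y]

/-- A subspace `D` of `X × B`, as a subspace of the `ℓ²`-sum `X ⊕ B`. -/
def graphSubmodule (D : Submodule ℝ (X × B)) : Submodule ℝ (WithLp 2 (X × B)) :=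
  D.comap (WithLp.linearEquiv 2 ℝ (X × B)).toLinearMap

/-- A subspace `D` of `X × B`, with the inner product of the `ℓ²`-sum. -/
def HilbertGraph (D : Submodule ℝ (X × B)) : Type := graphSubmodule D

namespace HilbertGraph

variable (D : Submodule ℝ (X × B))

instance : NormedAddCommGroup (HilbertGraph D) :=
  inferInstanceAs (NormedAddCommGroup (graphSubmodule D))

instance : InnerProductSpace ℝ (HilbertGraph D) :=
  inferInstanceAs (InnerProductSpace ℝ (graphSubmodule D))

lemma completeSpace [CompleteSpace X] [CompleteSpace B] (hD : IsClosed (D : Set (X × B))) :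
    CompleteSpace (HilbertGraph D) := by
  have : IsClosed (graphSubmodule D : Set (WithLp 2 (X × B))) :=
    hD.preimage (WithLp.prod_continuous_ofLp 2 _ _)
  exact this.completeSpace_coe

/-- The first component. -/
def fst : HilbertGraph D →L[ℝ] X :=
  ((WithLp.fstL 2 ℝ X B) ∘L (graphSubmodule D).subtypeL : graphSubmodule D →L[ℝ] X)

/-- The second component. -/
def snd : HilbertGraph D →L[ℝ] B :=
  ((WithLp.sndL 2 ℝ X B) ∘L (graphSubmodule D).subtypeL : graphSubmodule D →L[ℝ] B)

variable {D}

lemma mem (z : HilbertGraph D) : (fst D z, snd D z) ∈ D := z.2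

/-- An element of the graph from its components. -/
def mk {u : X} {v : B} (h : (u, v) ∈ D) : HilbertGraph D := (⟨WithLp.toLp 2 (u, v), h⟩ : graphSubmodule D)

lemma inner_eq (z ζ : HilbertGraph D) :
    inner ℝ z ζ = inner ℝ (fst D z) (fst D ζ) + inner ℝ (snd D z) (snd D ζ) :=
  WithLp.prod_inner_apply (𝕜 := ℝ) (E := X) (F := B) (z : graphSubmodule D).1 (ζ : graphSubmodule D).1

variable [CompleteSpace B] [CompleteSpace Y] [CompleteSpace (HilbertGraph D)]

variable (D) in
/-- The operator of the boundary form. -/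
def boundaryOp : HilbertGraph D →L[ℝ] HilbertGraph D := (snd D).adjoint ∘L snd D

/-- The graph inner product is the sum of the interior and the boundary form. As `boundaryOp`
represents the latter, 1 - `boundaryOp` represents the former, which explains the shape of
`IsRobinPair`. -/
lemma inner_boundaryOp (z ζ : HilbertGraph D) :
    inner ℝ z (boundaryOp D ζ) = inner ℝ (snd D z) (snd D ζ) := by
  rw [boundaryOp, ContinuousLinearMap.comp_apply, ContinuousLinearMap.adjoint_inner_right]

lemma boundaryOp_symm (z ζ : HilbertGraph D) :
    inner ℝ (boundaryOp D z) ζ = inner ℝ z (boundaryOp D ζ) := by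
  rw [inner_boundaryOp, real_inner_comm, inner_boundaryOp, real_inner_comm]

variable (D) in
/-- The Riesz representative of a source `f ∈ Y`, acting through `e : X → Y`, and boundary data
`g`. -/
def load (e : X →L[ℝ] Y) (f : Y) (g : B) : HilbertGraph D :=
  (e ∘L fst D).adjoint f + (snd D).adjoint g

lemma inner_load (e : X →L[ℝ] Y) (ζ : HilbertGraph D) (f : Y) (g : B) :
    inner ℝ ζ (load D e f g) = inner ℝ (e (fst D ζ)) f + inner ℝ (snd D ζ) g := by
  rw [load, inner_add_right, ContinuousLinearMap.adjoint_inner_right,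
    ContinuousLinearMap.adjoint_inner_right, ContinuousLinearMap.comp_apply]

lemma load_zero (e : X →L[ℝ] Y) : load D e 0 0 = 0 := by simp [load]

lemma load_sub (e : X →L[ℝ] Y) (f f' : Y) (g g' : B) :
    load D e (f - f') (g - g') = load D e f g - load D e f' g' := by
  simp only [load, map_sub]
  abel

/-- Weak form of the real system satisfied by the real and imaginary parts of a Robin solution. -/
lemma isRobinPair_iff {e : X →L[ℝ] Y} {f f' : Y} {g g' : B} {zr zi : HilbertGraph D} :
    IsRobinPair (boundaryOp D) (load D e f g) (load D e f' g') zr zi ↔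
      ∀ ζ : HilbertGraph D,
        inner ℝ (fst D ζ) (fst D zr) - inner ℝ (snd D ζ) (snd D zi) =
          inner ℝ (e (fst D ζ)) f + inner ℝ (snd D ζ) g ∧
        inner ℝ (fst D ζ) (fst D zi) + inner ℝ (snd D ζ) (snd D zr) =
          inner ℝ (e (fst D ζ)) f' + inner ℝ (snd D ζ) g' := by
  have h1 : ∀ ζ : HilbertGraph D, inner ℝ ζ (zr - boundaryOp D zr - boundaryOp D zi) =
      inner ℝ (fst D ζ) (fst D zr) - inner ℝ (snd D ζ) (snd D zi) := fun ζ => by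
    rw [inner_sub_right, inner_sub_right, inner_boundaryOp, inner_boundaryOp, inner_eq]
    ring
  have h2 : ∀ ζ : HilbertGraph D, inner ℝ ζ (zi - boundaryOp D zi + boundaryOp D zr) =
      inner ℝ (fst D ζ) (fst D zi) + inner ℝ (snd D ζ) (snd D zr) := fun ζ => by
    rw [inner_add_right, inner_sub_right, inner_boundaryOp, inner_boundaryOp, inner_eq]
    ring
  constructor
  · rintro ⟨e1, e2⟩ ζ
    rw [← h1, ← h2, e1, e2, inner_load, inner_load]
    exact ⟨rfl, rfl⟩
  · intro h
    constructor
    · refine ext_inner_left ℝ fun ζ => ?_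
      rw [h1, inner_load]
      exact (h ζ).1
    · refine ext_inner_left ℝ fun ζ => ?_
      rw [h2, inner_load]
      exact (h ζ).2

lemma isRobinPair_iff_of_zero {e : X →L[ℝ] Y} {f : Y} {g g' : B} {zr zi : HilbertGraph D} :
    IsRobinPair (boundaryOp D) (load D e f g) (load D e 0 g') zr zi ↔
      ∀ ζ : HilbertGraph D,
        inner ℝ (fst D ζ) (fst D zr) - inner ℝ (snd D ζ) (snd D zi) =
          inner ℝ (e (fst D ζ)) f + inner ℝ (snd D ζ) g ∧
        inner ℝ (fst D ζ) (fst D zi) + inner ℝ (snd D ζ) (snd D zr) = inner ℝ (snd D ζ) g' := by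
  rw [isRobinPair_iff]
  simp only [inner_zero_right, zero_add]

end HilbertGraph

end HilbertGraph

/-! ### The forward map, its adjoint and the Cauchy problem -/

noncomputable section GraphForwardMap

namespace HilbertGraph

variable {X B Y P : Type} [NormedAddCommGroup X] [InnerProductSpace ℝ X]
  [NormedAddCommGroup B] [InnerProductSpace ℝ B] [NormedAddCommGroup Y] [InnerProductSpace ℝ Y]
  [NormedAddCommGroup P] [InnerProductSpace ℝ P]
  (D : Submodule ℝ (X × B)) [CompleteSpace B] [CompleteSpace Y] [CompleteSpace (HilbertGraph D)]

/-- The solution operator of the Robin system. -/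
def resolvent : HilbertGraph D →L[ℝ] HilbertGraph D :=
  (exists_robinResolvent (J := boundaryOp D) boundaryOp_symm).choose

variable {D}

lemma isRobinPair_iff_resolvent {F K zr zi : HilbertGraph D} :
    IsRobinPair (boundaryOp D) F K zr zi ↔
      zr = resolvent D (F - boundaryOp D F + boundaryOp D K) ∧
      zi = resolvent D (K - boundaryOp D K - boundaryOp D F) :=
  (exists_robinResolvent (J := boundaryOp D) boundaryOp_symm).choose_spec F K zr zi

lemma exists_robinPair (F K : HilbertGraph D) :
    ∃ zr zi, IsRobinPair (boundaryOp D) F K zr zi :=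
  ⟨_, _, isRobinPair_iff_resolvent.2 ⟨rfl, rfl⟩⟩

lemma load_eq_add (e : X →L[ℝ] Y) (f : Y) (g : B) :
    load D e f g = load D e f 0 + load D e 0 g := by simp [load]

lemma load_zero_right (e : X →L[ℝ] Y) (f : Y) : load D e f 0 = (e ∘L fst D).adjoint f := by
  simp [load]

variable (D) in
/-- The linear part of the map sending a source to the imaginary part of the solution of the Robin
problem. -/
def forwardMap (e : X →L[ℝ] Y) (S : P →L[ℝ] Y) : P →L[ℝ] Y :=
  -((e ∘L fst D) ∘L resolvent D ∘L boundaryOp D ∘L (e ∘L fst D).adjoint ∘L S)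

variable (D) in
/-- The element of `Y` such that the imaginary part of the solution of the Robin problem with
boundary data `(g₁, g₂)` is `forwardMap p - boundaryData g₁ g₂`. -/
def boundaryData (e : X →L[ℝ] Y) (g₁ g₂ : B) : Y :=
  -e (fst D (resolvent D
    (load D e 0 g₁ - boundaryOp D (load D e 0 g₁) - boundaryOp D (load D e 0 g₂))))

lemma boundaryData_sub (e : X →L[ℝ] Y) (g₁ g₂ h₁ h₂ : B) :
    boundaryData D e (g₁ - h₁) (g₂ - h₂) = boundaryData D e g₁ g₂ - boundaryData D e h₁ h₂ := by
  have h : ∀ g h : B, load D e 0 (g - h) = load D e 0 g - load D e 0 h := fun g h => by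
    rw [← load_sub, sub_zero]
  simp only [boundaryData, h, map_sub]
  abel

lemma boundaryData_zero (e : X →L[ℝ] Y) : boundaryData D e 0 0 = 0 := by
  simp [boundaryData, load_zero]

/-- The resolvent formula for the imaginary part is linear in the loads, so source and boundary data
contribute separately. This turns the discrepancy into a residual. -/
lemma eq_forwardMap_sub {e : X →L[ℝ] Y} {S : P →L[ℝ] Y} {p : P} {g₁ g₂ : B}
    {zr zi : HilbertGraph D}
    (h : IsRobinPair (boundaryOp D) (load D e (S p) g₂) (load D e 0 g₁) zr zi) :
    e (fst D zi) = forwardMap D e S p - boundaryData D e g₁ g₂ := by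
  rw [(isRobinPair_iff_resolvent.1 h).2, load_eq_add e (S p), load_zero_right, forwardMap,
    boundaryData]
  simp only [neg_apply, ContinuousLinearMap.comp_apply, map_add, map_sub]
  abel

/-- The adjoint of the forward map is given by the solution of the adjoint problem. -/
lemma inner_forwardMap {e : X →L[ℝ] Y} (S : P →L[ℝ] Y) {U : Y} {wr wi : HilbertGraph D}
    (h : IsRobinPair (boundaryOp D) (load D e U 0) (load D e 0 0) wr wi) (p : P) :
    inner ℝ U (forwardMap D e S p) = inner ℝ (e (fst D wi)) (S p) := by
  obtain ⟨zr, zi, hz⟩ := exists_robinPair (load D e (S p) 0) (load D e 0 0)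
  have hzi := eq_forwardMap_sub hz
  rw [boundaryData_zero, sub_zero] at hzi
  rw [load_zero] at h hz
  have key := hz.inner_comm boundaryOp_symm h
  rw [inner_load, inner_load, inner_zero_right, inner_zero_right, add_zero, add_zero, hzi] at key
  rw [key, real_inner_comm]

/-- The element `z` solves the variational problem with source `f`, Dirichlet data `g₁` and Neumann
data `g₂`. -/
def IsCauchySolution (e : X →L[ℝ] Y) (f : Y) (g₁ g₂ : B) (z : HilbertGraph D) : Prop :=
  snd D z = g₁ ∧ ∀ ζ : HilbertGraph D,
    inner ℝ (fst D z) (fst D ζ) = inner ℝ (e (fst D ζ)) f + inner ℝ (snd D ζ) g₂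

/-- The Cauchy problem is solvable exactly for the solutions of the forward equation. That the
boundary values of the imaginary part vanish follows from the solvability for some source. -/
lemma exists_isCauchySolution_iff {e : X →L[ℝ] Y} {S : P →L[ℝ] Y} {g₁ g₂ : B}
    (hinj : ∀ z : HilbertGraph D, e (fst D z) = 0 → fst D z = 0)
    (hdense : ∀ a b : B, (∀ ζ : HilbertGraph D, inner ℝ (snd D ζ) a = inner ℝ (snd D ζ) b) → a = b)
    (hexact : ∃ p z, IsCauchySolution (D := D) e (S p) g₁ g₂ z) (p : P) :
    (∃ z, IsCauchySolution (D := D) e (S p) g₁ g₂ z) ↔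
      forwardMap D e S p = boundaryData D e g₁ g₂ := by
  constructor
  · rintro ⟨z, hz, hw⟩
    have hpair : IsRobinPair (boundaryOp D) (load D e (S p) g₂) (load D e 0 g₁) z 0 := by
      refine isRobinPair_iff_of_zero.2 fun ζ => ⟨?_, ?_⟩
      · rw [map_zero, inner_zero_right, sub_zero, real_inner_comm, hw]
      · rw [map_zero, inner_zero_right, zero_add, hz]
    have := eq_forwardMap_sub hpair
    rw [map_zero, map_zero] at this
    exact sub_eq_zero.1 this.symm
  · intro hp
    obtain ⟨pe, ze, -, hwe⟩ := hexact
    obtain ⟨zr, zi, hz⟩ := exists_robinPair (load D e (S p) g₂) (load D e 0 g₁)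
    have hzi : e (fst D zi) = 0 := by rw [eq_forwardMap_sub hz, hp, sub_self]
    have hzi1 := hinj zi hzi
    have hz := isRobinPair_iff_of_zero.1 hz
    have hzr2 : snd D zr = g₁ := hdense _ _ fun ζ => by
      rw [← (hz ζ).2, hzi1, inner_zero_right, zero_add]
    -- The relation D need not be single-valued, so a vanishing function does not give a vanishing
    -- boundary value. The real equation and the given Cauchy solution, both tested with zi,
    -- evaluate the pairing with g₂ as -‖snd zi‖² and as 0.
    have hzi2 : snd D zi = 0 := by
      have e1 := (hz zi).1
      have e2 := hwe zi
      rw [hzi1, map_zero, inner_zero_right, inner_zero_left, zero_add] at e2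
      rw [hzi1, map_zero, inner_zero_left, inner_zero_left, zero_add, ← e2, zero_sub,
        neg_eq_zero] at e1
      exact inner_self_eq_zero.1 e1
    refine ⟨zr, hzr2, fun ζ => ?_⟩
    rw [real_inner_comm, ← (hz ζ).1, hzi2, inner_zero_right, sub_zero]

end HilbertGraph

end GraphForwardMap

/-! ### The trace graph of Ω -/

noncomputable section TraceGraph

variable {d : ℕ} {Ω : Set (Eucl d)}

/-- The graph of the trace, as a Hilbert space with the norm of `H¹(Ω) × L²(Γ)`. -/
abbrev TraceGraph (Ω : Set (Eucl d)) : Type := HilbertGraph (smoothTracePairs ℝ Ω).topologicalClosure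

instance completeSpace_traceGraph : CompleteSpace (TraceGraph Ω) :=
  HilbertGraph.completeSpace _ (Submodule.isClosed_topologicalClosure _)

/-- The embedding of `H¹(Ω)` into `L²(Ω)`. -/
def sobolevToL2 (Ω : Set (Eucl d)) : SobolevH1 ℝ Ω →L[ℝ] Lp ℝ 2 (volume.restrict Ω) :=
  (WithLp.fstL 2 ℝ _ _) ∘L (SobolevH1 ℝ Ω).subtypeL

namespace TraceGraph

/-- The Sobolev function of an element of the trace graph. -/
def toH1 (z : TraceGraph Ω) : SobolevH1 ℝ Ω := HilbertGraph.fst _ z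

/-- The trace of an element of the trace graph. -/
def trace (z : TraceGraph Ω) : Lp ℝ 2 (surfaceMeasure Ω) := HilbertGraph.snd _ z

variable (Ω) in
/-- The square integrable function of an element of the trace graph. -/
def toL2 : TraceGraph Ω →L[ℝ] Lp ℝ 2 (volume.restrict Ω) :=
  sobolevToL2 Ω ∘L HilbertGraph.fst _

lemma hasTrace (z : TraceGraph Ω) : HasTrace (toH1 z) (trace z) := HilbertGraph.mem z

/-- An element of the trace graph from a function and its trace. -/
def mk {u : SobolevH1 ℝ Ω} {v : Lp ℝ 2 (surfaceMeasure Ω)} (h : HasTrace u v) : TraceGraph Ω :=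
  HilbertGraph.mk h

lemma trace_mk {u : SobolevH1 ℝ Ω} {v : Lp ℝ 2 (surfaceMeasure Ω)} (h : HasTrace u v) :
    trace (mk h) = v := rfl

lemma toL2_eq (z : TraceGraph Ω) : toL2 Ω z = SobolevH1.toL2 (toH1 z) := rfl

variable (Ω) in
/-- The operator of the boundary form. -/
def boundaryOp : TraceGraph Ω →L[ℝ] TraceGraph Ω := HilbertGraph.boundaryOp _

/-- The Riesz representative of a source `f` in `Ω` and boundary data `g`. -/
def load (f : Lp ℝ 2 (volume.restrict Ω)) (g : Lp ℝ 2 (surfaceMeasure Ω)) : TraceGraph Ω :=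
  HilbertGraph.load _ (sobolevToL2 Ω) f g

lemma isRobinPair_iff {f : Lp ℝ 2 (volume.restrict Ω)} {g g' : Lp ℝ 2 (surfaceMeasure Ω)}
    {zr zi : TraceGraph Ω} : IsRobinPair (boundaryOp Ω) (load f g) (load 0 g') zr zi ↔
      ∀ ζ : TraceGraph Ω,
        inner ℝ (toH1 ζ) (toH1 zr) - inner ℝ (trace ζ) (trace zi) =
          inner ℝ (toL2 Ω ζ) f + inner ℝ (trace ζ) g ∧
        inner ℝ (toH1 ζ) (toH1 zi) + inner ℝ (trace ζ) (trace zr) = inner ℝ (trace ζ) g' :=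
  HilbertGraph.isRobinPair_iff_of_zero

end TraceGraph

/-! ### Equivalence of the complex Robin problem and the real system -/

section Complexification

lemma integral_mul_star_eq {α : Type} [MeasurableSpace α] {μ : Measure α} {a b c₁ c₂ : Lp ℝ 2 μ}
    {w ψ : α → ℂ} (hw : ∀ᵐ x ∂μ, w x = (c₁ x : ℂ) + Complex.I * (c₂ x : ℂ))
    (hψ : ∀ᵐ x ∂μ, ψ x = (a x : ℂ) + Complex.I * (b x : ℂ)) :
    ∫ x, w x * star (ψ x) ∂μ = ((inner ℝ a c₁ + inner ℝ b c₂ : ℝ) : ℂ) +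
      Complex.I * ((inner ℝ a c₂ - inner ℝ b c₁ : ℝ) : ℂ) := by
  have hi := fun u v : Lp ℝ 2 μ => L2.integrable_inner (𝕜 := ℝ) u v
  simp only [L2.inner_def]
  rw [← integral_add (hi a c₁) (hi b c₂), ← integral_sub (hi a c₂) (hi b c₁),
    ← integral_complex_ofReal, ← integral_complex_ofReal, ← integral_const_mul,
    ← integral_add ((hi a c₁).add (hi b c₂)).ofReal
      (((hi a c₂).sub (hi b c₁)).ofReal.const_mul _)]
  refine integral_congr_ae ?_
  filter_upwards [hw, hψ] with x h1 h2
  rw [h1, h2]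
  apply Complex.ext
  · simp
  · simp
    ring

lemma integral_ofReal_mul_star_eq {α : Type} [MeasurableSpace α] {μ : Measure α}
    {a b c : Lp ℝ 2 μ} {w ψ : α → ℂ} (hw : ∀ᵐ x ∂μ, w x = (c x : ℂ))
    (hψ : ∀ᵐ x ∂μ, ψ x = (a x : ℂ) + Complex.I * (b x : ℂ)) :
    ∫ x, w x * star (ψ x) ∂μ = (inner ℝ a c : ℂ) - Complex.I * (inner ℝ b c : ℂ) := by
  have hw' : ∀ᵐ x ∂μ, w x = (c x : ℂ) + Complex.I * ((0 : Lp ℝ 2 μ) x : ℂ) := by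
    filter_upwards [hw, Lp.coeFn_zero ℝ 2 μ] with x h1 h2
    rw [h1, h2]
    simp
  rw [integral_mul_star_eq hw' hψ, inner_zero_right, inner_zero_right]
  push_cast
  ring

lemma integral_mul_star_ofReal_eq {α : Type} [MeasurableSpace α] {μ : Measure α}
    {a c₁ c₂ : Lp ℝ 2 μ} {w : α → ℂ}
    (hw : ∀ᵐ x ∂μ, w x = (c₁ x : ℂ) + Complex.I * (c₂ x : ℂ)) :
    ∫ x, w x * star ((Complex.ofRealCLM.compLpL 2 μ a) x) ∂μ =
      (inner ℝ a c₁ : ℂ) + Complex.I * (inner ℝ a c₂ : ℂ) := by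
  have hψ : ∀ᵐ x ∂μ, (Complex.ofRealCLM.compLpL 2 μ a) x =
      (a x : ℂ) + Complex.I * ((0 : Lp ℝ 2 μ) x : ℂ) := by
    filter_upwards [Complex.ofRealCLM.coeFn_compLpL a, Lp.coeFn_zero ℝ 2 μ] with x h1 h2
    rw [h1, h2]
    simp
  rw [integral_mul_star_eq hw hψ, inner_zero_left, inner_zero_left]
  push_cast
  ring

lemma integral_ofReal_mul_star_ofReal_eq {α : Type} [MeasurableSpace α] {μ : Measure α}
    {a c : Lp ℝ 2 μ} {w : α → ℂ} (hw : ∀ᵐ x ∂μ, w x = (c x : ℂ)) :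
    ∫ x, w x * star ((Complex.ofRealCLM.compLpL 2 μ a) x) ∂μ = (inner ℝ a c : ℂ) := by
  have hw' : ∀ᵐ x ∂μ, w x = (c x : ℂ) + Complex.I * ((0 : Lp ℝ 2 μ) x : ℂ) := by
    filter_upwards [hw, Lp.coeFn_zero ℝ 2 μ] with x h1 h2
    rw [h1, h2]
    simp
  rw [integral_mul_star_ofReal_eq hw', inner_zero_right, Complex.ofReal_zero, mul_zero, add_zero]

lemma Lp.ae_eq_re_add_im {α : Type} [MeasurableSpace α] {μ : Measure α} (w : Lp ℂ 2 μ) :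
    ∀ᵐ x ∂μ, w x = ((Complex.reCLM.compLpL 2 μ w) x : ℂ) +
      Complex.I * ((Complex.imCLM.compLpL 2 μ w) x : ℂ) := by
  filter_upwards [Complex.reCLM.coeFn_compLpL w, Complex.imCLM.coeFn_compLpL w] with x h1 h2
  rw [h1, h2]
  apply Complex.ext <;> simp

lemma Lp.ae_ofReal_add_I_smul_eq {α : Type} [MeasurableSpace α] {μ : Measure α}
    (v w : Lp ℝ 2 μ) :
    ∀ᵐ x ∂μ, (Complex.ofRealCLM.compLpL 2 μ v + Complex.I • Complex.ofRealCLM.compLpL 2 μ w : Lp ℂ 2 μ) x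
      = (v x : ℂ) + Complex.I * (w x : ℂ) := by
  filter_upwards [Complex.ofRealCLM.coeFn_compLpL v, Complex.ofRealCLM.coeFn_compLpL w,
    Lp.coeFn_add (Complex.ofRealCLM.compLpL 2 μ v) (Complex.I • Complex.ofRealCLM.compLpL 2 μ w),
    Lp.coeFn_smul Complex.I (Complex.ofRealCLM.compLpL 2 μ w)] with x h1 h2 h3 h4
  rw [h3, Pi.add_apply, h4, Pi.smul_apply, h1, h2]
  simp

lemma imNorm_eq (u : SobolevH1 ℂ Ω) :
    imNorm u = ‖Complex.imCLM.compLpL 2 (volume.restrict Ω) (SobolevH1.toL2 u)‖ := by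
  rw [imNorm, norm_eq_sqrt_real_inner, L2.inner_def]
  congr 1
  refine integral_congr_ae ?_
  filter_upwards [Complex.imCLM.coeFn_compLpL (SobolevH1.toL2 u)] with x hx
  rw [hx, real_inner_self_eq_norm_sq, Real.norm_eq_abs, sq_abs]
  simp

/-- The real part of a complex Sobolev function with trace, in the real trace graph. -/
def rePart {u : SobolevH1 ℂ Ω} {u' : Lp ℂ 2 (surfaceMeasure Ω)} (h : HasTrace u u') :
    TraceGraph Ω := TraceGraph.mk (h.map Complex.reCLM)

/-- The imaginary part of a complex Sobolev function with trace, in the real trace graph. -/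
def imPart {u : SobolevH1 ℂ Ω} {u' : Lp ℂ 2 (surfaceMeasure Ω)} (h : HasTrace u u') :
    TraceGraph Ω := TraceGraph.mk (h.map Complex.imCLM)

variable {f : Lp ℝ 2 (volume.restrict Ω)} {g₁ g₂ : Lp ℝ 2 (surfaceMeasure Ω)}
  {f' g' : Eucl d → ℂ}

/-- Real test functions suffice in this direction: the real and imaginary parts of the complex
identity are the two equations of the system. -/
lemma IsRobinSolution.exists_pair (hf : ∀ᵐ x ∂volume.restrict Ω, f' x = (f x : ℂ))
    (hg : ∀ᵐ x ∂surfaceMeasure Ω, g' x = (g₂ x : ℂ) + Complex.I * (g₁ x : ℂ)) {u : SobolevH1 ℂ Ω}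
    (h : IsRobinSolution Ω f' g' u) :
    ∃ zr zi : TraceGraph Ω, IsRobinPair (TraceGraph.boundaryOp Ω) (TraceGraph.load f g₂)
      (TraceGraph.load 0 g₁) zr zi ∧
      TraceGraph.toL2 Ω zi = Complex.imCLM.compLpL 2 _ (SobolevH1.toL2 u) := by
  obtain ⟨u', hu, h⟩ := h
  have key : ∀ {p q s t a b c : ℝ} {z₁ z₂ z₃ z₄ : ℂ}, z₁ + Complex.I * z₂ = z₃ + z₄ →
      z₁ = p + Complex.I * q → z₂ = s + Complex.I * t → z₃ = a → z₄ = b + Complex.I * c →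
      p - t = a + b ∧ q + s = c := by
    rintro p q s t a b c _ _ _ _ h rfl rfl rfl rfl
    have hr := congrArg Complex.re h
    have hi := congrArg Complex.im h
    simp at hr hi
    constructor <;> linarith
  exact ⟨rePart hu, imPart hu, TraceGraph.isRobinPair_iff.2 fun ζ =>
    key (h _ _ (ζ.hasTrace.map Complex.ofRealCLM)) (SobolevH1.inner_map_ofReal_left _ _)
      (integral_mul_star_ofReal_eq (Lp.ae_eq_re_add_im u'))
      (integral_ofReal_mul_star_ofReal_eq hf) (integral_mul_star_ofReal_eq hg), rfl⟩

lemma SobolevH1.inner_add_smul {𝕜 : Type} [RCLike 𝕜] (c : 𝕜) (a b b' : SobolevH1 𝕜 Ω) :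
    inner 𝕜 a (b + c • b') = inner 𝕜 a b + c * inner 𝕜 a b' := by
  rw [inner_add_right]
  exact congrArg _ (inner_smul_right (𝕜 := 𝕜) a.1 b'.1 c)

lemma SobolevH1.inner_map_ofReal_right (a : SobolevH1 ℝ Ω) (b : SobolevH1 ℂ Ω) :
    inner ℂ b (SobolevH1.map Complex.ofRealCLM a) =
      (inner ℝ (SobolevH1.map Complex.reCLM b) a : ℂ) -
        Complex.I * (inner ℝ (SobolevH1.map Complex.imCLM b) a : ℂ) := by
  have key : ∀ {p q p' q' : ℝ} {z z' : ℂ}, z = starRingEnd ℂ z' → z' = p + Complex.I * q →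
      p' = p → q' = q → z = p' - Complex.I * q' := by
    rintro p q _ _ _ _ rfl rfl rfl rfl
    simp [sub_eq_add_neg]
  exact key (inner_conj_symm b _).symm (SobolevH1.inner_map_ofReal_left a b)
    (real_inner_comm _ _) (real_inner_comm _ _)

/-- The solution is zr + i zi. A complex test function is split into its real and imaginary parts,
and the system tested with both gives the complex identity. -/
lemma IsRobinPair.exists_solution (hf : ∀ᵐ x ∂volume.restrict Ω, f' x = (f x : ℂ))
    (hg : ∀ᵐ x ∂surfaceMeasure Ω, g' x = (g₂ x : ℂ) + Complex.I * (g₁ x : ℂ))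
    {zr zi : TraceGraph Ω} (h : IsRobinPair (TraceGraph.boundaryOp Ω) (TraceGraph.load f g₂)
      (TraceGraph.load 0 g₁) zr zi) :
    ∃ u, IsRobinSolution Ω f' g' u ∧
      Complex.imCLM.compLpL 2 _ (SobolevH1.toL2 u) = TraceGraph.toL2 Ω zi := by
  have h := TraceGraph.isRobinPair_iff.1 h
  refine ⟨SobolevH1.map Complex.ofRealCLM zr.toH1 +
    Complex.I • SobolevH1.map Complex.ofRealCLM zi.toH1, ⟨_, (zr.hasTrace.map Complex.ofRealCLM).add
      ((zi.hasTrace.map Complex.ofRealCLM).smul Complex.I), fun ψ ψ' hψ => ?_⟩, ?_⟩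
  · have key : ∀ {x₁ x₂ y₁ y₂ s₁ s₂ s₃ s₄ f₁ f₂ g₁ g₂ g₃ g₄ : ℝ} {z x y z₂ z₃ z₄ : ℂ},
        z = x + Complex.I * y → x = x₁ - Complex.I * x₂ → y = y₁ - Complex.I * y₂ →
        z₂ = ((s₁ + s₂ : ℝ) : ℂ) + Complex.I * ((s₃ - s₄ : ℝ) : ℂ) →
        z₃ = f₁ - Complex.I * f₂ →
        z₄ = ((g₁ + g₂ : ℝ) : ℂ) + Complex.I * ((g₃ - g₄ : ℝ) : ℂ) →
        (x₁ - s₃ = f₁ + g₁ ∧ y₁ + s₁ = g₃) → (x₂ - s₂ = f₂ + g₄ ∧ y₂ + s₄ = g₂) →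
        z + Complex.I * z₂ = z₃ + z₄ := by
      rintro x₁ x₂ y₁ y₂ s₁ s₂ s₃ s₄ f₁ f₂ g₁ g₂ g₃ g₄ _ _ _ _ _ _ rfl rfl rfl rfl rfl rfl
        ⟨h1, h2⟩ ⟨h3, h4⟩
      apply Complex.ext
      · simp
        linarith
      · simp
        linarith
    refine key (SobolevH1.inner_add_smul _ _ _ _)
      (SobolevH1.inner_map_ofReal_right _ _) (SobolevH1.inner_map_ofReal_right _ _)
      (integral_mul_star_eq (Lp.ae_ofReal_add_I_smul_eq zr.trace zi.trace)
        (Lp.ae_eq_re_add_im ψ'))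
      (integral_ofReal_mul_star_eq hf (Lp.ae_eq_re_add_im (SobolevH1.toL2 ψ)))
      (integral_mul_star_eq hg (Lp.ae_eq_re_add_im ψ')) (h (rePart hψ)) (h (imPart hψ))
  · refine Lp.ext ?_
    filter_upwards [Complex.imCLM.coeFn_compLpL (SobolevH1.toL2
      (SobolevH1.map Complex.ofRealCLM zr.toH1 +
        Complex.I • SobolevH1.map Complex.ofRealCLM zi.toH1)),
      Lp.ae_ofReal_add_I_smul_eq (SobolevH1.toL2 zr.toH1) (SobolevH1.toL2 zi.toH1)] with x h1 h2
    refine h1.trans ((congrArg Complex.im h2).trans ?_)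
    rw [TraceGraph.toL2_eq]
    generalize SobolevH1.toL2 zr.toH1 x = r
    simp

end Complexification

end TraceGraph

/-! ### Smooth functions in H¹, density of traces, uniqueness of the weak gradient -/

noncomputable section SmoothFunctions

variable {d : ℕ} {Ω : Set (Eucl d)}

/-- Smooth compactly supported functions, with their classical gradient, belong to `H¹(Ω)`. -/
lemma exists_sobolevH1_of_contDiff {φ : Eucl d → ℝ} (hφ : ContDiff ℝ ∞ φ)
    (hs : HasCompactSupport φ) :
    ∃ u : SobolevH1 ℝ Ω, SobolevH1.toL2 u =ᵐ[volume.restrict Ω] φ := by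
  set D : Eucl d → EuclideanSpace ℝ (Fin d) :=
    fun x => WithLp.toLp 2 fun i => fderiv ℝ φ x (EuclideanSpace.single i 1) with hD
  have hdc : ∀ {ψ : Eucl d → ℝ}, ContDiff ℝ ∞ ψ → ∀ i : Fin d,
      Continuous fun x => fderiv ℝ ψ x (EuclideanSpace.single i 1) := fun h i =>
    (h.continuous_fderiv (by simp)).clm_apply continuous_const
  have hDc : Continuous D :=
    (PiLp.continuous_toLp 2 _).comp (continuous_pi fun i => hdc hφ i)
  have hDs : HasCompactSupport D := by
    refine hs.fderiv (𝕜 := ℝ) |>.mono fun x hx h0 => hx ?_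
    ext i
    simp [hD, h0]
  have hm1 : MemLp φ 2 (volume.restrict Ω) := hφ.continuous.memLp_of_hasCompactSupport hs
  have hm2 : MemLp D 2 (volume.restrict Ω) := hDc.memLp_of_hasCompactSupport hDs
  refine ⟨⟨WithLp.toLp 2 (hm1.toLp, hm2.toLp), ?_⟩, hm1.coeFn_toLp⟩
  intro ψ hψ hψs hψΩ i
  have e1 : ∫ x in Ω, (fderiv ℝ ψ x (EuclideanSpace.single i 1)) • hm1.toLp φ x =
      ∫ x in Ω, (fderiv ℝ ψ x (EuclideanSpace.single i 1)) * φ x := by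
    refine integral_congr_ae ?_
    filter_upwards [hm1.coeFn_toLp] with x hx
    rw [hx, smul_eq_mul]
  have e2 : ∫ x in Ω, ψ x • hm2.toLp D x i =
      ∫ x in Ω, ψ x * fderiv ℝ φ x (EuclideanSpace.single i 1) := by
    refine integral_congr_ae ?_
    filter_upwards [hm2.coeFn_toLp] with x hx
    rw [hx, smul_eq_mul]
  refine e1.trans (Eq.trans ?_ (congrArg Neg.neg e2.symm))
  have hzero : ∀ x, x ∉ Ω → x ∉ tsupport ψ := fun x hx h => hx (hψΩ h)
  rw [setIntegral_eq_integral_of_forall_compl_eq_zero fun x hx => by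
      rw [fderiv_of_notMem_tsupport ℝ (hzero x hx)]; simp,
    setIntegral_eq_integral_of_forall_compl_eq_zero fun x hx => by
      rw [image_eq_zero_of_notMem_tsupport (hzero x hx), zero_mul]]
  rw [integral_mul_fderiv_eq_neg_fderiv_mul_of_integrable, neg_neg]
  · exact ((hdc hψ i).mul hφ.continuous).integrable_of_hasCompactSupport hs.mul_left
  · exact (hψ.continuous.mul (hdc hφ i)).integrable_of_hasCompactSupport hψs.mul_right
  · exact (hψ.continuous.mul hφ.continuous).integrable_of_hasCompactSupport hψs.mul_right
  · exact fun x _ => (hψ.differentiable (by simp)).differentiableAt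
  · exact fun x _ => (hφ.differentiable (by simp)).differentiableAt

lemma TraceGraph.exists_of_contDiff [IsFiniteMeasure (surfaceMeasure Ω)] {φ : Eucl d → ℝ}
    (hφ : ContDiff ℝ ∞ φ) (hs : HasCompactSupport φ) :
    ∃ ζ : TraceGraph Ω, trace ζ =ᵐ[surfaceMeasure Ω] φ := by
  obtain ⟨u, hu⟩ := exists_sobolevH1_of_contDiff (Ω := Ω) hφ hs
  have hm : MemLp φ 2 (surfaceMeasure Ω) := hφ.continuous.memLp_of_hasCompactSupport hs
  have htr : HasTrace u (hm.toLp φ) := subset_closure ⟨φ, hφ, hu, hm.coeFn_toLp⟩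
  refine ⟨mk htr, ?_⟩
  rw [trace_mk]
  exact hm.coeFn_toLp

/-- Traces are dense in `L²(Γ)`. -/
lemma TraceGraph.eq_of_inner_trace_eq [IsFiniteMeasure (surfaceMeasure Ω)]
    {a b : Lp ℝ 2 (surfaceMeasure Ω)}
    (h : ∀ ζ : TraceGraph Ω, inner ℝ (trace ζ) a = inner ℝ (trace ζ) b) : a = b := by
  rw [← sub_eq_zero, Lp.eq_zero_iff_ae_eq_zero]
  refine ae_eq_zero_of_integral_contDiff_smul_eq_zero
    ((Lp.memLp (a - b)).locallyIntegrable (by norm_num)) fun φ hφ hs => ?_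
  obtain ⟨ζ, hζ⟩ := TraceGraph.exists_of_contDiff (Ω := Ω) hφ hs
  have h1 : inner ℝ (trace ζ) (a - b) = 0 := by rw [inner_sub_right, h, sub_self]
  rw [← h1, L2.inner_def]
  refine integral_congr_ae ?_
  filter_upwards [hζ] with x hx
  rw [hx]
  simp [mul_comm]

/-- The weak gradient is unique. -/
lemma SobolevH1.eq_zero_of_toL2_eq_zero (hΩ : IsOpen Ω) {u : SobolevH1 ℝ Ω}
    (hu : SobolevH1.toL2 u = 0) : u = 0 := by
  have hw := u.2
  have hfst : u.1.fst = 0 := hu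
  have hsnd : u.1.snd = 0 := by
    rw [Lp.eq_zero_iff_ae_eq_zero]
    have hi : ∀ i : Fin d, ∀ᵐ x ∂volume.restrict Ω, u.1.snd x i = 0 := by
      intro i
      have hm := memLp_coord (Lp.memLp u.1.snd) i
      rw [ae_restrict_iff' hΩ.measurableSet]
      refine hΩ.ae_eq_zero_of_integral_contDiff_smul_eq_zero (f := fun x => u.1.snd x i) ?_ ?_
      · intro x hx
        have h1 := hm.locallyIntegrable (by norm_num) x
        rw [IntegrableAtFilter] at h1
        obtain ⟨s, hs, hsi⟩ := h1
        refine ⟨s ∩ Ω, ?_, ?_⟩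
        · exact inter_mem (mem_nhdsWithin_of_mem_nhds hs) self_mem_nhdsWithin
        · rwa [IntegrableOn, Measure.restrict_restrict' hΩ.measurableSet] at hsi
      · intro φ hφ hs hsub
        have h1 := hw φ hφ hs hsub i
        have h2 : ∫ x in Ω, (fderiv ℝ φ x (EuclideanSpace.single i 1)) • u.1.fst x = 0 := by
          rw [hfst]
          refine integral_eq_zero_of_ae ?_
          filter_upwards [Lp.coeFn_zero ℝ 2 (volume.restrict Ω)] with x hx
          rw [hx]
          simp
        rw [h2, eq_comm, neg_eq_zero] at h1
        rw [← h1, eq_comm]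
        refine setIntegral_eq_integral_of_forall_compl_eq_zero fun x hx => ?_
        rw [image_eq_zero_of_notMem_tsupport fun h => hx (hsub h), zero_smul]
    filter_upwards [ae_all_iff.2 hi] with x hx
    ext i
    exact hx i
  refine Subtype.ext (WithLp.ofLp_injective 2 (Prod.ext hfst hsnd))

end SmoothFunctions

/-! ### The concrete forward map: states, adjoint states and exact sources -/

noncomputable section ForwardMap

variable {d : ℕ} {Ω Ω₀ : Set (Eucl d)} {k : SourceKind}

/-- The embedding of the solution space into `L²(Ω₀)`. -/
def sourceToL2 (k : SourceKind) (Ω₀ : Set (Eucl d)) :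
    SourceSpace k Ω₀ →L[ℝ] Lp ℝ 2 (volume.restrict Ω₀) :=
  match k with
  | .L2 => ContinuousLinearMap.id ℝ (Lp ℝ 2 (volume.restrict Ω₀))
  | .H1 => sobolevToL2 Ω₀

lemma sourceToL2_apply (p : SourceSpace k Ω₀) : sourceToL2 k Ω₀ p = p.toL2 := by
  cases k <;> rfl

lemma memLp_indicator_restrict (hΩ₀ : MeasurableSet Ω₀) (f : Lp ℝ 2 (volume.restrict Ω₀)) :
    MemLp (Ω₀.indicator f) 2 (volume.restrict Ω) :=
  ((memLp_indicator_iff_restrict hΩ₀).2 (Lp.memLp f)).restrict Ω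

lemma indicator_ae_eq_of_ae_restrict (hΩ₀ : MeasurableSet Ω₀) {f g : Eucl d → ℝ}
    (h : f =ᵐ[volume.restrict Ω₀] g) : Ω₀.indicator f =ᵐ[volume.restrict Ω] Ω₀.indicator g := by
  refine ae_restrict_of_ae ?_
  filter_upwards [(ae_restrict_iff' hΩ₀).1 h] with x hx
  by_cases hx₀ : x ∈ Ω₀
  · rw [indicator_of_mem hx₀, indicator_of_mem hx₀, hx hx₀]
  · rw [indicator_of_notMem hx₀, indicator_of_notMem hx₀]

/-- Extension by zero from `L²(Ω₀)` to `L²(Ω)`. -/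
def extendByZero (Ω : Set (Eucl d)) (hΩ₀ : MeasurableSet Ω₀) :
    Lp ℝ 2 (volume.restrict Ω₀) →L[ℝ] Lp ℝ 2 (volume.restrict Ω) :=
  LinearMap.mkContinuous
    { toFun := fun f => (memLp_indicator_restrict hΩ₀ f).toLp
      map_add' := fun f g => by
        rw [← MemLp.toLp_add, MemLp.toLp_eq_toLp_iff, ← indicator_add']
        exact indicator_ae_eq_of_ae_restrict hΩ₀ (Lp.coeFn_add f g)
      map_smul' := fun c f => by
        rw [RingHom.id_apply, ← MemLp.toLp_const_smul, MemLp.toLp_eq_toLp_iff]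
        refine (indicator_ae_eq_of_ae_restrict hΩ₀ (Lp.coeFn_smul c f)).trans ?_
        exact Eventually.of_forall fun x => congrFun (indicator_const_smul Ω₀ c f) x } 1
    fun f => by
      rw [one_mul, LinearMap.coe_mk, AddHom.coe_mk, Lp.norm_toLp, Lp.norm_def]
      refine ENNReal.toReal_mono (Lp.eLpNorm_ne_top f) ?_
      rw [← eLpNorm_indicator_eq_eLpNorm_restrict hΩ₀]
      exact eLpNorm_mono_measure _ Measure.restrict_le_self

/-- The source `p χ_{Ω₀}` in `L²(Ω)`. -/
def sourceTerm (k : SourceKind) (Ω : Set (Eucl d)) (hΩ₀ : MeasurableSet Ω₀) :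
    SourceSpace k Ω₀ →L[ℝ] Lp ℝ 2 (volume.restrict Ω) :=
  extendByZero Ω hΩ₀ ∘L sourceToL2 k Ω₀

lemma sourceTerm_ae_eq (hΩ₀ : MeasurableSet Ω₀) (p : SourceSpace k Ω₀) :
    sourceTerm k Ω hΩ₀ p =ᵐ[volume.restrict Ω] p.extend := by
  refine (MemLp.coeFn_toLp (memLp_indicator_restrict hΩ₀ (sourceToL2 k Ω₀ p))).trans ?_
  rw [sourceToL2_apply]
  rfl

lemma inner_sourceTerm (hΩ₀ : MeasurableSet Ω₀) (hsub : Ω₀ ⊆ Ω) (p : SourceSpace k Ω₀)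
    (f : Lp ℝ 2 (volume.restrict Ω)) :
    inner ℝ f (sourceTerm k Ω hΩ₀ p) = ∫ x in Ω₀, f x * p.toL2 x := by
  have h : ∫ x in Ω₀, f x * p.toL2 x = ∫ x in Ω, Ω₀.indicator (fun x => f x * p.toL2 x) x := by
    rw [setIntegral_indicator hΩ₀, inter_eq_self_of_subset_right hsub]
  rw [L2.inner_def, h]
  refine integral_congr_ae ?_
  filter_upwards [sourceTerm_ae_eq (Ω := Ω) hΩ₀ p] with x hx
  rw [hx, SourceSpace.extend]
  by_cases hx₀ : x ∈ Ω₀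
  · simp [hx₀, mul_comm]
  · simp [hx₀]

lemma TraceGraph.exists_robinPair (F K : TraceGraph Ω) :
    ∃ zr zi, IsRobinPair (boundaryOp Ω) F K zr zi :=
  HilbertGraph.exists_robinPair F K

open TraceGraph

/-- The linear part of `p ↦ u_im(p)`. -/
def forwardMap (k : SourceKind) (Ω : Set (Eucl d)) (hΩ₀ : MeasurableSet Ω₀) :
    SourceSpace k Ω₀ →L[ℝ] Lp ℝ 2 (volume.restrict Ω) :=
  HilbertGraph.forwardMap (smoothTracePairs ℝ Ω).topologicalClosure (sobolevToL2 Ω) (sourceTerm k Ω hΩ₀)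

/-- The element of `L²(Ω)` such that `u_im(p) = forwardMap p - boundaryData` for the boundary data
`(g₁, g₂)`. -/
def boundaryData (g₁ g₂ : Lp ℝ 2 (surfaceMeasure Ω)) : Lp ℝ 2 (volume.restrict Ω) :=
  HilbertGraph.boundaryData (smoothTracePairs ℝ Ω).topologicalClosure (sobolevToL2 Ω) g₁ g₂

lemma boundaryData_sub (g₁ g₂ h₁ h₂ : Lp ℝ 2 (surfaceMeasure Ω)) :
    boundaryData (g₁ - h₁) (g₂ - h₂) = boundaryData g₁ g₂ - boundaryData h₁ h₂ :=
  HilbertGraph.boundaryData_sub (D := (smoothTracePairs ℝ Ω).topologicalClosure) (sobolevToL2 Ω) g₁ g₂ h₁ h₂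

lemma toL2_eq_of_isRobinPair (hΩ₀ : MeasurableSet Ω₀) {p : SourceSpace k Ω₀}
    {g₁ g₂ : Lp ℝ 2 (surfaceMeasure Ω)} {zr zi : TraceGraph Ω}
    (h : IsRobinPair (boundaryOp Ω) (load (sourceTerm k Ω hΩ₀ p) g₂) (load 0 g₁) zr zi) :
    toL2 Ω zi = forwardMap k Ω hΩ₀ p - boundaryData g₁ g₂ :=
  HilbertGraph.eq_forwardMap_sub h

lemma inner_forwardMap (hΩ₀ : MeasurableSet Ω₀) {U : Lp ℝ 2 (volume.restrict Ω)}
    {wr wi : TraceGraph Ω} (h : IsRobinPair (boundaryOp Ω) (load U 0) (load 0 0) wr wi)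
    (p : SourceSpace k Ω₀) :
    inner ℝ U (forwardMap k Ω hΩ₀ p) = inner ℝ (toL2 Ω wi) (sourceTerm k Ω hΩ₀ p) :=
  HilbertGraph.inner_forwardMap (sourceTerm k Ω hΩ₀) h p

variable {G₁ G₂ : Lp ℝ 2 (surfaceMeasure Ω)} {g₁ g₂ : Eucl d → ℝ}

lemma ae_data_eq (hG₁ : G₁ =ᵐ[surfaceMeasure Ω] g₁) (hG₂ : G₂ =ᵐ[surfaceMeasure Ω] g₂) :
    ∀ᵐ x ∂surfaceMeasure Ω, (g₂ x : ℂ) + Complex.I * (g₁ x : ℂ) =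
      (G₂ x : ℂ) + Complex.I * (G₁ x : ℂ) := by
  filter_upwards [hG₁, hG₂] with x h1 h2
  rw [h1, h2]

lemma ae_source_eq (hΩ₀ : MeasurableSet Ω₀) (p : SourceSpace k Ω₀) :
    ∀ᵐ x ∂volume.restrict Ω, (p.extend x : ℂ) = (sourceTerm k Ω hΩ₀ p x : ℂ) := by
  filter_upwards [sourceTerm_ae_eq (Ω := Ω) hΩ₀ p] with x hx
  rw [hx]

lemma IsState.im_eq (hΩ₀ : MeasurableSet Ω₀) (hG₁ : G₁ =ᵐ[surfaceMeasure Ω] g₁)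
    (hG₂ : G₂ =ᵐ[surfaceMeasure Ω] g₂) {p : SourceSpace k Ω₀} {u : SobolevH1 ℂ Ω}
    (h : IsState Ω g₁ g₂ p u) : Complex.imCLM.compLpL 2 (volume.restrict Ω) (SobolevH1.toL2 u) =
      forwardMap k Ω hΩ₀ p - boundaryData G₁ G₂ := by
  obtain ⟨zr, zi, hz, hzi⟩ := IsRobinSolution.exists_pair (ae_source_eq hΩ₀ p)
    (ae_data_eq hG₁ hG₂) h
  rw [← hzi]
  exact toL2_eq_of_isRobinPair hΩ₀ hz

lemma IsState.imNorm_eq (hΩ₀ : MeasurableSet Ω₀) (hG₁ : G₁ =ᵐ[surfaceMeasure Ω] g₁)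
    (hG₂ : G₂ =ᵐ[surfaceMeasure Ω] g₂) {p : SourceSpace k Ω₀} {u : SobolevH1 ℂ Ω}
    (h : IsState Ω g₁ g₂ p u) : imNorm u = ‖forwardMap k Ω hΩ₀ p - boundaryData G₁ G₂‖ := by
  rw [_root_.imNorm_eq, h.im_eq hΩ₀ hG₁ hG₂]

lemma exists_isState (hΩ₀ : MeasurableSet Ω₀) (hG₁ : G₁ =ᵐ[surfaceMeasure Ω] g₁)
    (hG₂ : G₂ =ᵐ[surfaceMeasure Ω] g₂) (p : SourceSpace k Ω₀) : ∃ u, IsState Ω g₁ g₂ p u := by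
  obtain ⟨zr, zi, hz⟩ := exists_robinPair (load (sourceTerm k Ω hΩ₀ p) G₂) (load 0 G₁)
  obtain ⟨u, hu, -⟩ := hz.exists_solution (ae_source_eq hΩ₀ p) (ae_data_eq hG₁ hG₂)
  exact ⟨u, hu⟩

/-- The noise constant bounds the perturbation of the data in `L²(Ω)`. -/
lemma IsNoiseConstant.norm_boundaryData_le {C₀ δ : ℝ} (hC₀ : IsNoiseConstant Ω C₀) (hδ : 0 < δ)
    (hG₁ : G₁ =ᵐ[surfaceMeasure Ω] g₁) (hG₂ : G₂ =ᵐ[surfaceMeasure Ω] g₂)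
    (hg₁ : MemLp g₁ ∞ (surfaceMeasure Ω)) (hg₂ : MemLp g₂ ∞ (surfaceMeasure Ω))
    (hn₁ : eLpNorm g₁ ∞ (surfaceMeasure Ω) ≤ ENNReal.ofReal δ)
    (hn₂ : eLpNorm g₂ ∞ (surfaceMeasure Ω) ≤ ENNReal.ofReal δ) :
    ‖boundaryData G₁ G₂‖ ≤ C₀ * δ := by
  -- The zero source on the empty set is a device for viewing the problem with pure boundary data as
  -- a state, whose imaginary part is -`boundaryData`.
  have h0 : sourceTerm .L2 Ω MeasurableSet.empty 0 = 0 := map_zero _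
  obtain ⟨zr, zi, hz⟩ := exists_robinPair
    (load (sourceTerm .L2 Ω MeasurableSet.empty 0) G₂) (load 0 G₁)
  have hz' : toL2 Ω zi = -boundaryData G₁ G₂ :=
    (toL2_eq_of_isRobinPair MeasurableSet.empty hz).trans (by rw [map_zero, zero_sub])
  have hf : ∀ᵐ x ∂volume.restrict Ω, (0 : Eucl d → ℂ) x =
      (sourceTerm .L2 Ω MeasurableSet.empty 0 x : ℂ) := by
    rw [h0]
    filter_upwards [Lp.coeFn_zero ℝ 2 (volume.restrict Ω)] with x hx
    rw [hx]
    simp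
  obtain ⟨v, hv, hvi⟩ := hz.exists_solution hf (ae_data_eq hG₁ hG₂)
  have := hC₀.2 δ g₁ g₂ hδ hg₁ hg₂ hn₁ hn₂ v hv
  rwa [imNorm_eq, hvi, hz', norm_neg] at this

/-- The gradient of the discrepancy is given by the adjoint state. -/
lemma IsAdjointState.integral_eq (hΩ₀ : MeasurableSet Ω₀) (hsub : Ω₀ ⊆ Ω) {u w : SobolevH1 ℂ Ω}
    {U : Lp ℝ 2 (volume.restrict Ω)} (hU : Complex.imCLM.compLpL 2 _ (SobolevH1.toL2 u) = U)
    (hw : IsAdjointState Ω u w) (h : SourceSpace k Ω₀) :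
    ∫ x in Ω₀, (SobolevH1.toL2 w x).im * h.toL2 x = inner ℝ U (forwardMap k Ω hΩ₀ h) := by
  have hfU : ∀ᵐ x ∂volume.restrict Ω, ((SobolevH1.toL2 u x).im : ℂ) = (U x : ℂ) := by
    rw [← hU]
    filter_upwards [Complex.imCLM.coeFn_compLpL (SobolevH1.toL2 u)] with x hx
    rw [hx]
    rfl
  have hg0 : ∀ᵐ x ∂surfaceMeasure Ω, (0 : Eucl d → ℂ) x =
      ((0 : Lp ℝ 2 (surfaceMeasure Ω)) x : ℂ) +
        Complex.I * ((0 : Lp ℝ 2 (surfaceMeasure Ω)) x : ℂ) := by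
    filter_upwards [Lp.coeFn_zero ℝ 2 (surfaceMeasure Ω)] with x hx
    rw [hx]
    simp
  obtain ⟨wr, wi, hwz, hwi⟩ := IsRobinSolution.exists_pair hfU hg0 hw
  refine Eq.trans ?_ (inner_forwardMap hΩ₀ hwz h).symm
  refine Eq.trans ?_ (inner_sourceTerm hΩ₀ hsub h (toL2 Ω wi)).symm
  rw [hwi]
  refine integral_congr_ae ?_
  have hae := Complex.imCLM.coeFn_compLpL (p := 2) (SobolevH1.toL2 w)
  filter_upwards [ae_restrict_of_ae_restrict_of_subset hsub hae] with y hy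
  rw [hy]
  rfl

/-- A SOAR flow is a damped flow for the forward map. -/
lemma IsSOARFlow.isDampedFlow (hΩ₀ : MeasurableSet Ω₀) (hsub : Ω₀ ⊆ Ω) {t₀ : ℝ} {η : ℝ → ℝ}
    {p₀ v₀ : SourceSpace k Ω₀} {p q : ℝ → SourceSpace k Ω₀} (hG₁ : G₁ =ᵐ[surfaceMeasure Ω] g₁)
    (hG₂ : G₂ =ᵐ[surfaceMeasure Ω] g₂) (h : IsSOARFlow Ω t₀ η p₀ v₀ g₁ g₂ p q) :
    IsDampedFlow (forwardMap k Ω hΩ₀) t₀ η (boundaryData G₁ G₂) p q where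
  continuousOn_p := h.continuousOn_p
  continuousOn_q := h.continuousOn_q
  hasDerivAt_p := h.hasDerivAt_p
  flow t ht := by
    obtain ⟨a, u, w, ha, hu, hw, heq⟩ := h.flow t ht
    exact ⟨a, ha, fun x => (congrArg _
      (hw.integral_eq hΩ₀ hsub (hu.im_eq hΩ₀ hG₁ hG₂) x).symm).trans (heq x)⟩

lemma isExactSource_iff_isCauchySolution (hΩ₀ : MeasurableSet Ω₀)
    (hG₁ : G₁ =ᵐ[surfaceMeasure Ω] g₁) (hG₂ : G₂ =ᵐ[surfaceMeasure Ω] g₂) (p : SourceSpace k Ω₀) :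
    IsExactSource Ω g₁ g₂ p ↔ ∃ z : TraceGraph Ω, HilbertGraph.IsCauchySolution
      (sobolevToL2 Ω) (sourceTerm k Ω hΩ₀ p) G₁ G₂ z := by
  have eqsrc : ∀ ψ : SobolevH1 ℝ Ω, ∫ x in Ω, p.extend x * SobolevH1.toL2 ψ x =
      inner ℝ (sobolevToL2 Ω ψ) (sourceTerm k Ω hΩ₀ p) := fun ψ => by
    rw [L2.inner_def]
    refine integral_congr_ae ?_
    filter_upwards [sourceTerm_ae_eq (Ω := Ω) hΩ₀ p] with x hx
    rw [hx]
    rfl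
  have eqdat : ∀ ψ' : Lp ℝ 2 (surfaceMeasure Ω),
      ∫ x, g₂ x * ψ' x ∂(surfaceMeasure Ω) = inner ℝ ψ' G₂ := fun ψ' => by
    rw [L2.inner_def]
    refine integral_congr_ae ?_
    filter_upwards [hG₂] with x hx
    rw [hx]
    rfl
  constructor
  · rintro ⟨u, u', htr, hu', hw⟩
    exact ⟨TraceGraph.mk htr, Lp.ext (hu'.trans hG₁.symm), fun ζ =>
      (hw _ _ (TraceGraph.hasTrace ζ)).trans (congrArg₂ _ (eqsrc _) (eqdat _))⟩
  · rintro ⟨z, hz, hw⟩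
    refine ⟨toH1 z, trace z, z.hasTrace, ?_, fun ψ ψ' hψ =>
      (hw (TraceGraph.mk hψ)).trans (congrArg₂ _ (eqsrc _) (eqdat _)).symm⟩
    rw [show trace z = G₁ from hz]
    exact hG₁

/-- Exact sources are the solutions of the forward equation. -/
lemma isExactSource_iff (hΩ : IsSmoothBoundedDomain Ω) (hΩ₀ : MeasurableSet Ω₀)
    (hG₁ : G₁ =ᵐ[surfaceMeasure Ω] g₁) (hG₂ : G₂ =ᵐ[surfaceMeasure Ω] g₂)
    (hexact : ∃ p : SourceSpace k Ω₀, IsExactSource Ω g₁ g₂ p) (p : SourceSpace k Ω₀) :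
    IsExactSource Ω g₁ g₂ p ↔ forwardMap k Ω hΩ₀ p = boundaryData G₁ G₂ := by
  have := hΩ.isFiniteMeasure_surfaceMeasure
  obtain ⟨pe, he⟩ := hexact
  exact (isExactSource_iff_isCauchySolution hΩ₀ hG₁ hG₂ p).trans
    (HilbertGraph.exists_isCauchySolution_iff
      (fun _ hz => SobolevH1.eq_zero_of_toL2_eq_zero hΩ.isOpen hz)
      (fun _ _ h => TraceGraph.eq_of_inner_trace_eq h)
      ⟨pe, (isExactSource_iff_isCauchySolution hΩ₀ hG₁ hG₂ pe).1 he⟩ p)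

end ForwardMap

/-! ### Discrepancy roots and noisy flows in abstract terms -/

noncomputable section Discrepancy

variable {d : ℕ} {Ω Ω₀ : Set (Eucl d)} {k : SourceKind} {t₀ C₀ τ δ : ℝ} {g₁ g₂ : Eucl d → ℝ}
  {p q : ℝ → SourceSpace k Ω₀} {T : ℝ}

/-- The datum in `L²(Ω)` determined by bounded boundary data. -/
def boundedData [IsFiniteMeasure (surfaceMeasure Ω)] (hg₁ : MemLp g₁ ∞ (surfaceMeasure Ω))
    (hg₂ : MemLp g₂ ∞ (surfaceMeasure Ω)) : Lp ℝ 2 (volume.restrict Ω) :=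
  boundaryData ((hg₁.mono_exponent le_top).toLp g₁) ((hg₂.mono_exponent le_top).toLp g₂)

variable [IsFiniteMeasure (surfaceMeasure Ω)] (hg₁ : MemLp g₁ ∞ (surfaceMeasure Ω))
  (hg₂ : MemLp g₂ ∞ (surfaceMeasure Ω))

lemma IsNoiseConstant.norm_boundedData_sub_le (hC₀ : IsNoiseConstant Ω C₀) (hδ : 0 < δ)
    {h₁ h₂ : Eucl d → ℝ} (hh₁ : MemLp h₁ ∞ (surfaceMeasure Ω))
    (hh₂ : MemLp h₂ ∞ (surfaceMeasure Ω))
    (hn₁ : eLpNorm (h₁ - g₁) ∞ (surfaceMeasure Ω) ≤ ENNReal.ofReal δ)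
    (hn₂ : eLpNorm (h₂ - g₂) ∞ (surfaceMeasure Ω) ≤ ENNReal.ofReal δ) :
    ‖boundedData hh₁ hh₂ - boundedData hg₁ hg₂‖ ≤ C₀ * δ := by
  have h : ∀ {f g : Eucl d → ℝ} (hf : MemLp f 2 (surfaceMeasure Ω))
      (hg : MemLp g 2 (surfaceMeasure Ω)), hf.toLp f - hg.toLp g =ᵐ[surfaceMeasure Ω] f - g :=
    fun hf hg => by
      rw [← MemLp.toLp_sub]
      exact MemLp.coeFn_toLp _
  have := hC₀.norm_boundaryData_le hδ
    (h (hh₁.mono_exponent le_top) (hg₁.mono_exponent le_top))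
    (h (hh₂.mono_exponent le_top) (hg₂.mono_exponent le_top))
    (hh₁.sub hg₁) (hh₂.sub hg₂) hn₁ hn₂
  rwa [boundaryData_sub] at this

lemma isMorozovRoot_iff (hΩ₀ : MeasurableSet Ω₀) :
    IsMorozovRoot Ω t₀ C₀ τ δ g₁ g₂ p T ↔
      t₀ ≤ T ∧ ‖forwardMap k Ω hΩ₀ (p T) - boundedData hg₁ hg₂‖ = C₀ * τ * δ := by
  have hG₁ := (hg₁.mono_exponent (p := 2) le_top).coeFn_toLp
  have hG₂ := (hg₂.mono_exponent (p := 2) le_top).coeFn_toLp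
  refine and_congr_right fun _ => ⟨?_, fun h => ?_⟩
  · rintro ⟨u, hu, h⟩
    exact (hu.imNorm_eq hΩ₀ hG₁ hG₂).symm.trans (sub_eq_zero.1 h)
  · obtain ⟨u, hu⟩ := exists_isState hΩ₀ hG₁ hG₂ (p T)
    exact ⟨u, hu, sub_eq_zero.2 ((hu.imNorm_eq hΩ₀ hG₁ hG₂).trans h)⟩

lemma IsTotalEnergyRoot.eq (hΩ₀ : MeasurableSet Ω₀)
    (h : IsTotalEnergyRoot Ω t₀ C₀ τ δ g₁ g₂ p q T) :
    ‖q T‖ ^ 2 + ‖forwardMap k Ω hΩ₀ (p T) - boundedData hg₁ hg₂‖ ^ 2 = (C₀ * τ * δ) ^ 2 := by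
  obtain ⟨-, u, hu, h⟩ := h
  have key : ∀ {a b c : ℝ}, a = b → a ^ 2 + c ^ 2 - C₀ ^ 2 * τ ^ 2 * δ ^ 2 = 0 →
      c ^ 2 + b ^ 2 = (C₀ * τ * δ) ^ 2 := by
    rintro a _ c rfl h
    linarith
  exact key (hu.imNorm_eq hΩ₀ (hg₁.mono_exponent (p := 2) le_top).coeFn_toLp
    (hg₂.mono_exponent (p := 2) le_top).coeFn_toLp) h

lemma IsNoisyFlowSequence.isNoisyDampedFlows (hΩ₀ : MeasurableSet Ω₀) (hsub : Ω₀ ⊆ Ω)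
    (hC₀ : IsNoiseConstant Ω C₀) {η : ℝ → ℝ} {p₀ v₀ : SourceSpace k Ω₀} {δ : ℕ → ℝ}
    {g₁n g₂n : ℕ → Eucl d → ℝ} {p q : ℕ → ℝ → SourceSpace k Ω₀}
    (h : IsNoisyFlowSequence Ω t₀ η p₀ v₀ g₁ g₂ δ g₁n g₂n p q) :
    IsNoisyDampedFlows (forwardMap k Ω hΩ₀) t₀ η C₀ (boundedData hg₁ hg₂) p₀ v₀ δ
      (fun n => boundedData (h.memLp₁ n) (h.memLp₂ n)) p q where
  pos := h.pos
  tendsto_zero := h.tendsto_zero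
  noise n := hC₀.norm_boundedData_sub_le hg₁ hg₂ (h.pos n) _ _ (h.noise₁ n) (h.noise₂ n)
  flow n := (h.flow n).isDampedFlow hΩ₀ hsub
    ((h.memLp₁ n).mono_exponent le_top).coeFn_toLp ((h.memLp₂ n).mono_exponent le_top).coeFn_toLp
  init_p n := (h.flow n).init_p
  init_q n := (h.flow n).init_q

lemma isExactSource_iff_forwardMap_eq (hΩ : IsSmoothBoundedDomain Ω) (hΩ₀ : MeasurableSet Ω₀)
    (hexact : ∃ p : SourceSpace k Ω₀, IsExactSource Ω g₁ g₂ p) (p : SourceSpace k Ω₀) :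
    IsExactSource Ω g₁ g₂ p ↔ forwardMap k Ω hΩ₀ p = boundedData hg₁ hg₂ :=
  isExactSource_iff hΩ hΩ₀ (hg₁.mono_exponent le_top).coeFn_toLp
    (hg₂.mono_exponent le_top).coeFn_toLp hexact p

end Discrepancy

/-! ### Transfer of the abstract convergence results -/

theorem theorem4p4 {d : ℕ} (hd : d = 2 ∨ d = 3) (Ω Ω₀ : Set (Eucl d))
    (hΩ : IsSmoothBoundedDomain Ω) (hΩ₀ : IsOpen Ω₀) (hsub : Ω₀ ⊆ Ω)
    (k : SourceKind)
    (g₁ g₂ : Eucl d → ℝ)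
    (hg₁ : MemLp g₁ ∞ (surfaceMeasure Ω)) (hg₂ : MemLp g₂ ∞ (surfaceMeasure Ω))
    (hexact : ∃ p : SourceSpace k Ω₀, IsExactSource Ω g₁ g₂ p)
    (t₀ : ℝ) (η : ℝ → ℝ) (hη : IsDamping t₀ η)
    (p₀ v₀ : SourceSpace k Ω₀)
    (C₀ τ : ℝ) (hC₀ : IsNoiseConstant Ω C₀) (hτ : 1 < τ) :
    -- total energy principle, and Morozov's principle with arbitrary roots for suitable `v₀`
    (∃ pdag : SourceSpace k Ω₀, IsExactSource Ω g₁ g₂ pdag ∧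
      (∀ (δ : ℕ → ℝ) (g₁n g₂n : ℕ → Eucl d → ℝ) (p q : ℕ → ℝ → SourceSpace k Ω₀) (T : ℕ → ℝ),
        IsNoisyFlowSequence Ω t₀ η p₀ v₀ g₁ g₂ δ g₁n g₂n p q →
        (∀ n, IsTotalEnergyRoot Ω t₀ C₀ τ (δ n) (g₁n n) (g₂n n) (p n) (q n) (T n)) →
        WeaklyConverges (fun n => p n (T n)) pdag) ∧
      ((∀ a b : SourceSpace k Ω₀, IsExactSource Ω g₁ g₂ a → IsExactSource Ω g₁ g₂ b →
          inner ℝ v₀ (a - b) = 0) →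
        ∀ (δ : ℕ → ℝ) (g₁n g₂n : ℕ → Eucl d → ℝ) (p q : ℕ → ℝ → SourceSpace k Ω₀) (T : ℕ → ℝ),
          IsNoisyFlowSequence Ω t₀ η p₀ v₀ g₁ g₂ δ g₁n g₂n p q →
          (∀ n, IsMorozovRoot Ω t₀ C₀ τ (δ n) (g₁n n) (g₂n n) (p n) (T n)) →
          WeaklyConverges (fun n => p n (T n)) pdag)) ∧
    -- Morozov's principle, stopping at the first root
    (∃ pdag : SourceSpace k Ω₀, IsExactSource Ω g₁ g₂ pdag ∧
      ∀ (δ : ℕ → ℝ) (g₁n g₂n : ℕ → Eucl d → ℝ) (p q : ℕ → ℝ → SourceSpace k Ω₀) (T : ℕ → ℝ),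
        IsNoisyFlowSequence Ω t₀ η p₀ v₀ g₁ g₂ δ g₁n g₂n p q →
        (∀ n, IsLeast {S | IsMorozovRoot Ω t₀ C₀ τ (δ n) (g₁n n) (g₂n n) (p n) S} (T n)) →
        WeaklyConverges (fun n => p n (T n)) pdag) ∧
    -- Morozov's principle, arbitrary choice of the roots
    (∀ (δ : ℕ → ℝ) (g₁n g₂n : ℕ → Eucl d → ℝ) (p q : ℕ → ℝ → SourceSpace k Ω₀) (T : ℕ → ℝ),
      IsNoisyFlowSequence Ω t₀ η p₀ v₀ g₁ g₂ δ g₁n g₂n p q →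
      (∀ n, IsMorozovRoot Ω t₀ C₀ τ (δ n) (g₁n n) (g₂n n) (p n) (T n)) →
      ∃ (pdag : SourceSpace k Ω₀) (s : ℕ → ℕ), IsExactSource Ω g₁ g₂ pdag ∧ StrictMono s ∧
        WeaklyConverges (fun n => p (s n) (T (s n))) pdag) := by
  have := hΩ.isFiniteMeasure_surfaceMeasure
  have hm := hΩ₀.measurableSet
  have hiff := isExactSource_iff_forwardMap_eq hg₁ hg₂ hΩ hm hexact
  have hy : ∃ z, forwardMap k Ω hm z = boundedData hg₁ hg₂ :=
    hexact.imp fun z hz => (hiff z).1 hz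
  refine ⟨?_, ?_, fun δ g₁n g₂n p q T h hT => ?_⟩
  · obtain ⟨x, hx, hTE, hM⟩ := exists_weak_limit_totalEnergy hη hC₀.1 hτ hy p₀ v₀
    refine ⟨x, (hiff x).2 hx, fun δ g₁n g₂n p q T h hT => ?_, fun hv δ g₁n g₂n p q T h hT => ?_⟩
    · exact hTE _ _ _ _ _ (h.isNoisyDampedFlows hg₁ hg₂ hm hsub hC₀) (fun n => (hT n).1)
        fun n => (hT n).eq _ _ hm
    · have hroot := fun n => (isMorozovRoot_iff (h.memLp₁ n) (h.memLp₂ n) hm).1 (hT n)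
      refine hM (fun w hw => ?_) _ _ _ _ _ (h.isNoisyDampedFlows hg₁ hg₂ hm hsub hC₀)
        (fun n => (hroot n).1) fun n => (hroot n).2
      -- Adding w ∈ ker A to an exact source gives another one, so orthogonality to differences of
      -- exact sources is orthogonality to ker A.
      have := hv (x + w) x ((hiff _).2 (by rw [map_add, hw, add_zero, hx])) ((hiff x).2 hx)
      rwa [add_sub_cancel_left] at this
  · obtain ⟨x, hx, hlim⟩ := exists_weak_limit_firstRoot (p₀ := p₀) (v₀ := v₀) hη hC₀.1 hτ hy
    refine ⟨x, (hiff x).2 hx, fun δ g₁n g₂n p q T h hT => ?_⟩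
    refine hlim _ _ _ _ _ (h.isNoisyDampedFlows hg₁ hg₂ hm hsub hC₀) fun n => ?_
    have hset := Set.ext fun S =>
      isMorozovRoot_iff (T := S) (t₀ := t₀) (C₀ := C₀) (τ := τ) (δ := δ n) (p := p n)
        (h.memLp₁ n) (h.memLp₂ n) hm
    exact hset ▸ hT n
  · have hroot := fun n => (isMorozovRoot_iff (h.memLp₁ n) (h.memLp₂ n) hm).1 (hT n)
    obtain ⟨x, s, hx, hs, hlim⟩ := exists_subseq_weak_limit hη hC₀.1 hτ hy
      (h.isNoisyDampedFlows hg₁ hg₂ hm hsub hC₀) (fun n => (hroot n).1) fun n => (hroot n).2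
    exact ⟨x, s, (hiff x).2 hx, hs, hlim⟩
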